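/- Let $\mathbb K$ be a field of characteristic $0$. Let $\mathcal A=\mathcal A(E,R)=T(E)/(R)$ be a (homogeneous) Koszul algebra, where $E$ is a $\mathbb Z$-graded vector space and $R\subseteq E\otimes E$ is a graded subspace, and let $\mathcal A^¡=\bigoplus_{n\ge 0}(\mathcal A^¡)^{(n)}$ be its Koszul dual coalgebra, i.e. the subcoalgebra of the tensor coalgebra $T^c(sE)$ with weight components $(\mathcal A^¡)^{(n)}=\bigcap_{i+2+j=n}(sE)^{\otimes i}\otimes s^2R\otimes (sE)^{\otimes j}$ (so $(\mathcal A^¡)^{(0)}=\mathbb K\,\mathrm I$ and $(\mathcal A^¡)^{(1)}=sE$). Let $\overline{\mathcal A}^¡=\bigoplus_{n\ge1}(\mathcal A^¡)^{(n)}$, and let $(V,\partial_V)$ be a chain complex over $\mathbb K$. On $\mathrm{Hom}(\mathcal A^¡,\mathrm{End}(V))$ consider the differential $\partial f=(\partial_V)_*f$, $(\partial f)(c)=[\partial_V,f(c)]$, the convolution product $(f\star g)(c)=\sum(-1)^{|g||c'|}f(c')g(c'')$, whose unit is $1:\mathrm I\mapsto \mathrm{id}_V$, and the graded commutator $[\,,\,]$.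 Let $\mathfrak g=\mathrm{Hom}(\overline{\mathcal A}^¡,\mathrm{End}(V))$ be the sub dg Lie algebra of the maps vanishing on $\mathrm I$, let $\mathfrak g_0$ be its degree $0$ part, let $\delta$ be the map $\mathrm I\mapsto\partial_V$ (extended by $0$ in positive weight), and let $\mathrm{MC}(\mathfrak g)=\{\alpha\in\mathfrak g_{-1}\mid \partial\alpha+\tfrac12[\alpha,\alpha]=0\}$. A homotopy $\mathcal A$-module structure on $V$ is a dg module structure on $(V,\partial_V)$ over the cobar construction $\mathcal A_\infty=\Omega\mathcal A^¡$, i.e. a morphism of dg algebras $\rho:\Omega\mathcal A^¡\to\mathrm{End}(V)$; denote by $\alpha_\rho\in\mathfrak g_{-1}$ the map $c\mapsto\rho(s^{-1}c)$ on $\overline{\mathcal A}^¡$. An $\infty$-isotopy $\rho\rightsquigarrow\rho'$ is a degree $0$ map $f:\mathcal A^¡\to\mathrm{End}(V)$ with $f(\mathrm I)=\mathrm{id}_V$ and $f\star(\delta+\alpha_\rho)=(\delta+\alpha_{\rho'})\star f$. Let $\infty\text{-}\mathsf{iso}$ be the set of all $\infty$-isotopies between homotopy $\mathcal A$-module structures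 on $V$. Then the following hold, all series below being finite in each weight. 1. The Baker–Campbell–Hausdorff series makes $\mathfrak g_0$ into a group $\Gamma=(\mathfrak g_0,\mathrm{BCH},0)$ (the gauge group), $\infty\text{-}\mathsf{iso}$ is a group under $\star$ with unit $1$, and the exponential $\lambda\mapsto e^\lambda=\sum_{k\ge0}\lambda^{\star k}/k!$ is an isomorphism of groups $\Gamma\cong(\infty\text{-}\mathsf{iso},\star,1)$. 2. The gauge group $\Gamma$ acts on $\mathrm{MC}(\mathfrak g)$ by $\delta+\lambda.\alpha=e^{\mathrm{ad}_\lambda}(\delta+\alpha)$. Its action groupoid is the Deligne groupoid $\mathsf{Deligne}(\mathfrak g)=(\mathrm{MC}(\mathfrak g),\Gamma)$: the objects are the Maurer–Cartan elements, and the morphisms $\alpha\to\beta$ are the $\lambda\in\Gamma$ with $\lambda.\alpha=\beta$. 3. The homotopy $\mathcal A$-module structures on $V$, with the $\infty$-isotopies as morphisms, the composite of $f:\rho\rightsquigarrow\rho'$ and $g:\rho'\rightsquigarrow\rho''$ being $g\star f$ and the identities being $1$, form a groupoid. The Deligne groupoid is isomorphic to this groupoid by the isomorphism that sends a Maurer–Cartan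 element $\alpha$ to the homotopy $\mathcal A$-module structure $\rho$ with $\alpha_\rho=\alpha$ and a morphism $\lambda$ to $e^\lambda$. -/

import Mathlib

universe u v w

namespace KoszulDeligne

noncomputable section

open scoped DirectSum
open TensorProduct

/-! ### Linear algebra in the tensor algebra -/

section TensorFacts

theorem mem_range_mapIncl_of_slices {K M N : Type*} [Field K] [AddCommGroup M] [Module K M]
    [AddCommGroup N] [Module K N] (X : Submodule K M) (Y : Submodule K N) (z : M ⊗[K] N)
    (hX : ∀ φ : N →ₗ[K] K, TensorProduct.rid K M (LinearMap.lTensor M φ z) ∈ X)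
    (hY : ∀ ψ : M →ₗ[K] K, TensorProduct.lid K N (LinearMap.rTensor N ψ z) ∈ Y) :
    ∃ t : X ⊗[K] Y, TensorProduct.map X.subtype Y.subtype t = z := by
  classical
  have h1 : LinearMap.rTensor N X.mkQ z = 0 := by
    let b := Module.Basis.ofVectorSpace K N
    apply (TensorProduct.equivFinsuppOfBasisRight (M := M ⧸ X) b).injective
    ext i
    rw [TensorProduct.equivFinsuppOfBasisRight_apply, map_zero, Finsupp.zero_apply]
    have := (Submodule.Quotient.mk_eq_zero X).2 (hX (b.coord i))
    rw [← this]
    clear this hX hY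
    induction z with
    | zero => simp
    | tmul x y => simp
    | add x y hx hy => simp only [map_add, hx, hy]; simp
  have h2 : LinearMap.lTensor M Y.mkQ z = 0 := by
    let b := Module.Basis.ofVectorSpace K M
    apply (TensorProduct.equivFinsuppOfBasisLeft (N := N ⧸ Y) b).injective
    ext i
    rw [TensorProduct.equivFinsuppOfBasisLeft_apply, map_zero, Finsupp.zero_apply]
    have := (Submodule.Quotient.mk_eq_zero Y).2 (hY (b.coord i))
    rw [← this]
    clear this hX hY h1
    induction z with
    | zero => simp
    | tmul x y => simp
    | add x y hx hy => simp only [map_add, hx, hy]; simp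
  obtain ⟨z1, rfl⟩ := (rTensor_exact N (LinearMap.exact_subtype_mkQ X) X.mkQ_surjective z).1 h1
  have h3 : LinearMap.lTensor X Y.mkQ z1 = 0 := by
    apply Module.Flat.rTensor_preserves_injective_linearMap (M := N ⧸ Y) X.subtype X.injective_subtype
    rw [map_zero, ← h2, ← LinearMap.comp_apply, ← LinearMap.comp_apply,
      LinearMap.rTensor_comp_lTensor, LinearMap.lTensor_comp_rTensor]
  obtain ⟨t, rfl⟩ := (lTensor_exact X (LinearMap.exact_subtype_mkQ Y) Y.mkQ_surjective z1).1 h3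
  exact ⟨t, by rw [← LinearMap.comp_apply, LinearMap.rTensor_comp_lTensor]⟩

variable {K M : Type*} [Field K] [AddCommGroup M] [Module K M]

theorem range_toTensorAlgebra (n : ℕ) :
    LinearMap.range (TensorPower.toTensorAlgebra : (⨂[K]^n M) →ₗ[K] TensorAlgebra K M) =
      LinearMap.range (TensorAlgebra.ι K : M →ₗ[K] TensorAlgebra K M) ^ n := by
  apply le_antisymm
  · rintro _ ⟨x, rfl⟩
    induction x using PiTensorProduct.induction_on with
    | smul_tprod r f =>
      rw [map_smul, TensorPower.toTensorAlgebra_tprod, TensorAlgebra.tprod_apply]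
      refine Submodule.smul_mem _ _ ?_
      clear r
      induction n with
      | zero => simp
      | succ n ih =>
        rw [List.ofFn_succ, List.prod_cons, pow_succ']
        exact Submodule.mul_mem_mul ⟨_, rfl⟩ (ih _)
    | add x y hx hy => rw [map_add]; exact Submodule.add_mem _ hx hy
  · intro x hx
    induction hx using Submodule.pow_induction_on_left' with
    | algebraMap r =>
      exact ⟨_, TensorPower.toTensorAlgebra_galgebra_toFun r⟩
    | add x y i hx hy ihx ihy => exact Submodule.add_mem _ ihx ihy
    | mem_mul m hm i x hx ih =>
      obtain ⟨m, rfl⟩ := hm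
      obtain ⟨x, rfl⟩ := ih
      have := (TensorPower.toTensorAlgebra_gMul (PiTensorProduct.tprod K fun _ : Fin 1 => m) x)
      rw [TensorPower.toTensorAlgebra_tprod, TensorAlgebra.tprod_apply] at this
      simp only [List.ofFn_succ, List.ofFn_zero, List.prod_cons, List.prod_nil, mul_one] at this
      rw [← this]
      have h : ∀ (k : ℕ), k = i + 1 → ∀ y : (⨂[K]^k M), TensorPower.toTensorAlgebra y ∈
          LinearMap.range (TensorPower.toTensorAlgebra :
            (⨂[K]^(i + 1) M) →ₗ[K] TensorAlgebra K M) := by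
        rintro k rfl y
        exact ⟨y, rfl⟩
      exact h _ (add_comm 1 i) _

theorem toTensorAlgebra_injective (n : ℕ) : Function.Injective
    (TensorPower.toTensorAlgebra : (⨂[K]^n M) →ₗ[K] TensorAlgebra K M) := by
  have h : ∀ x : (⨂[K]^n M), TensorAlgebra.toDirectSum (TensorPower.toTensorAlgebra x) =
      DirectSum.of (fun n => ⨂[K]^n M) n x := by
    intro x
    rw [← TensorAlgebra.toDirectSum_ofDirectSum (DirectSum.of (fun n => ⨂[K]^n M) n x)]
    congr 1
    exact ((DirectSum.toAddMonoid_of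
      (fun _ ↦ LinearMap.toAddMonoidHom TensorPower.toTensorAlgebra) _ _)).symm
  intro x y hxy
  apply DirectSum.of_injective (β := fun n => ⨂[K]^n M) n
  rw [← h, ← h, hxy]

theorem linearDisjoint_pow (p q : ℕ) :
    (LinearMap.range (TensorAlgebra.ι K : M →ₗ[K] TensorAlgebra K M) ^ p).LinearDisjoint
      (LinearMap.range (TensorAlgebra.ι K : M →ₗ[K] TensorAlgebra K M) ^ q) := by
  rw [← range_toTensorAlgebra, ← range_toTensorAlgebra]
  constructor
  refine (injective_iff_map_eq_zero _).2 fun x hx => ?_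
  obtain ⟨y, rfl⟩ := TensorProduct.map_surjective
    (TensorPower.toTensorAlgebra : (⨂[K]^p M) →ₗ[K] TensorAlgebra K M).surjective_rangeRestrict
    (TensorPower.toTensorAlgebra : (⨂[K]^q M) →ₗ[K] TensorAlgebra K M).surjective_rangeRestrict x
  have h : ∀ y, Submodule.mulMap _ _ (TensorProduct.map
      (TensorPower.toTensorAlgebra : (⨂[K]^p M) →ₗ[K] TensorAlgebra K M).rangeRestrict
      (TensorPower.toTensorAlgebra : (⨂[K]^q M) →ₗ[K] TensorAlgebra K M).rangeRestrict y) =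
      TensorPower.toTensorAlgebra (TensorPower.mulEquiv y) := by
    intro y
    induction y with
    | zero => simp
    | tmul a b =>
      rw [TensorProduct.map_tmul, Submodule.mulMap_tmul]
      exact (TensorPower.toTensorAlgebra_gMul a b).symm
    | add a b ha hb => simp only [map_add, ha, hb]
  rw [h, ← map_zero (TensorPower.toTensorAlgebra : (⨂[K]^(p+q) M) →ₗ[K] TensorAlgebra K M)] at hx
  have := toTensorAlgebra_injective _ hx
  rw [LinearEquiv.map_eq_zero_iff] at this
  rw [this, map_zero]

theorem mem_mul_of_forall_mem {S : Type*} [Ring S] [Algebra K S] {P Q : Submodule K S}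
    (h : P.LinearDisjoint Q) {ι κ : Sort*} {X : ι → Submodule K S} {Y : κ → Submodule K S}
    (hX : ∀ i, X i ≤ P) (hY : ∀ j, Y j ≤ Q) {c : S} (hc : c ∈ P * Q)
    (hcX : ∀ i, c ∈ X i * Q) (hcY : ∀ j, c ∈ P * Y j) :
    c ∈ (P ⊓ ⨅ i, X i) * (Q ⊓ ⨅ j, Y j) := by
  rw [← Submodule.mulMap_range] at hc
  obtain ⟨z, rfl⟩ := hc
  obtain ⟨t, rfl⟩ := mem_range_mapIncl_of_slices ((⨅ i, X i).comap P.subtype)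
    ((⨅ j, Y j).comap Q.subtype) z
    (by
      intro φ
      rw [Submodule.mem_comap, Submodule.mem_iInf]
      intro i
      have := hcX i
      rw [← Submodule.mulMap_range] at this
      obtain ⟨z', hz'⟩ := this
      rw [← Submodule.mulMap_comp_rTensor _ (hX i)] at hz'
      have := h.injective hz'
      rw [← this]
      clear this hz'
      induction z' with
      | zero => simp
      | tmul a b => simpa using Submodule.smul_mem _ _ a.2
      | add a b ha hb => simpa using Submodule.add_mem _ ha hb)
    (by
      intro φ
      rw [Submodule.mem_comap, Submodule.mem_iInf]
      intro i
      have := hcY i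
      rw [← Submodule.mulMap_range] at this
      obtain ⟨z', hz'⟩ := this
      rw [← Submodule.mulMap_comp_lTensor _ (hY i)] at hz'
      have := h.injective hz'
      rw [← this]
      clear this hz'
      induction z' with
      | zero => simp
      | tmul a b => simpa using Submodule.smul_mem _ _ b.2
      | add a b ha hb => simpa using Submodule.add_mem _ ha hb)
  clear hcX hcY
  induction t with
  | zero => simp
  | tmul a b => exact Submodule.mul_mem_mul ⟨a.1.2, a.2⟩ ⟨b.1.2, b.2⟩
  | add a b ha hb => simpa using Submodule.add_mem _ ha hb

end TensorFacts

open TensorProduct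


/-- For a graded module `M` (with `deg i` the elements of degree `i`), the elements of degree `i`
of the tensor algebra on the `s`-fold suspension of `M`: the span of the words
`s x₁ ⋯ s xₙ` with `x_k` homogeneous of degree `d_k` and `∑ (d_k + s) = i`. -/
def tensorDegree (K : Type*) [Field K] {M : Type*} [AddCommGroup M] [Module K M]
    (deg : ℤ → Submodule K M) (s i : ℤ) : Submodule K (TensorAlgebra K M) :=
  Submodule.span K {t | ∃ l : List (ℤ × M), (∀ p ∈ l, p.2 ∈ deg p.1) ∧
    (l.map fun p => p.1 + s).sum = i ∧ t = (l.map fun p => TensorAlgebra.ι K p.2).prod}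

/-! ### Quadratic data and the Koszul dual coalgebra -/

section Graded

variable {K : Type u} [Field K] (E : ℤ → ModuleCat.{v} K)

/-- The homogeneous elements of degree `i` of the graded vector space `⨁ i, E i`. -/
def homDegree (i : ℤ) : Submodule K (⨁ i, E i) :=
  LinearMap.range (DirectSum.lof K ℤ (fun i => E i) i)

/-- The operator `x ↦ (-1) ^ (|x| + s) x` on the graded vector space `⨁ i, E i`. -/
def signOp (s : ℤ) : (⨁ i, E i) →ₗ[K] (⨁ i, E i) :=
  DirectSum.toModule K ℤ _ fun i => ((-1 : K) ^ (i + s)) • DirectSum.lof K ℤ (fun i => E i) i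

/-- The elements of total degree `n` of `(⨁ i, E i) ⊗ (⨁ i, E i)`. -/
def tensorSqDegree (n : ℤ) : Submodule K ((⨁ i, E i) ⊗[K] (⨁ i, E i)) :=
  ⨆ (i : ℤ) (j : ℤ) (_ : i + j = n), LinearMap.range
    (TensorProduct.map (homDegree E i).subtype (homDegree E j).subtype)

end Graded

/-- Homogeneous quadratic data `(E, R)`: a graded vector space `E` and a graded subspace `R` of
`E ⊗ E`. -/
structure QuadraticData (K : Type u) [Field K] where
  /-- the graded space of generators -/
  E : ℤ → ModuleCat.{v} K
  /-- the space of relators -/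
  R : Submodule K ((⨁ i, E i) ⊗[K] (⨁ i, E i))
  /-- `R` is spanned by homogeneous elements -/
  homogeneous : R ≤ ⨆ n : ℤ, R ⊓ tensorSqDegree E n

namespace QuadraticData

variable {K : Type u} [Field K] (Q : QuadraticData.{u, v} K)

/-- The total space of the generators. -/
abbrev Gen : Type v := ⨁ i, Q.E i

/-- The map `E ⊗ E → T(E)`. -/
def mulGen : Q.Gen ⊗[K] Q.Gen →ₗ[K] TensorAlgebra K Q.Gen :=
  LinearMap.mul' K (TensorAlgebra K Q.Gen) ∘ₗ
    TensorProduct.map (TensorAlgebra.ι K) (TensorAlgebra.ι K)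

/-- The quadratic algebra `A = A(E, R) = T(E) / (R)`. -/
abbrev Alg : Type (max u v) :=
  RingQuot fun a b : TensorAlgebra K Q.Gen => (∃ r ∈ Q.R, Q.mulGen r = a) ∧ b = 0

/-- The space `(sE)^{⊗ n}` inside the tensor (co)algebra on the suspension `sE` of `E`. As an
ungraded space, `sE` is identified with `E`. -/
def words (n : ℕ) : Submodule K (TensorAlgebra K Q.Gen) :=
  LinearMap.range (TensorAlgebra.ι K : Q.Gen →ₗ[K] TensorAlgebra K Q.Gen) ^ n

/-- The space `s²R`: the image of `R` under `s ⊗ s`, that is `x ⊗ y ↦ (-1)^{|x|} sx ⊗ sy`. -/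
def suspR : Submodule K (TensorAlgebra K Q.Gen) :=
  Q.R.map (Q.mulGen ∘ₗ TensorProduct.map (signOp Q.E 0) LinearMap.id)

/-- The weight `n` component of the Koszul dual coalgebra `A^¡ = C(sE, s²R)`, that is
`⋂_{i + 2 + j = n} (sE)^{⊗ i} ⊗ s²R ⊗ (sE)^{⊗ j}` inside `(sE)^{⊗ n}` (so `K` for `n = 0`, `sE` for
`n = 1` and `s²R` for `n = 2`). -/
def dualWeight (n : ℕ) : Submodule K (TensorAlgebra K Q.Gen) :=
  Q.words n ⊓ ⨅ p : {p : ℕ × ℕ // p.1 + 2 + p.2 = n},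
    Q.words p.1.1 * Q.suspR * Q.words p.1.2

theorem suspR_le : Q.suspR ≤ Q.words 2 := by
  rintro _ ⟨r, -, rfl⟩
  rw [LinearMap.comp_apply]
  generalize (TensorProduct.map (signOp Q.E 0) LinearMap.id) r = t
  induction t with
  | zero => simp
  | tmul x y =>
    rw [words, pow_two]
    exact Submodule.mul_mem_mul ⟨x, rfl⟩ ⟨y, rfl⟩
  | add x y hx hy => rw [map_add]; exact Submodule.add_mem _ hx hy

theorem words_mul (p q : ℕ) : Q.words p * Q.words q = Q.words (p + q) := (pow_add _ _ _).symm

theorem dualWeight_le_mul {p q n : ℕ} (h : p + q = n) :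
    Q.dualWeight n ≤ Q.dualWeight p * Q.dualWeight q := by
  subst h
  rintro c ⟨hc, hc'⟩
  have hc'' := fun i => (Submodule.mem_iInf _).1 hc' i
  refine mem_mul_of_forall_mem (linearDisjoint_pow p q) ?_ ?_ ?_ ?_ ?_
  · rintro ⟨⟨i, j⟩, rfl⟩
    change Q.words i * Q.suspR * Q.words j ≤ Q.words (i + 2 + j)
    rw [← Q.words_mul, ← Q.words_mul]
    gcongr
    exact Q.suspR_le
  · rintro ⟨⟨i, j⟩, rfl⟩
    change Q.words i * Q.suspR * Q.words j ≤ Q.words (i + 2 + j)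
    rw [← Q.words_mul, ← Q.words_mul]
    gcongr
    exact Q.suspR_le
  · change c ∈ Q.words p * Q.words q
    rwa [Q.words_mul]
  · rintro ⟨⟨i, j⟩, hp⟩
    have := hc'' ⟨(i, j + q), by simp only at hp ⊢; omega⟩
    rwa [← Q.words_mul, ← mul_assoc] at this
  · rintro ⟨⟨i, j⟩, hp⟩
    have := hc'' ⟨(p + i, j), by simp only at hp ⊢; omega⟩
    rwa [← Q.words_mul, mul_assoc, mul_assoc, ← mul_assoc (Q.words i)] at this

theorem mulMap_words_injective (p q : ℕ) :
    Function.Injective (Submodule.mulMap (Q.dualWeight p) (Q.words q)) :=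
  ((linearDisjoint_pow p q).of_le_left_of_flat inf_le_left).injective

theorem mulMap_dualWeight_injective (p q : ℕ) :
    Function.Injective (Submodule.mulMap (Q.dualWeight p) (Q.dualWeight q)) :=
  ((linearDisjoint_pow p q).of_le_of_flat_left inf_le_left inf_le_left).injective

/-- The underlying graded vector space `⨁ₙ (A^¡)^{(n)}` of the Koszul dual coalgebra. -/
def Dual : Type (max u v) := ⨁ n, Q.dualWeight n

instance : AddCommGroup Q.Dual := inferInstanceAs (AddCommGroup (⨁ n, Q.dualWeight n))

instance : Module K Q.Dual := inferInstanceAs (Module K (⨁ n, Q.dualWeight n))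

/-- The inclusion of the weight `n` component. -/
def incl (n : ℕ) : Q.dualWeight n →ₗ[K] Q.Dual :=
  DirectSum.lof K ℕ (fun n => Q.dualWeight n) n

/-- The weight `n` component of an element of the Koszul dual coalgebra, in `(sE)^{⊗ n}`. -/
def comp (n : ℕ) : Q.Dual →ₗ[K] TensorAlgebra K Q.Gen :=
  (Q.dualWeight n).subtype ∘ₗ DirectSum.component K ℕ (fun n => Q.dualWeight n) n

/-- A linear map out of the Koszul dual coalgebra, given on each weight component. -/
def desc {M : Type*} [AddCommGroup M] [Module K M] (f : ∀ n, Q.dualWeight n →ₗ[K] M) :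
    Q.Dual →ₗ[K] M :=
  DirectSum.toModule K ℕ M f

/-- The component `(A^¡)^{(n)} → (A^¡)^{(p)} ⊗ (A^¡)^{(q)}`, `n = p + q`, of the deconcatenation
coproduct: the inverse of the concatenation of words. -/
def deconc {p q n : ℕ} (h : p + q = n) :
    Q.dualWeight n →ₗ[K] Q.dualWeight p ⊗[K] Q.dualWeight q :=
  (LinearEquiv.ofInjective _ (Q.mulMap_dualWeight_injective p q)).symm.toLinearMap ∘ₗ
    Submodule.inclusion ((Q.dualWeight_le_mul h).trans (Submodule.mulMap_range _ _).ge)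

theorem mulMap_deconc {p q n : ℕ} (h : p + q = n) (c : Q.dualWeight n) :
    Submodule.mulMap _ _ (Q.deconc h c) = (c : TensorAlgebra K Q.Gen) :=
  congrArg Subtype.val
    ((LinearEquiv.ofInjective _ (Q.mulMap_dualWeight_injective p q)).apply_symm_apply _)

/-- The coproduct (deconcatenation) and the counit of the Koszul dual coalgebra. -/
instance : CoalgebraStruct K Q.Dual where
  comul := Q.desc fun n => ∑ p ∈ (Finset.HasAntidiagonal.antidiagonal n).attach,
    TensorProduct.map (Q.incl p.1.1) (Q.incl p.1.2) ∘ₗ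
      Q.deconc (Finset.HasAntidiagonal.mem_antidiagonal.1 p.2)
  counit := TensorAlgebra.algebraMapInv.toLinearMap ∘ₗ Q.comp 0


theorem comul_incl (n : ℕ) (c : Q.dualWeight n) :
    CoalgebraStruct.comul (R := K) (Q.incl n c) =
      ∑ p ∈ (Finset.HasAntidiagonal.antidiagonal n).attach,
        TensorProduct.map (Q.incl p.1.1) (Q.incl p.1.2)
          (Q.deconc (Finset.HasAntidiagonal.mem_antidiagonal.1 p.2) c) := by
  change DirectSum.toModule K ℕ _ _ (DirectSum.lof K ℕ (fun n => Q.dualWeight n) n c) = _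
  rw [DirectSum.toModule_lof, LinearMap.sum_apply]
  rfl

theorem comp_incl_self (n : ℕ) (c : Q.dualWeight n) : Q.comp n (Q.incl n c) = c :=
  congrArg Subtype.val
    (DirectSum.component.lof_self (M := fun n => Q.dualWeight n) K n c)

theorem comp_incl_of_ne {m n : ℕ} (h : m ≠ n) (c : Q.dualWeight m) : Q.comp n (Q.incl m c) = 0 :=
  congrArg Subtype.val ((DirectSum.component.of (M := fun n => Q.dualWeight n) K n m c).trans
    (dif_neg h))

theorem dual_hom_ext {M : Type*} [AddCommGroup M] [Module K M] {f g : Q.Dual →ₗ[K] M}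
    (h : ∀ n c, f (Q.incl n c) = g (Q.incl n c)) : f = g :=
  DirectSum.linearMap_ext K fun n => LinearMap.ext fun c => h n c

/-- The concatenation of three words. -/
def mulMap₃ (p q r : ℕ) :
    Q.dualWeight p ⊗[K] (Q.dualWeight q ⊗[K] Q.dualWeight r) →ₗ[K] TensorAlgebra K Q.Gen :=
  LinearMap.mul' K _ ∘ₗ
    TensorProduct.map (Q.dualWeight p).subtype (Submodule.mulMap (Q.dualWeight q) (Q.dualWeight r))

theorem mulMap₃_injective (p q r : ℕ) : Function.Injective (Q.mulMap₃ p q r) := by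
  have hm : ∀ x, Submodule.mulMap (Q.dualWeight q) (Q.dualWeight r) x ∈ Q.words (q + r) := by
    intro x
    rw [← Q.words_mul]
    refine (?_ : Q.dualWeight q * Q.dualWeight r ≤ _) ?_
    · gcongr <;> exact inf_le_left
    · rw [← Submodule.mulMap_range]
      exact ⟨x, rfl⟩
  let g := LinearMap.codRestrict (Q.words (q + r)) _ hm
  have hg : Function.Injective g := fun x y hxy =>
    Q.mulMap_dualWeight_injective q r (congrArg Subtype.val hxy)
  have h : Q.mulMap₃ p q r =
      Submodule.mulMap (Q.dualWeight p) (Q.words (q + r)) ∘ₗ g.lTensor (Q.dualWeight p) := by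
    ext a b c
    rfl
  rw [h]
  exact (Q.mulMap_words_injective p (q + r)).comp
    (Module.Flat.lTensor_preserves_injective_linearMap (M := Q.dualWeight p) g hg)

theorem deconc_assoc {p q r m m' n : ℕ} (h1 : m + r = n) (h2 : p + q = m) (h3 : p + m' = n)
    (h4 : q + r = m') (c : Q.dualWeight n) :
    TensorProduct.assoc K _ _ _ ((Q.deconc h2).rTensor _ (Q.deconc h1 c)) =
      (Q.deconc h4).lTensor _ (Q.deconc h3 c) := by
  apply Q.mulMap₃_injective
  have e1 : ∀ z : Q.dualWeight p ⊗[K] Q.dualWeight m',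
      Q.mulMap₃ p q r ((Q.deconc h4).lTensor _ z) = Submodule.mulMap _ _ z := by
    intro z
    induction z with
    | zero => simp
    | tmul a b => exact congrArg (a.1 * ·) (Q.mulMap_deconc h4 b)
    | add a b ha hb => simp only [map_add, ha, hb]
  have e2 : ∀ (z : Q.dualWeight p ⊗[K] Q.dualWeight q) (b : Q.dualWeight r),
      Q.mulMap₃ p q r (TensorProduct.assoc K _ _ _ (z ⊗ₜ b)) = Submodule.mulMap _ _ z * b.1 := by
    intro z b
    induction z with
    | zero => simp
    | tmul a a' => exact (mul_assoc a.1 a'.1 b.1).symm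
    | add a b ha hb => simp only [map_add, TensorProduct.add_tmul, ha, hb, add_mul]
  have e3 : ∀ z : Q.dualWeight m ⊗[K] Q.dualWeight r,
      Q.mulMap₃ p q r (TensorProduct.assoc K _ _ _ ((Q.deconc h2).rTensor _ z)) =
        Submodule.mulMap _ _ z := by
    intro z
    induction z with
    | zero => simp
    | tmul a b =>
      rw [LinearMap.rTensor_tmul, e2, Q.mulMap_deconc]
      rfl
    | add a b ha hb => simp only [map_add, ha, hb]
  rw [e1, e3, Q.mulMap_deconc, Q.mulMap_deconc]

theorem dualWeight_zero : Q.dualWeight 0 = 1 := by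
  have : IsEmpty {p : ℕ × ℕ // p.1 + 2 + p.2 = 0} := ⟨fun p => by have := p.2; omega⟩
  rw [dualWeight, iInf_of_empty, inf_top_eq, words, pow_zero]

theorem counit_incl_succ (n : ℕ) (c : Q.dualWeight (n + 1)) :
    CoalgebraStruct.counit (R := K) (Q.incl (n + 1) c) = 0 := by
  change TensorAlgebra.algebraMapInv (Q.comp 0 (Q.incl (n + 1) c)) = 0
  rw [Q.comp_incl_of_ne (by omega), map_zero]

theorem counit_incl_zero (c : Q.dualWeight 0) :
    algebraMap K (TensorAlgebra K Q.Gen) (CoalgebraStruct.counit (R := K) (Q.incl 0 c)) = c := by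
  change algebraMap K (TensorAlgebra K Q.Gen)
    (TensorAlgebra.algebraMapInv (Q.comp 0 (Q.incl 0 c))) = c
  rw [Q.comp_incl_self]
  obtain ⟨c, hc⟩ := c
  have hc' := hc
  rw [dualWeight_zero, Submodule.mem_one] at hc'
  obtain ⟨k, rfl⟩ := hc'
  rw [TensorAlgebra.algebraMap_leftInverse]

/-- The element `I ∈ A^¡`, spanning the weight `0` component. -/
def unitI : Q.Dual := Q.incl 0 ⟨1, by rw [dualWeight_zero]; exact Submodule.mem_one.2 ⟨1, map_one _⟩⟩

theorem sum_antidiagonal_assoc {M : Type*} [AddCommMonoid M] (n : ℕ)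
    (F : ∀ p q r : ℕ, p + q + r = n → M) :
    ∑ x ∈ (Finset.HasAntidiagonal.antidiagonal n).attach,
      ∑ s ∈ (Finset.HasAntidiagonal.antidiagonal x.1.1).attach,
        F s.1.1 s.1.2 x.1.2 (by
          have h1 := Finset.HasAntidiagonal.mem_antidiagonal.1 x.2
          have h2 := Finset.HasAntidiagonal.mem_antidiagonal.1 s.2
          omega) =
    ∑ x ∈ (Finset.HasAntidiagonal.antidiagonal n).attach,
      ∑ s ∈ (Finset.HasAntidiagonal.antidiagonal x.1.2).attach,
        F x.1.1 s.1.1 s.1.2 (by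
          have h1 := Finset.HasAntidiagonal.mem_antidiagonal.1 x.2
          have h2 := Finset.HasAntidiagonal.mem_antidiagonal.1 s.2
          omega) := by
  let G : ℕ → ℕ → ℕ → M := fun p q r => if h : p + q + r = n then F p q r h else 0
  have hG : ∀ p q r h, F p q r h = G p q r := fun p q r h => (dif_pos h).symm
  simp only [hG]
  clear_value G
  have h1 : ∀ x : ℕ × ℕ, ∑ s ∈ (Finset.HasAntidiagonal.antidiagonal x.1).attach,
      G s.1.1 s.1.2 x.2 = ∑ s ∈ Finset.HasAntidiagonal.antidiagonal x.1, G s.1 s.2 x.2 :=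
    fun x => Finset.sum_attach _ (fun s : ℕ × ℕ => G s.1 s.2 x.2)
  have h2 : ∀ x : ℕ × ℕ, ∑ s ∈ (Finset.HasAntidiagonal.antidiagonal x.2).attach,
      G x.1 s.1.1 s.1.2 = ∑ s ∈ Finset.HasAntidiagonal.antidiagonal x.2, G x.1 s.1 s.2 :=
    fun x => Finset.sum_attach _ (fun s : ℕ × ℕ => G x.1 s.1 s.2)
  refine (Finset.sum_attach _ (fun x : ℕ × ℕ =>
    ∑ s ∈ (Finset.HasAntidiagonal.antidiagonal x.1).attach, G s.1.1 s.1.2 x.2)).trans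
    (Eq.trans ?_ (Finset.sum_attach _ (fun x : ℕ × ℕ =>
    ∑ s ∈ (Finset.HasAntidiagonal.antidiagonal x.2).attach, G x.1 s.1.1 s.1.2)).symm)
  simp only [h1, h2]
  rw [Finset.sum_sigma', Finset.sum_sigma']
  apply Finset.sum_nbij' (fun ⟨⟨_i, j⟩, ⟨k, l⟩⟩ ↦ ⟨(k, l + j), (l, j)⟩)
    (fun ⟨⟨i, _j⟩, ⟨k, l⟩⟩ ↦ ⟨(i + k, l), (i, k)⟩)
  · rintro ⟨⟨i, j⟩, ⟨k, l⟩⟩ h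
    obtain ⟨h1, h2⟩ := Finset.mem_sigma.1 h
    obtain rfl : i + j = n := by simpa using h1
    obtain rfl : k + l = i := by simpa using h2
    simp [add_assoc]
  · rintro ⟨⟨i, j⟩, ⟨k, l⟩⟩ h
    obtain ⟨h1, h2⟩ := Finset.mem_sigma.1 h
    obtain rfl : i + j = n := by simpa using h1
    obtain rfl : k + l = j := by simpa using h2
    simp [add_assoc]
  · rintro ⟨⟨i, j⟩, ⟨k, l⟩⟩ h
    obtain rfl : k + l = i := by simpa using (Finset.mem_sigma.1 h).2
    rfl
  · rintro ⟨⟨i, j⟩, ⟨k, l⟩⟩ h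
    obtain rfl : k + l = j := by simpa using (Finset.mem_sigma.1 h).2
    rfl
  · rintro ⟨⟨i, j⟩, ⟨k, l⟩⟩ h
    rfl

/-- The Koszul dual coalgebra `A^¡` is a (coassociative, counital) coalgebra. -/
instance : Coalgebra K Q.Dual where
  coassoc := by
    refine Q.dual_hom_ext fun n c => ?_
    simp only [LinearMap.comp_apply, comul_incl, map_sum, LinearEquiv.coe_coe]
    have hL : ∀ (p : {p // p ∈ Finset.HasAntidiagonal.antidiagonal n}),
      TensorProduct.assoc K _ _ _ (LinearMap.rTensor Q.Dual (CoalgebraStruct.comul (R := K))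
        (TensorProduct.map (Q.incl p.1.1) (Q.incl p.1.2)
          (Q.deconc (Finset.HasAntidiagonal.mem_antidiagonal.1 p.2) c))) =
      ∑ s ∈ (Finset.HasAntidiagonal.antidiagonal p.1.1).attach,
        TensorProduct.map (Q.incl s.1.1) (TensorProduct.map (Q.incl s.1.2) (Q.incl p.1.2))
          (TensorProduct.assoc K _ _ _ ((Q.deconc
            (Finset.HasAntidiagonal.mem_antidiagonal.1 s.2)).rTensor _
              (Q.deconc (Finset.HasAntidiagonal.mem_antidiagonal.1 p.2) c))) := by
      intro p
      generalize Q.deconc (Finset.HasAntidiagonal.mem_antidiagonal.1 p.2) c = z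
      induction z with
      | zero => simp
      | tmul a b =>
        simp only [TensorProduct.map_tmul, LinearMap.rTensor_tmul, comul_incl,
          TensorProduct.sum_tmul, map_sum]
        refine Finset.sum_congr rfl fun s _ => ?_
        rw [TensorProduct.map_map_assoc, TensorProduct.map_tmul]
      | add a b ha hb => simp only [map_add, ha, hb, Finset.sum_add_distrib]
    have hR : ∀ (p : {p // p ∈ Finset.HasAntidiagonal.antidiagonal n}),
      LinearMap.lTensor Q.Dual (CoalgebraStruct.comul (R := K))
        (TensorProduct.map (Q.incl p.1.1) (Q.incl p.1.2)
          (Q.deconc (Finset.HasAntidiagonal.mem_antidiagonal.1 p.2) c)) =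
      ∑ s ∈ (Finset.HasAntidiagonal.antidiagonal p.1.2).attach,
        TensorProduct.map (Q.incl p.1.1) (TensorProduct.map (Q.incl s.1.1) (Q.incl s.1.2))
          ((Q.deconc (Finset.HasAntidiagonal.mem_antidiagonal.1 s.2)).lTensor _
              (Q.deconc (Finset.HasAntidiagonal.mem_antidiagonal.1 p.2) c)) := by
      intro p
      generalize Q.deconc (Finset.HasAntidiagonal.mem_antidiagonal.1 p.2) c = z
      induction z with
      | zero => simp
      | tmul a b =>
        simp only [TensorProduct.map_tmul, LinearMap.lTensor_tmul, comul_incl,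
          TensorProduct.tmul_sum]
      | add a b ha hb => simp only [map_add, ha, hb, Finset.sum_add_distrib]
    simp only [hL, hR]
    refine Eq.trans ?_ ((sum_antidiagonal_assoc n fun p q r h =>
      TensorProduct.map (Q.incl p) (TensorProduct.map (Q.incl q) (Q.incl r))
        ((Q.deconc rfl).lTensor _ (Q.deconc ((add_assoc p q r).symm.trans h) c))).trans ?_)
    · refine Finset.sum_congr rfl fun x _ => Finset.sum_congr rfl fun s _ => ?_
      rw [Q.deconc_assoc]
    · refine Finset.sum_congr rfl fun x _ => Finset.sum_congr rfl fun s _ => ?_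
      obtain ⟨⟨p, m⟩, h1⟩ := x
      obtain ⟨⟨q, r⟩, h2⟩ := s
      have h3 : q + r = m := Finset.HasAntidiagonal.mem_antidiagonal.1 h2
      subst h3
      rfl
  rTensor_counit_comp_comul := by
    refine Q.dual_hom_ext fun n c => ?_
    rw [LinearMap.comp_apply, comul_incl, map_sum, Finset.sum_eq_single
      ⟨(0, n), Finset.HasAntidiagonal.mem_antidiagonal.2 (zero_add n)⟩ _ (by simp)]
    · have h : ∀ z : Q.dualWeight 0 ⊗[K] Q.dualWeight n, ∃ y : Q.dualWeight n,
          y.1 = Submodule.mulMap _ _ z ∧ LinearMap.rTensor Q.Dual (CoalgebraStruct.counit (R := K))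
            (TensorProduct.map (Q.incl 0) (Q.incl n) z) = 1 ⊗ₜ Q.incl n y := by
        intro z
        induction z with
        | zero => exact ⟨0, by simp⟩
        | tmul a b =>
          refine ⟨CoalgebraStruct.counit (R := K) (Q.incl 0 a) • b, ?_, ?_⟩
          · rw [Submodule.mulMap_tmul, ← Q.counit_incl_zero a, Submodule.coe_smul, Algebra.smul_def]
          · rw [TensorProduct.map_tmul, LinearMap.rTensor_tmul, map_smul, ← TensorProduct.smul_tmul,
              smul_eq_mul, mul_one]
        | add a b ha hb =>
          obtain ⟨x, hx, hx'⟩ := ha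
          obtain ⟨y, hy, hy'⟩ := hb
          exact ⟨x + y, by simp [hx, hy], by simp [hx', hy', TensorProduct.tmul_add]⟩
      obtain ⟨y, hy, hy'⟩ := h (Q.deconc (zero_add n) c)
      rw [Q.mulMap_deconc] at hy
      rw [hy', Subtype.ext hy]
      rfl
    · rintro ⟨⟨_ | p, q⟩, hpq⟩ - hne
      · obtain rfl : q = n := by simpa using hpq
        exact absurd rfl hne
      · generalize Q.deconc (Finset.HasAntidiagonal.mem_antidiagonal.1 hpq) c = z
        induction z with
        | zero => simp
        | tmul a b => simp [counit_incl_succ]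
        | add a b ha hb => rw [map_add, map_add, ha, hb, add_zero]
  lTensor_counit_comp_comul := by
    refine Q.dual_hom_ext fun n c => ?_
    rw [LinearMap.comp_apply, comul_incl, map_sum, Finset.sum_eq_single
      ⟨(n, 0), Finset.HasAntidiagonal.mem_antidiagonal.2 (add_zero n)⟩ _ (by simp)]
    · have h : ∀ z : Q.dualWeight n ⊗[K] Q.dualWeight 0, ∃ y : Q.dualWeight n,
          y.1 = Submodule.mulMap _ _ z ∧ LinearMap.lTensor Q.Dual (CoalgebraStruct.counit (R := K))
            (TensorProduct.map (Q.incl n) (Q.incl 0) z) = Q.incl n y ⊗ₜ 1 := by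
        intro z
        induction z with
        | zero => exact ⟨0, by simp⟩
        | tmul a b =>
          refine ⟨CoalgebraStruct.counit (R := K) (Q.incl 0 b) • a, ?_, ?_⟩
          · rw [Submodule.mulMap_tmul, ← Q.counit_incl_zero b, Submodule.coe_smul,
              ← Algebra.commutes, Algebra.smul_def]
          · rw [TensorProduct.map_tmul, LinearMap.lTensor_tmul, map_smul, TensorProduct.smul_tmul,
              smul_eq_mul, mul_one]
        | add a b ha hb =>
          obtain ⟨x, hx, hx'⟩ := ha
          obtain ⟨y, hy, hy'⟩ := hb
          exact ⟨x + y, by simp [hx, hy], by simp [hx', hy', TensorProduct.add_tmul]⟩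
      obtain ⟨y, hy, hy'⟩ := h (Q.deconc (add_zero n) c)
      rw [Q.mulMap_deconc] at hy
      rw [hy', Subtype.ext hy]
      rfl
    · rintro ⟨⟨p, _ | q⟩, hpq⟩ - hne
      · obtain rfl : p = n := by simpa using hpq
        exact absurd rfl hne
      · generalize Q.deconc (Finset.HasAntidiagonal.mem_antidiagonal.1 hpq) c = z
        induction z with
        | zero => simp
        | tmul a b => simp [counit_incl_succ]
        | add a b ha hb => rw [map_add, map_add, ha, hb, add_zero]

/-- The elements of (homological) degree `i` of the Koszul dual coalgebra. -/
def dualDegree (i : ℤ) : Submodule K Q.Dual :=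
  ⨅ n, (tensorDegree K (homDegree Q.E) 1 i).comap (Q.comp n)

/-- The algebra automorphism `x ↦ (-1)^{|x|} x` of the tensor algebra on `sE`. -/
def parity : TensorAlgebra K Q.Gen →ₐ[K] TensorAlgebra K Q.Gen :=
  TensorAlgebra.lift K (TensorAlgebra.ι K ∘ₗ signOp Q.E 1)

theorem signOp_lof (E : ℤ → ModuleCat.{v} K) (s i : ℤ) (x : E i) :
    signOp E s (DirectSum.lof K ℤ (fun i => E i) i x) =
      ((-1 : K) ^ (i + s)) • DirectSum.lof K ℤ (fun i => E i) i x := by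
  rw [signOp, DirectSum.toModule_lof, LinearMap.smul_apply]

theorem signOp_sq_mem {r : Q.Gen ⊗[K] Q.Gen} (hr : r ∈ Q.R) :
    TensorProduct.map (signOp Q.E 1) (signOp Q.E 1) r ∈ Q.R := by
  have h : Q.R ≤ Q.R.comap (TensorProduct.map (signOp Q.E 1) (signOp Q.E 1)) := by
    refine Q.homogeneous.trans (iSup_le fun n => ?_)
    rintro x ⟨hx, hx'⟩
    have key : tensorSqDegree Q.E n ≤ LinearMap.ker
        (TensorProduct.map (signOp Q.E 1) (signOp Q.E 1) - ((-1 : K) ^ n) • LinearMap.id) := by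
      refine iSup_le fun i => iSup_le fun j => iSup_le fun hij => ?_
      rintro _ ⟨t, rfl⟩
      induction t with
      | zero => simp
      | tmul a b =>
        obtain ⟨_, a, rfl⟩ := a
        obtain ⟨_, b, rfl⟩ := b
        rw [LinearMap.mem_ker, LinearMap.sub_apply, sub_eq_zero]
        simp only [TensorProduct.map_tmul, Submodule.subtype_apply, signOp_lof,
          LinearMap.smul_apply, LinearMap.id_apply, TensorProduct.tmul_smul,
          TensorProduct.smul_tmul', smul_smul]
        congr 2
        rw [← hij, zpow_add₀ (by simp), zpow_add₀ (by simp), zpow_add₀ (by simp)]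
        ring
      | add a b ha hb => rw [map_add]; exact Submodule.add_mem _ ha hb
    have := key hx'
    rw [LinearMap.mem_ker, LinearMap.sub_apply, sub_eq_zero] at this
    rw [Submodule.mem_comap, this]
    exact Submodule.smul_mem _ _ hx
  exact h hr

theorem map_parity_words (n : ℕ) : (Q.words n).map Q.parity.toLinearMap ≤ Q.words n := by
  rw [words, Submodule.map_pow]
  gcongr
  rintro _ ⟨_, ⟨x, rfl⟩, rfl⟩
  exact ⟨signOp Q.E 1 x, by simp [parity]⟩

theorem map_parity_suspR : Q.suspR.map Q.parity.toLinearMap ≤ Q.suspR := by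
  rintro _ ⟨_, ⟨r, hr, rfl⟩, rfl⟩
  refine ⟨_, Q.signOp_sq_mem hr, ?_⟩
  have hc : ∀ x : Q.Gen, signOp Q.E 0 (signOp Q.E 1 x) = signOp Q.E 1 (signOp Q.E 0 x) := by
    intro x
    induction x using DirectSum.induction_on with
    | zero => simp
    | of i x =>
      rw [← DirectSum.lof_eq_of K]
      simp only [signOp_lof, map_smul, smul_smul, mul_comm]
    | add x y hx hy => simp only [map_add, hx, hy]
  generalize r = t
  induction t with
  | zero => simp
  | tmul a b => simp [mulGen, parity, hc]
  | add a b ha hb => simp only [map_add, ha, hb]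

theorem parity_mem (n : ℕ) (c : TensorAlgebra K Q.Gen) (hc : c ∈ Q.dualWeight n) :
    Q.parity.toLinearMap c ∈ Q.dualWeight n := by
  refine ⟨Q.map_parity_words n ⟨c, hc.1, rfl⟩, ?_⟩
  rw [SetLike.mem_coe, Submodule.mem_iInf]
  intro p
  have h := (Submodule.mem_iInf _).1 hc.2 p
  have h' : (Q.words p.1.1 * Q.suspR * Q.words p.1.2).map Q.parity.toLinearMap ≤
      Q.words p.1.1 * Q.suspR * Q.words p.1.2 := by
    rw [Submodule.map_mul, Submodule.map_mul]
    gcongr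
    exacts [Q.map_parity_words _, Q.map_parity_suspR, Q.map_parity_words _]
  exact h' ⟨c, h, rfl⟩

/-- The sign operator `c ↦ (-1)^{|c|} c` of the Koszul dual coalgebra. -/
def sign : Q.Dual →ₗ[K] Q.Dual :=
  Q.desc fun n => Q.incl n ∘ₗ Q.parity.toLinearMap.restrict (Q.parity_mem n)

/-! ### Koszul algebras -/

/-- The twisting morphism `κ : A^¡ → A`, `A^¡ ↠ sE ≅ E ↪ A`. -/
def kappa : Q.Dual →ₗ[K] Q.Alg :=
  (RingQuot.mkAlgHom K _).toLinearMap ∘ₗ Q.comp 1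

/-- The differential `c ⊗ a ↦ ∑ (-1)^{|c'|} c' ⊗ κ(c'') a` of the Koszul complex `A^¡ ⊗_κ A`. -/
def koszulDiff : Q.Dual ⊗[K] Q.Alg →ₗ[K] Q.Dual ⊗[K] Q.Alg :=
  (LinearMap.mul' K Q.Alg).lTensor Q.Dual ∘ₗ
    (TensorProduct.assoc K Q.Dual Q.Alg Q.Alg).toLinearMap ∘ₗ
      (TensorProduct.map Q.sign Q.kappa ∘ₗ CoalgebraStruct.comul).rTensor Q.Alg

/-- The quadratic algebra `A(E, R)` is Koszul: its Koszul complex is acyclic, that is its homology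
is spanned by the class of `I ⊗ 1`. -/
def IsKoszul : Prop :=
  LinearMap.ker Q.koszulDiff = LinearMap.range Q.koszulDiff ⊔ Submodule.span K {Q.unitI ⊗ₜ 1}

/-! ### The cobar construction -/

/-- The coaugmentation coideal of the Koszul dual coalgebra. -/
abbrev DualBar : Submodule K Q.Dual := LinearMap.ker (CoalgebraStruct.counit (R := K) (A := Q.Dual))

theorem counit_unitI : CoalgebraStruct.counit (R := K) Q.unitI = 1 := by
  change TensorAlgebra.algebraMapInv (Q.comp 0 Q.unitI) = 1
  rw [unitI, Q.comp_incl_self]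
  exact map_one _

/-- The projection `c ↦ c - ε(c) I` onto the coaugmentation coideal. -/
def projBar : Q.Dual →ₗ[K] Q.DualBar :=
  LinearMap.codRestrict _
    (LinearMap.id - LinearMap.toSpanSingleton K Q.Dual Q.unitI ∘ₗ CoalgebraStruct.counit)
    fun c => by simp [counit_unitI]

/-- The algebra underlying `A_∞ = Ω A^¡`: the tensor algebra on the desuspension of the
coaugmentation coideal of `A^¡`. -/
abbrev Cobar : Type (max u v) := TensorAlgebra K Q.DualBar

/-- The elements of degree `i` of the cobar construction; `s⁻¹c` has degree `|c| - 1`. -/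
def cobarDegree (i : ℤ) : Submodule K Q.Cobar :=
  tensorDegree K (fun j => (Q.dualDegree j).comap Q.DualBar.subtype) (-1) i

/-- The map `c ↦ s⁻¹ (c - ε(c) I)`. -/
def desusp : Q.Dual →ₗ[K] Q.Cobar := TensorAlgebra.ι K ∘ₗ Q.projBar

/-- The algebra automorphism `x ↦ (-1)^{|x|} x` of the cobar construction. -/
def cobarParity : Q.Cobar →ₐ[K] Q.Cobar :=
  TensorAlgebra.lift K (-(Q.desusp ∘ₗ Q.sign ∘ₗ Q.DualBar.subtype))

/-- The differential of the cobar construction on generators,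
`s⁻¹c ↦ - ∑ (-1)^{|c'|} s⁻¹c' s⁻¹c''`, for the reduced coproduct. -/
def cobarDiffGen : Q.DualBar →ₗ[K] Q.Cobar :=
  -(LinearMap.mul' K Q.Cobar ∘ₗ TensorProduct.map (Q.desusp ∘ₗ Q.sign) Q.desusp ∘ₗ
    CoalgebraStruct.comul ∘ₗ Q.DualBar.subtype)

/-- The algebra map `x ↦ !![(-1)^{|x|} x, d x; 0, x]`. -/
def cobarMatrix : Q.Cobar →ₐ[K] Matrix (Fin 2) (Fin 2) Q.Cobar :=
  TensorAlgebra.lift K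
    (Matrix.singleLinearMap K 0 0 ∘ₗ (Q.cobarParity.toLinearMap ∘ₗ TensorAlgebra.ι K) +
      Matrix.singleLinearMap K 0 1 ∘ₗ Q.cobarDiffGen +
      Matrix.singleLinearMap K 1 1 ∘ₗ TensorAlgebra.ι K)

/-- The differential of the cobar construction: the unique derivation (of degree `-1`) extending
`cobarDiffGen`, see `cobarDiff_ι` and `cobarDiff_mul`. -/
def cobarDiff : Q.Cobar →ₗ[K] Q.Cobar :=
  Matrix.entryLinearMap K Q.Cobar 0 1 ∘ₗ Q.cobarMatrix.toLinearMap

theorem cobarDiff_ι (c : Q.DualBar) : Q.cobarDiff (TensorAlgebra.ι K c) = Q.cobarDiffGen c := by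
  simp [cobarDiff, cobarMatrix, Matrix.singleLinearMap]

theorem cobarMatrix_apply (x : Q.Cobar) :
    Q.cobarMatrix x 0 0 = Q.cobarParity x ∧ Q.cobarMatrix x 1 0 = 0 ∧ Q.cobarMatrix x 1 1 = x := by
  induction x using TensorAlgebra.induction with
  | algebraMap r => simp [Matrix.algebraMap_eq_diagonal]
  | ι c => simp [cobarMatrix, Matrix.singleLinearMap]
  | mul a b ha hb =>
    simp only [map_mul, Matrix.mul_apply, Fin.sum_univ_two]
    simp [ha.1, ha.2.1, ha.2.2, hb.1, hb.2.1, hb.2.2]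
  | add a b ha hb =>
    simp [ha.1, ha.2.1, ha.2.2, hb.1, hb.2.1, hb.2.2]

theorem cobarDiff_mul (x y : Q.Cobar) :
    Q.cobarDiff (x * y) = Q.cobarDiff x * y + Q.cobarParity x * Q.cobarDiff y := by
  change Q.cobarMatrix (x * y) 0 1 = Q.cobarMatrix x 0 1 * y +
    Q.cobarParity x * Q.cobarMatrix y 0 1
  rw [map_mul, Matrix.mul_apply, Fin.sum_univ_two, (Q.cobarMatrix_apply x).1,
    (Q.cobarMatrix_apply y).2.2, add_comm]

end QuadraticData

/-! ### The endomorphism algebra of a chain complex -/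

section Endomorphisms

variable {K : Type u} [Field K] (V : ChainComplex (ModuleCat.{w} K) ℤ)

/-- The total space of a chain complex. -/
abbrev Total : Type w := ⨁ i, V.X i

/-- The differential `∂_V` of a chain complex, on its total space. -/
def totalDiff : Module.End K (Total V) :=
  DirectSum.toModule K ℤ _ fun i =>
    DirectSum.lof K ℤ (fun i => V.X i) (i - 1) ∘ₗ (V.d i (i - 1)).hom

/-- The endomorphisms of degree `k` of the graded vector space `V`. -/
def endDegree (k : ℤ) : Submodule K (Module.End K (Total V)) :=
  ⨅ j : ℤ, ⨅ x : homDegree V.X j, (homDegree V.X (j + k)).comap (LinearMap.applyₗ (x : Total V))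

/-- The differential `φ ↦ ∂_V φ - (-1)^{|φ|} φ ∂_V` of `End(V)`; the sign is obtained by
conjugating with `x ↦ (-1)^{|x|} x`. -/
def endDiff : Module.End K (Total V) →ₗ[K] Module.End K (Total V) :=
  LinearMap.mulLeft K (totalDiff V) - LinearMap.mulRight K (totalDiff V) ∘ₗ
    LinearMap.mulLeft K (signOp V.X 0) ∘ₗ LinearMap.mulRight K (signOp V.X 0)

end Endomorphisms

/-! ### The Baker-Campbell-Hausdorff series -/

/-- The right-nested bracket `[a₁, [a₂, [⋯, aₙ]]]`, for the Lie bracket `br`. -/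
def nestedBracket {L : Type*} [Zero L] (br : L → L → L) : List L → L
  | [] => 0
  | [a] => a
  | a :: b :: l => br a (nestedBracket br (b :: l))

/-- The word `x^{r₁} y^{s₁} ⋯ x^{rₙ} y^{sₙ}`. -/
def dynkinWord {L : Type*} (x y : L) {n : ℕ} (m : Fin n → ℕ × ℕ) : List L :=
  (List.ofFn fun i => List.replicate (m i).1 x ++ List.replicate (m i).2 y).flatten

open scoped Nat in
/-- The component of degree `N` of the Baker-Campbell-Hausdorff series, by Dynkin's formula
`∑_{n ≥ 1} (-1)^{n-1}/n ∑ [x^{r₁} y^{s₁} ⋯ x^{rₙ} y^{sₙ}] / (N ∏ rᵢ! sᵢ!)`, the inner sum being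
over all `r, s` with `rᵢ + sᵢ > 0` for all `i` and `∑ (rᵢ + sᵢ) = N`. Here `br` is the Lie
bracket. -/
def bchTerm (K : Type*) [Field K] {L : Type*} [AddCommGroup L] [Module K L] (br : L → L → L)
    (x y : L) (N : ℕ) : L :=
  ∑ n ∈ Finset.Icc 1 N, ((-1 : K) ^ (n - 1) / n) •
    ∑ m ∈ (Fintype.piFinset fun _ : Fin n => Finset.range (N + 1) ×ˢ Finset.range (N + 1)) with
        (∀ i, 0 < (m i).1 + (m i).2) ∧ ∑ i, ((m i).1 + (m i).2) = N,
      ((N * ∏ i, ((m i).1 ! * (m i).2 !) : ℕ) : K)⁻¹ • nestedBracket br (dynkinWord x y m)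

/-! ### The convolution algebra -/

section Convolution

variable {K : Type u} [Field K] (Q : QuadraticData.{u, v} K) (V : ChainComplex (ModuleCat.{w} K) ℤ)

/-- The linear maps `A^¡ → End(V)`. The ring structure provided by Mathlib is the
convolution product `(f * g)(c) = ∑ f(c') g(c'')` without Koszul sign, with unit `I ↦ id_V`; the
product of the convolution dg algebra is `convStar`. -/
abbrev Conv : Type (max u v w) := WithConv (Q.Dual →ₗ[K] Module.End K (Total V))

variable {Q V}

/-- `f : A^¡ → End(V)` is homogeneous of degree `p`. -/
def HasDegree (f : Conv Q V) (p : ℤ) : Prop :=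
  ∀ i, ∀ c ∈ Q.dualDegree i, f.ofConv c ∈ endDegree V (i + p)

/-- The convolution product `(f ⋆ g)(c) = ∑ (-1)^{|g| |c'|} f(c') g(c'')`, where `q = |g|`. -/
def convStar (q : ℤ) (f g : Conv Q V) : Conv Q V :=
  WithConv.toConv (f.ofConv ∘ₗ (Q.sign ^ q.natAbs : Module.End K Q.Dual)) * g

/-- The graded commutator `[f, g] = f ⋆ g - (-1)^{|f| |g|} g ⋆ f`, where `p = |f|`, `q = |g|`. -/
def gradedBracket (p q : ℤ) (f g : Conv Q V) : Conv Q V :=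
  convStar q f g - ((-1 : K) ^ (p * q)) • convStar p g f

/-- The differential `(∂_V)_*` of the convolution algebra. -/
def convDiff (f : Conv Q V) : Conv Q V :=
  WithConv.toConv (endDiff V ∘ₗ f.ofConv)

variable (Q V) in
/-- The element `δ : I ↦ ∂_V` of the convolution algebra. -/
def delta : Conv Q V :=
  WithConv.toConv (LinearMap.toSpanSingleton K _ (totalDiff V) ∘ₗ CoalgebraStruct.counit)

/-- The sum `∑ₖ F k` of a series whose term `F k` vanishes on the components of weight `< k` of
`A^¡`. -/
def weightSum (F : ℕ → Conv Q V) : Conv Q V :=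
  WithConv.toConv (Q.desc fun n => (∑ k ∈ Finset.range (n + 1), F k).ofConv ∘ₗ Q.incl n)

open scoped Nat in
/-- The exponential `∑ₖ λ^{⋆k} / k!` of an element of degree `0` and of positive weight (there is
no sign in the product of elements of degree `0`). -/
def convExp (l : Conv Q V) : Conv Q V :=
  weightSum fun k => ((k ! : ℕ) : K)⁻¹ • l ^ k

/-- The Baker-Campbell-Hausdorff series of two elements of degree `0` and of positive weight, for
the bracket of the dg Lie algebra `Hom(A^¡, End(V))`. -/
def convBCH (x y : Conv Q V) : Conv Q V :=
  weightSum fun N => bchTerm K (gradedBracket 0 0) x y N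

variable (Q V) in
/-- The underlying set `g₀` of the gauge group: the elements of degree `0` of
`g = Hom(\overline{A^¡}, End(V))`, seen as the maps on `A^¡` which vanish on `I`. -/
def Gauge : Type (max u v w) :=
  {l : Conv Q V // HasDegree l 0 ∧ l.ofConv Q.unitI = 0}

variable (Q V) in
/-- The Maurer-Cartan elements of the dg Lie algebra `g = Hom(\overline{A^¡}, End(V))`: the `α` of
degree `-1` with `∂α + ½ [α, α] = 0`. -/
def MaurerCartan : Type (max u v w) :=
  {a : Conv Q V // HasDegree a (-1) ∧ a.ofConv Q.unitI = 0 ∧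
    convDiff a + (2 : K)⁻¹ • gradedBracket (-1) (-1) a a = 0}

open scoped Nat in
/-- The gauge action: `λ.α` is defined by `δ + λ.α = e^{ad_λ}(δ + α)`. -/
def gaugeAct (l a : Conv Q V) : Conv Q V :=
  weightSum (fun k => ((k ! : ℕ) : K)⁻¹ • (gradedBracket 0 (-1) l)^[k] (delta Q V + a)) - delta Q V

/-! ### Homotopy modules and ∞-isotopies -/

variable (Q V) in
/-- A homotopy `A`-module structure on `V`: a (left) dg module structure over `A_∞ = Ω A^¡` on the
chain complex `V`, that is a morphism of dg algebras `Ω A^¡ → End(V)`. -/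
@[ext]
structure HomotopyModule where
  /-- the action -/
  act : Q.Cobar →ₐ[K] Module.End K (Total V)
  /-- the action has degree `0` -/
  degree : ∀ i, ∀ x ∈ Q.cobarDegree i, act x ∈ endDegree V i
  /-- the action commutes with the differentials -/
  diff : ∀ x, act (Q.cobarDiff x) = endDiff V (act x)

/-- The map `A^¡ → End(V)` of degree `-1`, `c ↦ s⁻¹c ↦ act (s⁻¹c)`, `I ↦ 0`, attached to a homotopy
module structure. -/
def HomotopyModule.twisting (M : HomotopyModule Q V) : Conv Q V :=
  WithConv.toConv (M.act.toLinearMap ∘ₗ Q.desusp)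

/-- An ∞-morphism between two homotopy module structures on `V`: a map `f : A^¡ → End(V)` of degree
`0` with `f ⋆ (δ + α) = (δ + β) ⋆ f`. -/
def IsInfMorphism (M N : HomotopyModule Q V) (f : Conv Q V) : Prop :=
  HasDegree f 0 ∧ convStar (-1) f (delta Q V + M.twisting) = convStar 0 (delta Q V + N.twisting) f

/-- An ∞-isotopy: an ∞-morphism whose first component is the identity. -/
def IsInfIsotopy (M N : HomotopyModule Q V) (f : Conv Q V) : Prop :=
  IsInfMorphism M N f ∧ f.ofConv Q.unitI = LinearMap.id

/-- The ∞-isotopies between two given homotopy module structures. -/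
def InfIsotopy (M N : HomotopyModule Q V) : Type (max u v w) := {f : Conv Q V // IsInfIsotopy M N f}

variable (Q V) in
/-- The set of all ∞-isotopies between homotopy module structures on `V`. -/
def InfIso : Type (max u v w) :=
  {f : Conv Q V // ∃ M N : HomotopyModule Q V, IsInfIsotopy M N f}

end Convolution

end

end KoszulDeligne

open CategoryTheory KoszulDeligne

/-! The weight grading makes `g` pronilpotent, and in degree `0` its exponentials already live in
the convolution algebra. The maps `A^¡ → End(V)` vanishing in weights `< k` form a filtration which
is multiplicative, because deconcatenation preserves weight, and separated. Modulo a piece, every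
map vanishing on `I` is nilpotent, so exp, log and BCH become finite sums. Identities between series
are proved for truncated series in associative algebras and lifted by `conv_ext_proj`.

The truncated identities come from calculus in `A[X]`, where `X` is a time parameter: in
characteristic zero two polynomials with the same derivative and the same value at `0` agree, and
evaluation at `1` gives the result. In this way exp and log are inverse to each other. For Dynkin's
form of BCH, take `w = e^{Xx} e^{Xy}` and the Euler derivation `D = X d/dX`. The formula `D log w =
∑ (-1)^n/(n+1) (Ad_w - 1)^n (Dw w⁻¹)` (`map_logTrunc_eq_sum`), together with `Ad_w = e^{ad Xx} e^{ad
Xy}` and `Dw w⁻¹ = Xx + e^{ad Xx}(Xy)`, expands into nested brackets; the coefficient of `X^N` is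
`N` times Dynkin's term (`expTrunc_sum_bchTerm`).

The Koszul signs are absorbed by `s : I ↦ (x ↦ (-1)^{|x|} x)`. Put `D_α = s(δ + α)` for the unsigned
product (`twistedDiff`). Then `α` is Maurer-Cartan iff `D_α² = 0` (`maurerCartan_iff`), a degree `0`
map `f` intertwines `δ + α` and `δ + β` iff `f D_α = D_β f` (`intertwine_iff`), and the gauge action
is `D_α ↦ e^λ D_α e^{-λ}` (`twistedDiff_gaugeAct`). Since `s² = 1`, `D_α` determines `α`. Hence the
gauge formula is an action on Maurer-Cartan elements, and `λ.α = β` says exactly that `e^λ` is an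
∞-isotopy. Every degree `0` map with first component the identity is some `e^λ`, and every `e^λ` is
an ∞-isotopy out of `α = 0`; so the ∞-isotopies are the image of exp.

Finally, `Ω A^¡` is free as an algebra, so a module structure is determined by its values on
generators, and compatibility with the differentials, being a derivation identity, reduces to
generators, where it is the Maurer-Cartan equation.

Degrees are tested by rescaling: powers of `2` are distinct in characteristic zero, so having degree
`p` is a commutation relation with the operator `2^{|x|}`, visibly stable under products and
weightwise finite sums. -/

namespace KoszulDeligne

open scoped DirectSum
open TensorProduct

/-! ### Truncated exponential and logarithm of nilpotent elements -/

section TruncatedSeries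

open Polynomial

variable (K : Type*) {A B : Type*} [Field K] [Ring A] [Algebra K A] [Ring B] [Algebra K B]

open scoped Nat in
/-- The truncated exponential `∑_{k < P} a ^ k / k!`. -/
noncomputable def expTrunc (P : ℕ) (a : A) : A :=
  ∑ k ∈ Finset.range P, ((k ! : ℕ) : K)⁻¹ • a ^ k

/-- The truncated logarithm `∑_{0 < k < P} (-1) ^ (k + 1) u ^ k / k` of `1 + u`. -/
noncomputable def logTrunc (P : ℕ) (u : A) : A :=
  ∑ k ∈ Finset.range P, ((-1 : K) ^ (k + 1) / k) • u ^ k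

variable {K}

theorem map_expTrunc (φ : A →ₐ[K] B) (P : ℕ) (a : A) :
    φ (expTrunc K P a) = expTrunc K P (φ a) := by
  simp [expTrunc, map_sum]

theorem map_logTrunc (φ : A →ₐ[K] B) (P : ℕ) (a : A) :
    φ (logTrunc K P a) = logTrunc K P (φ a) := by
  simp [logTrunc, map_sum]

theorem expTrunc_of_le {P P' : ℕ} (h : P ≤ P') {a : A} (ha : a ^ P = 0) :
    expTrunc K P' a = expTrunc K P a := by
  refine (Finset.sum_subset (by simpa using h) fun k _ hk => ?_).symm
  rw [pow_eq_zero_of_le (by simpa using hk) ha, smul_zero]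

theorem logTrunc_of_le {P P' : ℕ} (h : P ≤ P') {a : A} (ha : a ^ P = 0) :
    logTrunc K P' a = logTrunc K P a := by
  refine (Finset.sum_subset (by simpa using h) fun k _ hk => ?_).symm
  rw [pow_eq_zero_of_le (by simpa using hk) ha, smul_zero]

theorem Commute.expTrunc_right {a b : A} (h : Commute b a) (P : ℕ) :
    Commute b (expTrunc K P a) :=
  Commute.sum_right _ _ _ fun _ _ => (h.pow_right _).smul_right _

theorem Commute.logTrunc_right {a b : A} (h : Commute b a) (P : ℕ) :
    Commute b (logTrunc K P a) :=
  Commute.sum_right _ _ _ fun _ _ => (h.pow_right _).smul_right _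

theorem expTrunc_zero {P : ℕ} (hP : 0 < P) : expTrunc K P (0 : A) = 1 := by
  rw [expTrunc, Finset.sum_eq_single_of_mem 0 (by simpa using hP)]
  · simp
  · intro k _ hk
    simp [hk]

/-- The truncated logarithm is divisible by its argument. -/
theorem exists_logTrunc_eq (P : ℕ) (u : A) : ∃ v, Commute u v ∧ logTrunc K P u = u * v := by
  refine ⟨∑ k ∈ Finset.range P, ((-1 : K) ^ (k + 1) / k) • u ^ (k - 1),
    Commute.sum_right _ _ _ fun _ _ => ((Commute.refl u).pow_right _).smul_right _, ?_⟩
  rw [logTrunc, Finset.mul_sum]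
  refine Finset.sum_congr rfl fun k _ => ?_
  rcases k with _ | k
  · simp
  · rw [mul_smul_comm, Nat.add_sub_cancel, pow_succ' u]

theorem logTrunc_pow_eq_zero {P : ℕ} (P' : ℕ) {u : A} (hu : u ^ P = 0) :
    logTrunc K P' u ^ P = 0 := by
  obtain ⟨v, hv, h⟩ := exists_logTrunc_eq (K := K) P' u
  rw [h, hv.mul_pow, hu, zero_mul]

/-- `exp a - 1` is divisible by `a`. -/
theorem exists_expTrunc_eq {P : ℕ} (hP : 0 < P) (a : A) :
    ∃ v, Commute a v ∧ expTrunc K P a - 1 = a * v := by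
  obtain ⟨P, rfl⟩ := Nat.exists_eq_succ_of_ne_zero hP.ne'
  refine ⟨∑ k ∈ Finset.range P, (((k + 1).factorial : ℕ) : K)⁻¹ • a ^ k,
    Commute.sum_right _ _ _ fun _ _ => ((Commute.refl a).pow_right _).smul_right _, ?_⟩
  rw [expTrunc, Finset.sum_range_succ', Finset.mul_sum]
  simp [pow_succ']

-- On nilpotent elements the truncation is `IsNilpotent.exp`, whose rational coefficients act
-- through `ℚ → K`; the addition formula is inherited from there.
open scoped Nat in
theorem expTrunc_add_of_commute [CharZero K] {P : ℕ} {a b : A} (h : Commute a b) (ha : a ^ P = 0)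
    (hb : b ^ P = 0) (hab : (a + b) ^ P = 0) :
    expTrunc K P (a + b) = expTrunc K P a * expTrunc K P b := by
  let : Module ℚ A := Module.compHom A (algebraMap ℚ K)
  have key : ∀ c : A, c ^ P = 0 → expTrunc K P c = IsNilpotent.exp c := by
    intro c hc
    rw [IsNilpotent.exp_eq_sum hc, expTrunc]
    refine Finset.sum_congr rfl fun k _ => ?_
    change _ = algebraMap ℚ K _ • c ^ k
    simp
  rw [key _ ha, key _ hb, key _ hab, IsNilpotent.exp_add_of_commute h ⟨P, ha⟩ ⟨P, hb⟩]

theorem expTrunc_mul_neg [CharZero K] {P : ℕ} (hP : 0 < P) {a : A} (ha : a ^ P = 0) :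
    expTrunc K P a * expTrunc K P (-a) = 1 := by
  rw [← expTrunc_add_of_commute (Commute.refl a).neg_right ha (by rw [neg_pow, ha, mul_zero])
    (by rw [add_neg_cancel, zero_pow hP.ne']), add_neg_cancel, expTrunc_zero hP]

/-- The operator `ad_a` on an associative algebra. -/
def adLin (K : Type*) {A : Type*} [Field K] [Ring A] [Algebra K A] (a : A) : Module.End K A :=
  LinearMap.mulLeft K a - LinearMap.mulRight K a

theorem adLin_apply (a b : A) : adLin K a b = a * b - b * a := rfl

/-- `e^{ad_a} = Ad_{e^a}`. -/
theorem expTrunc_adLin [CharZero K] {P : ℕ} {a : A} (ha : a ^ P = 0) (had : adLin K a ^ P = 0) (b : A) :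
    expTrunc K P (adLin K a) b = expTrunc K P a * b * expTrunc K P (-a) := by
  -- `ad_a` is a difference of two commuting operators, left and right multiplication, so its
  -- exponential factors into theirs.
  have h1 : Commute (LinearMap.mulLeft K a) (-LinearMap.mulRight K a) :=
    Commute.neg_right (R := Module.End K A) (LinearMap.commute_mulLeft_right a a)
  have h2 : adLin K a = LinearMap.mulLeft K a + -LinearMap.mulRight K a := sub_eq_add_neg _ _
  have hL : ∀ c : A, expTrunc K P (LinearMap.mulLeft K c) = LinearMap.mulLeft K (expTrunc K P c) := by
    intro c
    ext d
    simp [expTrunc, Finset.sum_mul, LinearMap.pow_mulLeft]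
  have hR : ∀ c : A, expTrunc K P (LinearMap.mulRight K c) =
      LinearMap.mulRight K (expTrunc K P c) := by
    intro c
    ext d
    simp [expTrunc, Finset.mul_sum, LinearMap.pow_mulRight]
  have h3 : -LinearMap.mulRight K a = LinearMap.mulRight K (-a) := by
    ext d
    simp
  rw [h2, expTrunc_add_of_commute h1, h3, hL, hR]
  · simp [mul_assoc]
  · rw [LinearMap.pow_mulLeft, ha, LinearMap.mulLeft_zero_eq_zero]
  · rw [h3, LinearMap.pow_mulRight, neg_pow, ha, mul_zero, LinearMap.mulRight_zero_eq_zero]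
  · rw [← h2, had]

section Derivation

theorem map_one_of_leibniz (D : A →ₗ[K] A) (hD : ∀ a b, D (a * b) = D a * b + a * D b) : D 1 = 0 := by
  have := hD 1 1
  simpa using this

theorem map_pow_of_leibniz (D : A →ₗ[K] A) (hD : ∀ a b, D (a * b) = D a * b + a * D b)
    {a : A} (h : Commute a (D a)) (n : ℕ) :
    D (a ^ (n + 1)) = ((n + 1 : ℕ) : K) • (D a * a ^ n) := by
  induction n with
  | zero => simp
  | succ n ih =>
    rw [pow_succ', hD, ih, mul_smul_comm, ← mul_assoc, h.eq, mul_assoc, ← pow_succ']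
    push_cast
    module

/-- Differentiation lowers each exponent by one, so the sum up to `a ^ P / P!` yields a sum up to `a
^ (P - 1)`; the lost top term is zero because `a ^ P = 0`. This is why the truncation order is `P +
1`. -/
theorem map_expTrunc_of_leibniz [CharZero K] (D : A →ₗ[K] A) (hD : ∀ a b, D (a * b) = D a * b + a * D b)
    {a : A} (h : Commute a (D a)) {P : ℕ} (ha : a ^ P = 0) :
    D (expTrunc K (P + 1) a) = D a * expTrunc K (P + 1) a := by
  conv_rhs => rw [expTrunc_of_le (Nat.le_succ P) ha, expTrunc, Finset.mul_sum]
  rw [expTrunc, Finset.sum_range_succ', map_add, map_sum]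
  simp only [pow_zero, map_smul, map_one_of_leibniz D hD, smul_zero, add_zero]
  refine Finset.sum_congr rfl fun k _ => ?_
  rw [map_pow_of_leibniz D hD h, smul_smul, mul_smul_comm]
  congr 1
  rw [Nat.factorial_succ]
  have : ((k + 1 : ℕ) : K) ≠ 0 := Nat.cast_ne_zero.2 k.succ_ne_zero
  push_cast at this ⊢
  rw [mul_inv, mul_right_comm, inv_mul_cancel₀ this, one_mul]

/-- The derivative of the series is `D u` times the geometric series of `-u`, a finite sum inverse
to `1 + u`. -/
theorem map_logTrunc_of_leibniz [CharZero K] (D : A →ₗ[K] A) (hD : ∀ a b, D (a * b) = D a * b + a * D b)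
    {u : A} (h : Commute u (D u)) {P : ℕ} (hu : u ^ P = 0) :
    D (logTrunc K (P + 1) u) * (1 + u) = D u := by
  have h1 : D (logTrunc K (P + 1) u) = D u * ∑ k ∈ Finset.range P, (-u) ^ k := by
    rw [logTrunc, Finset.sum_range_succ', map_add, map_sum, Finset.mul_sum]
    simp only [pow_zero, map_smul, map_one_of_leibniz D hD, smul_zero, add_zero]
    refine Finset.sum_congr rfl fun k _ => ?_
    have : ((k + 1 : ℕ) : K) ≠ 0 := Nat.cast_ne_zero.2 k.succ_ne_zero
    rw [map_pow_of_leibniz D hD h, smul_smul, div_mul_cancel₀ _ this, pow_succ, pow_succ,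
      mul_assoc, neg_one_mul, neg_neg, mul_one, neg_pow u]
    rcases Nat.even_or_odd k with hk | hk <;> simp [hk.neg_one_pow]
  have h2 := geom_sum_mul_neg (-u) P
  rw [neg_pow, hu, mul_zero, sub_neg_eq_add, sub_zero] at h2
  rw [h1, mul_assoc, h2, mul_one]

end Derivation

end TruncatedSeries

/-! ### Calculus along the path `s ↦ s a` -/

section PolynomialHomotopy

open Polynomial

variable {K A : Type*} [Field K] [Ring A] [Algebra K A]

/-- The formal derivative of polynomials over a `K`-algebra, as a `K`-linear map. -/
noncomputable def polyDeriv (K A : Type*) [Field K] [Ring A] [Algebra K A] : A[X] →ₗ[K] A[X] :=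
  (derivative : A[X] →ₗ[A] A[X]).restrictScalars K

theorem polyDeriv_apply (p : A[X]) : polyDeriv K A p = derivative p := rfl

theorem polyDeriv_mul (p q : A[X]) :
    polyDeriv K A (p * q) = polyDeriv K A p * q + p * polyDeriv K A q :=
  derivative_mul

/-- Evaluation at a scalar. -/
noncomputable def evalScalar (A : Type*) [Ring A] [Algebra K A] (r : K) : A[X] →ₐ[K] A :=
  eval₂AlgHom (AlgHom.id K A) (algebraMap K A r) fun a => (Algebra.commutes r a).symm

theorem evalScalar_C (r : K) (a : A) : evalScalar A r (C a) = a :=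
  eval₂_C _ _

theorem evalScalar_X (r : K) : evalScalar A r X = algebraMap K A r :=
  eval₂_X _ _

/-- Uniqueness of antiderivatives: the degree `n + 1` coefficient is read from the derivative after
division by `n + 1`. It is the engine of all the path arguments below. -/
theorem eq_of_derivative_eq [CharZero K] {p q : A[X]} (h : derivative p = derivative q)
    (h0 : p.coeff 0 = q.coeff 0) : p = q := by
  ext n
  rcases n with _ | n
  · exact h0
  · have := congrArg (fun r => r.coeff n) h
    simp only [coeff_derivative] at this
    have h1 : ∀ a : A, a * (n + 1) = ((n + 1 : ℕ) : K) • a := by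
      intro a
      rw [Algebra.smul_def, map_natCast, Nat.cast_comm]
      push_cast
      rfl
    rw [h1, h1] at this
    exact smul_right_injective A (Nat.cast_ne_zero.2 n.succ_ne_zero : ((n + 1 : ℕ) : K) ≠ 0) this

theorem coeff_zero_eq_evalScalar (p : A[X]) : p.coeff 0 = evalScalar A (0 : K) p := by
  rw [coeff_zero_eq_eval_zero]
  simp [evalScalar, Polynomial.eval]

theorem eq_of_polyDeriv_eq [CharZero K] {p q : A[X]} (h : polyDeriv K A p = polyDeriv K A q)
    (h0 : evalScalar A (0 : K) p = evalScalar A (0 : K) q) : p = q :=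
  eq_of_derivative_eq (K := K) h
    (by rw [coeff_zero_eq_evalScalar (K := K), coeff_zero_eq_evalScalar (K := K), h0])

/-- The path `s ↦ s a`. -/
noncomputable def linePath (a : A) : A[X] := C a * X

theorem linePath_pow (a : A) (n : ℕ) : linePath a ^ n = C (a ^ n) * X ^ n := by
  rw [linePath, (commute_X (C a)).symm.mul_pow, C_pow]

theorem linePath_pow_eq_zero {P : ℕ} {a : A} (ha : a ^ P = 0) : linePath a ^ P = 0 := by
  rw [linePath_pow, ha, C_0, zero_mul]

theorem polyDeriv_linePath (a : A) : polyDeriv K A (linePath a) = C a := by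
  simp [polyDeriv_apply, linePath]

theorem evalScalar_linePath (r : K) (a : A) : evalScalar A r (linePath a) = r • a := by
  rw [linePath, map_mul, evalScalar_C, evalScalar_X, ← Algebra.commutes, Algebra.smul_def]

theorem commute_linePath_C (a : A) : Commute (linePath a) (C a) :=
  (Commute.refl (C a)).mul_left (commute_X (C a))

theorem logTrunc_zero (P : ℕ) : logTrunc K P (0 : A) = 0 := by
  refine Finset.sum_eq_zero fun k _ => ?_
  rcases k with _ | k <;> simp

/-- `exp (log (1 + u)) = 1 + u`. -/
theorem expTrunc_logTrunc [CharZero K] {P : ℕ} (hP : 0 < P) {u : A} (hu : u ^ P = 0) :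
    expTrunc K P (logTrunc K P u) = 1 + u := by
  have hP' := Nat.le_succ P
  have hU := linePath_pow_eq_zero hu
  set U := linePath u with hUdef
  have hdU : Commute U (polyDeriv K A U) := by
    rw [polyDeriv_linePath]
    exact commute_linePath_C u
  have hΛ : logTrunc K (P + 1) U ^ P = 0 := logTrunc_pow_eq_zero _ hU
  -- The inverse of `1 + U`, a finite geometric series since `U` is nilpotent.
  set c := ∑ k ∈ Finset.range P, (-U) ^ k with hc
  have hc1 : c * (1 + U) = 1 := by
    have := geom_sum_mul_neg (-U) P
    rwa [neg_pow, hU, mul_zero, sub_neg_eq_add, sub_zero] at this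
  have hc2 : (1 + U) * c = 1 := by
    have := mul_neg_geom_sum (-U) P
    rwa [neg_pow, hU, mul_zero, sub_neg_eq_add, sub_zero] at this
  have hdc : Commute U c := Commute.sum_right _ _ _ fun _ _ => (Commute.refl U).neg_right.pow_right _
  have hdΛ : polyDeriv K A (logTrunc K (P + 1) U) = polyDeriv K A U * c := by
    have := congrArg (· * c) (map_logTrunc_of_leibniz (polyDeriv K A) polyDeriv_mul hdU hU)
    simpa only [mul_assoc, hc2, mul_one] using this
  have hcomm : Commute (logTrunc K (P + 1) U) (polyDeriv K A (logTrunc K (P + 1) U)) := by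
    rw [hdΛ]
    exact (((hdU.mul_right hdc).symm).logTrunc_right _).symm
  have hE := map_expTrunc_of_leibniz (polyDeriv K A) polyDeriv_mul hcomm hΛ
  rw [hdΛ] at hE
  have hDc : polyDeriv K A c * (1 + U) = - (c * polyDeriv K A U) := by
    have := congrArg (polyDeriv K A) hc1
    rw [polyDeriv_mul, map_one_of_leibniz _ polyDeriv_mul, map_add,
      map_one_of_leibniz _ polyDeriv_mul, zero_add] at this
    exact eq_neg_of_add_eq_zero_left this
  have hDc' : polyDeriv K A c = - (c * polyDeriv K A U * c) := by
    have := congrArg (· * c) hDc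
    simpa only [mul_assoc, hc2, mul_one, neg_mul] using this
  -- Along the path, `(1 + U)⁻¹ exp (log (1 + U))` has derivative zero and starts at `1`.
  have key : c * expTrunc K (P + 1) (logTrunc K (P + 1) U) = 1 := by
    apply eq_of_polyDeriv_eq (K := K)
    · rw [polyDeriv_mul, hE, hDc', map_one_of_leibniz _ polyDeriv_mul]
      simp only [mul_assoc, neg_mul, neg_add_cancel]
    · rw [map_mul, map_expTrunc, map_logTrunc, hc, map_sum, hUdef]
      simp only [map_pow, map_neg, evalScalar_linePath, zero_smul, neg_zero, logTrunc_zero,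
        expTrunc_zero (Nat.succ_pos P), map_one, mul_one]
      rw [Finset.sum_eq_single_of_mem 0 (by simpa using hP)]
      · simp
      · intro k _ hk
        simp [hk]
  have key1 := congrArg ((1 + U) * ·) key
  simp only [← mul_assoc, hc2, one_mul, mul_one] at key1
  have key2 := congrArg (evalScalar A (1 : K)) key1
  rw [map_expTrunc, map_logTrunc, map_add, map_one, hUdef, evalScalar_linePath, one_smul] at key2
  rwa [logTrunc_of_le hP' hu, expTrunc_of_le hP' (logTrunc_pow_eq_zero _ hu)] at key2

/-- `log (exp a) = a`. -/
theorem logTrunc_expTrunc [CharZero K] {P : ℕ} (hP : 0 < P) {a : A} (ha : a ^ P = 0) :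
    logTrunc K P (expTrunc K P a - 1) = a := by
  have hU := linePath_pow_eq_zero ha
  set U := linePath a with hUdef
  have hdU : Commute U (polyDeriv K A U) := by
    rw [polyDeriv_linePath]
    exact commute_linePath_C a
  have hexp := map_expTrunc_of_leibniz (polyDeriv K A) polyDeriv_mul hdU hU
  have hcE : Commute U (expTrunc K (P + 1) U) := (Commute.refl U).expTrunc_right _
  have hDE : Commute (polyDeriv K A U) (expTrunc K (P + 1) U) := hdU.symm.expTrunc_right _
  set v := expTrunc K (P + 1) U - 1 with hv
  have hvP : v ^ P = 0 := by
    obtain ⟨w, hw, h⟩ := exists_expTrunc_eq (K := K) (Nat.succ_pos P) U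
    rw [hv, h, hw.mul_pow, hU, zero_mul]
  have hDv : polyDeriv K A v = polyDeriv K A U * (1 + v) := by
    rw [hv, map_sub, map_one_of_leibniz _ polyDeriv_mul, sub_zero, hexp, add_sub_cancel]
  have hvc : Commute v (polyDeriv K A v) := by
    rw [hDv]
    have h1 : Commute v (polyDeriv K A U) := (hDE.sub_right (Commute.one_right _)).symm
    exact h1.mul_right ((Commute.one_right _).add_right (Commute.refl v))
  have hlog := map_logTrunc_of_leibniz (polyDeriv K A) polyDeriv_mul hvc hvP
  rw [hDv] at hlog
  have hinv : (1 + v) * expTrunc K (P + 1) (-U) = 1 := by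
    rw [hv, add_sub_cancel]
    exact expTrunc_mul_neg (Nat.succ_pos P) (pow_eq_zero_of_le (Nat.le_succ P) hU)
  have hlog' := congrArg (· * expTrunc K (P + 1) (-U)) hlog
  simp only [mul_assoc, hinv, mul_one] at hlog'
  -- Both sides have the derivative of `U`, by `hlog'`, and vanish at time `0`.
  have key : logTrunc K (P + 1) v = U := by
    apply eq_of_polyDeriv_eq (K := K) hlog'
    rw [map_logTrunc, hv, map_sub, map_expTrunc, hUdef, evalScalar_linePath, zero_smul,
      expTrunc_zero (Nat.succ_pos P), map_one, sub_self, logTrunc_zero]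
  have key2 := congrArg (evalScalar A (1 : K)) key
  rw [map_logTrunc, hv, map_sub, map_expTrunc, map_one, hUdef, evalScalar_linePath, one_smul,
    expTrunc_of_le (Nat.le_succ P) ha, logTrunc_of_le (Nat.le_succ P)] at key2
  · exact key2
  · obtain ⟨w, hw, h⟩ := exists_expTrunc_eq (K := K) hP a
    rw [h, hw.mul_pow, ha, zero_mul]

/-- The derivative of the logarithm: `D (log w) = ∑ₙ (-1)^n (Ad_w - 1)^n (D w ⬝ w⁻¹) / (n + 1)`. -/
theorem map_logTrunc_eq_sum [CharZero K] (D : A →ₗ[K] A)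
    (hD : ∀ a b, D (a * b) = D a * b + a * D b) {u w' : A} {P : ℕ} (hu : u ^ P = 0)
    (had : adLin K u ^ P = 0) (hw : (1 + u) * w' = 1) :
    D (logTrunc K (P + 1) u) = ∑ n ∈ Finset.range P, ((-1 : K) ^ n / (n + 1 : ℕ)) •
      ((LinearMap.mulLeft K (1 + u) ∘ₗ LinearMap.mulRight K w' - 1 : Module.End K A) ^ n)
        (D u * w') := by
  have hU := linePath_pow_eq_zero hu
  set U := linePath u with hUdef
  set c := ∑ k ∈ Finset.range P, (-U) ^ k with hc
  have hc1 : c * (1 + U) = 1 := by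
    have := geom_sum_mul_neg (-U) P
    rwa [neg_pow, hU, mul_zero, sub_neg_eq_add, sub_zero] at this
  have hc2 : (1 + U) * c = 1 := by
    have := mul_neg_geom_sum (-U) P
    rwa [neg_pow, hU, mul_zero, sub_neg_eq_add, sub_zero] at this
  have hcomm : Commute (1 + U) c := hc2.trans hc1.symm
  have hDc : polyDeriv K A c = - (c * C u * c) := by
    have := congrArg (polyDeriv K A) hc1
    rw [polyDeriv_mul, map_one_of_leibniz _ polyDeriv_mul, map_add,
      map_one_of_leibniz _ polyDeriv_mul, zero_add, polyDeriv_linePath] at this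
    have := congrArg (· * c) (eq_neg_of_add_eq_zero_left this)
    simpa only [mul_assoc, hc2, mul_one, neg_mul] using this
  -- the two paths
  let F : A[X] := ∑ n ∈ Finset.range P, ((-1 : K) ^ n / (n + 1 : ℕ)) •
    (C (D (u ^ (n + 1))) * X ^ (n + 1))
  let G : A[X] := ∑ n ∈ Finset.range P, ((-1 : K) ^ n / (n + 1 : ℕ)) •
    (C ((adLin K u ^ n) (D u)) * (X * c) ^ (n + 1))
  have hX : ∀ p : A[X], X * p = p * X := fun p => X_mul
  -- `F` is `D` applied to the coefficients of `log (1 + X u)`, and `G` is the claimed expansion for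
  -- `1 + X u` in place of `1 + u`. Both vanish at `0`, and both turn out to have derivative `c (D
  -- u) c`.
  have hF : polyDeriv K A F = c * C (D u) * c := by
    have h1 : polyDeriv K A F =
        ∑ n ∈ Finset.range P, (-1 : K) ^ n • (C (D (u ^ (n + 1))) * X ^ n) := by
      rw [map_sum]
      refine Finset.sum_congr rfl fun n _ => ?_
      have : ((n + 1 : ℕ) : K) ≠ 0 := Nat.cast_ne_zero.2 n.succ_ne_zero
      have h2 : polyDeriv K A (C (D (u ^ (n + 1))) * X ^ (n + 1)) =
          ((n + 1 : ℕ) : K) • (C (D (u ^ (n + 1))) * X ^ n) := by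
        have h3 : polyDeriv K A (X : A[X]) = 1 := derivative_X
        rw [polyDeriv_mul, map_pow_of_leibniz _ polyDeriv_mul (hX _), h3, one_mul, mul_smul_comm,
          polyDeriv_apply, derivative_C, zero_mul, zero_add]
      rw [map_smul, h2, smul_smul, div_mul_cancel₀ _ this]
    -- The Leibniz rule for `u * u ^ p` makes the partial sums telescope; the remainder contains `D
    -- (u ^ p)`, which dies at `p = P`.
    have h3 : ∀ p : ℕ, (1 + U) * ∑ n ∈ Finset.range p, (-1 : K) ^ n • (C (D (u ^ (n + 1))) * X ^ n) =
        C (D u) * ∑ k ∈ Finset.range p, (-U) ^ k - (-1 : K) ^ p • (C (u * D (u ^ p)) * X ^ p) := by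
      intro p
      induction p with
      | zero => simp [map_one_of_leibniz D hD]
      | succ p ih =>
        rw [Finset.sum_range_succ, Finset.sum_range_succ, mul_add, mul_add, ih, pow_succ' u, hD,
          neg_pow U, hUdef, linePath_pow]
        have e1 : linePath u * (C (D u * u ^ p + u * D (u ^ p)) * X ^ p) =
            C (u * (D u * u ^ p + u * D (u ^ p))) * X ^ (p + 1) := by
          rw [linePath, C_mul, mul_assoc, ← mul_assoc X, hX, pow_succ' X]
          simp only [mul_assoc]
        have e2 : C (D u) * ((-1) ^ p * (C (u ^ p) * X ^ p)) =
            (-1 : K) ^ p • (C (D u * u ^ p) * X ^ p) := by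
          rw [C_mul]
          rcases Nat.even_or_odd p with hp | hp <;> simp [hp.neg_one_pow, mul_assoc]
        rw [e2, mul_smul_comm, add_mul, one_mul, e1, pow_succ (-1 : K)]
        simp only [C_add, add_mul]
        module
    have h4 := h3 P
    rw [← h1, hu, map_zero, mul_zero, C_0, zero_mul, smul_zero, sub_zero, ← hc] at h4
    have := congrArg (c * ·) h4
    simpa only [← mul_assoc, hc1, one_mul] using this
  have hG : polyDeriv K A G = c * C (D u) * c := by
    have hUc : Commute U c := by simpa using hcomm.sub_left (Commute.one_left c)
    -- The derivative of `X / (1 + X u)` is `1 / (1 + X u)²`.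
    have hXc : polyDeriv K A (X * c) = c * c := by
      have h5 : X * (c * C u * c) = U * c * c := by
        rw [← mul_assoc, ← mul_assoc, hX c, mul_assoc c X, hX, ← linePath, ← hUdef, hUc.eq]
      have h6 : U * c = 1 - c := by
        rw [← hc2]
        noncomm_ring
      rw [polyDeriv_mul, hDc, mul_neg, h5, h6, polyDeriv_apply, derivative_X]
      noncomm_ring
    have hcc : Commute (X * c) (polyDeriv K A (X * c)) := by
      rw [hXc]
      have : Commute (X * c) c := (commute_X c).mul_left (Commute.refl c)
      exact this.mul_right this
    have h1 : polyDeriv K A G = (∑ n ∈ Finset.range P,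
        (-1 : K) ^ n • (C ((adLin K u ^ n) (D u)) * (X * c) ^ n) * c) * c := by
      rw [map_sum, Finset.sum_mul]
      refine Finset.sum_congr rfl fun n _ => ?_
      have : ((n + 1 : ℕ) : K) ≠ 0 := Nat.cast_ne_zero.2 n.succ_ne_zero
      rw [map_smul, polyDeriv_mul, map_pow_of_leibniz _ polyDeriv_mul hcc, polyDeriv_apply,
        derivative_C, zero_mul, zero_add, (hcc.symm.pow_right n).eq, hXc, mul_smul_comm, smul_smul,
        div_mul_cancel₀ _ this]
      simp only [smul_mul_assoc, mul_assoc]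
    -- Again telescoping: moving `U` across a coefficient costs one `ad_u`. The remainder contains
    -- `ad_u ^ p`, which dies at `p = P`.
    have h3 : ∀ p : ℕ, (1 + U) * ∑ n ∈ Finset.range p,
        (-1 : K) ^ n • (C ((adLin K u ^ n) (D u)) * (X * c) ^ n) * c =
        C (D u) - (-1 : K) ^ p • (C ((adLin K u ^ p) (D u)) * (X * c) ^ p) := by
      intro p
      induction p with
      | zero => simp
      | succ p ih =>
        have h4 : ∀ a : A, (1 + U) * (C a * (X * c) ^ p) * c =
            C a * (X * c) ^ p + C (adLin K u a) * (X * c) ^ (p + 1) := by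
          intro a
          have h5 : c = 1 - U * c := by
            rw [← hc2]
            noncomm_ring
          have hUX : Commute U ((X * c) ^ p) := ((commute_X U).symm.mul_right hUc).pow_right p
          have h6 : C (adLin K u a) * (X * c) ^ (p + 1) =
              U * (C a * (X * c) ^ p) * c - C a * (X * c) ^ p * (U * c) := by
            have h7 : (X * c) ^ p * (U * c) = U * (X * c) ^ p * c := by
              rw [← mul_assoc, hUX.eq]
            rw [mul_assoc (C a), h7, adLin_apply, C_sub, C_mul, C_mul, pow_succ, sub_mul, hUdef,
              linePath]
            have h8 : ∀ q : A[X], (X * c) ^ p * (X * c) * q = X * ((X * c) ^ p * (c * q)) := by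
              intro q
              rw [← mul_assoc, ← hX ((X * c) ^ p)]
              simp only [mul_assoc]
            have h9 := h8 1
            rw [mul_one, mul_one] at h9
            rw [h9]
            congr 1
            · simp only [mul_assoc]
              rw [← mul_assoc X (C a), hX (C a)]
              simp only [mul_assoc]
            · simp only [mul_assoc]
          rw [h6, add_mul, one_mul, add_mul]
          nth_rewrite 2 [h5]
          noncomm_ring
        rw [Finset.sum_range_succ, mul_add, ih, smul_mul_assoc, mul_smul_comm, ← mul_assoc, h4,
          pow_succ' (adLin K u), Module.End.mul_apply, pow_succ (-1 : K)]
        module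
    have h4 := h3 P
    rw [had, LinearMap.zero_apply, C_0, zero_mul, smul_zero, sub_zero] at h4
    have h5 := congrArg (c * · * c) h4
    simp only [← mul_assoc, hc1, one_mul] at h5
    rw [h1, h5]
  have hFG : F = G := by
    apply eq_of_polyDeriv_eq (K := K) (hF.trans hG.symm)
    simp only [F, G, map_sum, map_smul, map_mul, map_pow, evalScalar_X, map_zero]
    simp
  have hev := congrArg (evalScalar A (1 : K)) hFG
  have hcw : evalScalar A (1 : K) c = w' := by
    have h1 := congrArg (evalScalar A (1 : K)) hc1
    rw [map_mul, map_add, map_one, hUdef, evalScalar_linePath, one_smul] at h1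
    calc _ = evalScalar A (1 : K) c * ((1 + u) * w') := by rw [hw, mul_one]
      _ = w' := by rw [← mul_assoc, h1, one_mul]
  simp only [F, G, map_sum, map_smul, map_mul, map_pow, evalScalar_X, evalScalar_C, map_one,
    one_pow, mul_one, one_mul, hcw] at hev
  -- With `w = 1 + u`, one has `Ad_w z - z = ad_u(z) w'`. Each application therefore adds one `ad_u`
  -- and one factor `w'`, matching `G` at time `1`.
  have hop : ∀ n b, ((LinearMap.mulLeft K (1 + u) ∘ₗ LinearMap.mulRight K w' - 1 :
      Module.End K A) ^ n) (b * w') = (adLin K u ^ n) b * w' ^ (n + 1) := by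
    intro n
    have hw2 : w' * (1 + u) = 1 := by
      have h1 := congrArg (evalScalar A (1 : K)) hc1
      rwa [map_mul, map_add, map_one, hUdef, evalScalar_linePath, one_smul, hcw] at h1
    induction n with
    | zero => simp
    | succ n ih =>
      intro b
      rw [pow_succ', Module.End.mul_apply, ih, pow_succ' (adLin K u), Module.End.mul_apply]
      generalize (adLin K u ^ n) b = b
      have h2 : b * w' ^ (n + 1) = b * (1 + u) * w' ^ (n + 2) := by
        rw [pow_succ' w' (n + 1), ← mul_assoc, mul_assoc b, hw, mul_one]
      have h3 : w' ^ (n + 1) * w' = w' ^ (n + 2) := (pow_succ _ _).symm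
      rw [LinearMap.sub_apply, LinearMap.comp_apply, LinearMap.mulRight_apply,
        LinearMap.mulLeft_apply, Module.End.one_apply, mul_assoc b, h3, h2, adLin_apply]
      noncomm_ring
  rw [logTrunc, Finset.sum_range_succ', map_add, map_sum]
  simp only [map_smul, pow_zero, map_one_of_leibniz D hD, smul_zero, add_zero]
  rw [Finset.sum_congr rfl fun n _ => ?_, hev]
  · exact Finset.sum_congr rfl fun n _ => by rw [hop]
  · rw [pow_succ, pow_succ]
    simp

end PolynomialHomotopy

/-! ### Multiplicative filtrations -/

section RingFiltrations

open Polynomial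

/-- A decreasing multiplicative filtration of an algebra by subspaces. -/
structure RingFiltration (K A : Type*) [Field K] [Ring A] [Algebra K A] where
  /-- the subspaces of the filtration -/
  piece : ℕ → Submodule K A
  zero : piece 0 = ⊤
  anti : Antitone piece
  mul_mem : ∀ {i j : ℕ} {a b : A}, a ∈ piece i → b ∈ piece j → a * b ∈ piece (i + j)

namespace RingFiltration

variable {K A B : Type*} [Field K] [Ring A] [Algebra K A] [Ring B] [Algebra K B]
  (F : RingFiltration K A)

theorem mem_zero (a : A) : a ∈ F.piece 0 := by
  rw [F.zero]
  trivial

theorem pow_mem {a : A} {i : ℕ} (ha : a ∈ F.piece i) (n : ℕ) : a ^ n ∈ F.piece (n * i) := by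
  induction n with
  | zero => simpa using F.mem_zero 1
  | succ n ih =>
    rw [pow_succ, Nat.succ_mul]
    exact F.mul_mem ih ha

theorem pow_mem_one {a : A} (ha : a ∈ F.piece 1) (n : ℕ) : a ^ n ∈ F.piece n := by
  simpa using F.pow_mem ha n

theorem mul_mem_left {a b : A} {i : ℕ} (hb : b ∈ F.piece i) : a * b ∈ F.piece i := by
  simpa using F.mul_mem (F.mem_zero a) hb

theorem mul_mem_right {a b : A} {i : ℕ} (ha : a ∈ F.piece i) : a * b ∈ F.piece i :=
  F.mul_mem ha (F.mem_zero b)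

theorem adLin_pow_mem {a b : A} {i : ℕ} (ha : a ∈ F.piece 1) (hb : b ∈ F.piece i) (n : ℕ) :
    (adLin K a ^ n) b ∈ F.piece (i + n) := by
  induction n with
  | zero => simpa using hb
  | succ n ih =>
    rw [pow_succ', Module.End.mul_apply, adLin_apply, ← add_assoc]
    refine Submodule.sub_mem _ ?_ (F.mul_mem ih ha)
    rw [add_comm (i + n)]
    exact F.mul_mem ha ih

theorem expTrunc_sub_one_mem {a : A} (ha : a ∈ F.piece 1) {P : ℕ} (hP : 0 < P) :
    expTrunc K P a - 1 ∈ F.piece 1 := by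
  obtain ⟨v, -, h⟩ := exists_expTrunc_eq (K := K) hP a
  rw [h]
  exact F.mul_mem_right ha

theorem pow_eq_zero {M : ℕ} (hM : F.piece M = ⊥) {a : A} (ha : a ∈ F.piece 1) {P : ℕ}
    (hP : M ≤ P) : a ^ P = 0 := by
  have := F.anti hP (F.pow_mem_one ha P)
  rwa [hM, Submodule.mem_bot] at this

/-- Bracketing with an element of the first piece raises the filtration by one, so `ad_a` is
nilpotent as an operator on the whole algebra, not only on the first piece. -/
theorem adLin_pow_eq_zero {M : ℕ} (hM : F.piece M = ⊥) {a : A} (ha : a ∈ F.piece 1) {P : ℕ}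
    (hP : M ≤ P) : adLin K a ^ P = 0 := by
  ext b
  have := F.anti (hP.trans (Nat.le_add_left _ _)) (F.adLin_pow_mem ha (F.mem_zero b) P)
  rwa [hM, Submodule.mem_bot] at this

/-- The filtration on polynomials given by the filtration of the coefficients. -/
def poly : RingFiltration K A[X] where
  piece k :=
    { carrier := {p | ∀ n, p.coeff n ∈ F.piece k}
      add_mem' := fun ha hb n => by
        rw [coeff_add]
        exact Submodule.add_mem _ (ha n) (hb n)
      zero_mem' := fun n => by simp
      smul_mem' := fun r p hp n => by
        rw [coeff_smul]
        exact Submodule.smul_mem _ _ (hp n) }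
  zero := by
    ext p
    exact ⟨fun _ => trivial, fun _ n => F.mem_zero _⟩
  anti i j h p hp n := F.anti h (hp n)
  mul_mem {i j a b} ha hb n := by
    rw [coeff_mul]
    exact Submodule.sum_mem _ fun x _ => F.mul_mem (ha x.1) (hb x.2)

theorem poly_eq_bot {M : ℕ} (hM : F.piece M = ⊥) : F.poly.piece M = ⊥ := by
  rw [eq_bot_iff]
  intro p hp
  rw [Submodule.mem_bot]
  ext n
  have := hp n
  rwa [hM, Submodule.mem_bot] at this

theorem linePath_mem {a : A} {i : ℕ} (ha : a ∈ F.piece i) : linePath a ∈ F.poly.piece i := by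
  refine F.poly.mul_mem_right fun n => ?_
  rw [coeff_C]
  split_ifs
  exacts [ha, Submodule.zero_mem _]

/-- The image of a filtration under a surjective homomorphism. -/
def map (φ : A →ₐ[K] B) (hφ : Function.Surjective φ) : RingFiltration K B where
  piece k := (F.piece k).map φ.toLinearMap
  zero := by
    rw [F.zero, Submodule.map_top, LinearMap.range_eq_top]
    exact hφ
  anti i j h := Submodule.map_mono (F.anti h)
  mul_mem := by
    rintro i j _ _ ⟨a, ha, rfl⟩ ⟨b, hb, rfl⟩
    exact ⟨a * b, F.mul_mem ha hb, map_mul φ a b⟩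

end RingFiltration

end RingFiltrations

/-! ### Nested brackets of Dynkin words -/

section Dynkin

variable {L : Type*}

theorem nestedBracket_replicate_append [Zero L] (br : L → L → L) (x : L) (r : ℕ) {l : List L}
    (hl : l ≠ []) :
    nestedBracket br (List.replicate r x ++ l) = (br x)^[r] (nestedBracket br l) := by
  induction r with
  | zero => rfl
  | succ r ih =>
    rw [Function.iterate_succ_apply', ← ih, List.replicate_succ, List.cons_append]
    obtain ⟨a, t, ht⟩ := List.exists_cons_of_ne_nil (l := List.replicate r x ++ l) (by simp [hl])
    rw [ht]
    rfl

theorem dynkinWord_cons (x y : L) {n : ℕ} (p : ℕ × ℕ) (m : Fin n → ℕ × ℕ) :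
    dynkinWord x y (Fin.cons p m : Fin (n + 1) → ℕ × ℕ) =
      List.replicate p.1 x ++ (List.replicate p.2 y ++ dynkinWord x y m) := by
  simp [dynkinWord, List.ofFn_succ]

theorem length_dynkinWord (x y : L) {n : ℕ} (m : Fin n → ℕ × ℕ) :
    (dynkinWord x y m).length = ∑ i, ((m i).1 + (m i).2) := by
  simp [dynkinWord, List.length_flatten, List.sum_ofFn]

theorem mem_dynkinWord {x y : L} {n : ℕ} {m : Fin n → ℕ × ℕ} {z : L} (hz : z ∈ dynkinWord x y m) :
    z = x ∨ z = y := by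
  simp only [dynkinWord, List.mem_flatten, List.mem_ofFn] at hz
  obtain ⟨_, ⟨i, rfl⟩, hz⟩ := hz
  rcases List.mem_append.1 hz with h | h
  exacts [Or.inl (List.eq_of_mem_replicate h), Or.inr (List.eq_of_mem_replicate h)]

/-- Splitting off the first pair of exponents isolates the outermost brackets `ad_x^r ad_y^s`, which
is the recursion behind Dynkin's sum. -/
theorem sum_piFinset_cons {M α : Type*} [AddCommMonoid M] (n : ℕ) (s : Finset α)
    (f : (Fin (n + 1) → α) → M) :
    ∑ m ∈ Fintype.piFinset (fun _ : Fin (n + 1) => s), f m =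
      ∑ p ∈ s, ∑ m ∈ Fintype.piFinset (fun _ : Fin n => s), f (Fin.cons p m) := by
  rw [← Finset.sum_product' s _ fun p m => f (Fin.cons p m)]
  refine Finset.sum_nbij' (fun m => (m 0, Fin.tail m)) (fun q => Fin.cons q.1 q.2) ?_ ?_ ?_ ?_ ?_
  · intro m hm
    rw [Fintype.mem_piFinset] at hm
    simp only [Finset.mem_product, Fintype.mem_piFinset]
    exact ⟨hm 0, fun i => hm i.succ⟩
  · intro q hq
    simp only [Finset.mem_product, Fintype.mem_piFinset] at hq
    rw [Fintype.mem_piFinset]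
    exact Fin.cases hq.1 hq.2
  · intro m _
    exact Fin.cons_self_tail m
  · intro q _
    simp
  · intro m _
    simp

-- Only brackets of words of length exactly `N` occur in the `N`-th term. This gives both the
-- filtration estimate and the stability of degree `0`.
open scoped Nat in
theorem bchTerm_mem {K : Type*} [Field K] [AddCommGroup L] [Module K L] {br : L → L → L}
    (S : Submodule K L) {x y : L} {N : ℕ}
    (h : ∀ n, ∀ m : Fin n → ℕ × ℕ, ∑ i, ((m i).1 + (m i).2) = N →
      nestedBracket br (dynkinWord x y m) ∈ S) :
    bchTerm K br x y N ∈ S := by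
  refine Submodule.sum_mem _ fun n _ => Submodule.smul_mem _ _ (Submodule.sum_mem _ fun m hm => ?_)
  exact Submodule.smul_mem _ _ (h n m (Finset.mem_filter.1 hm).2.2)

theorem nestedBracket_mem {K : Type*} [Field K] [AddCommGroup L] [Module K L] {br : L → L → L}
    (S : Submodule K L) (hS : ∀ a ∈ S, ∀ b ∈ S, br a b ∈ S) :
    ∀ l : List L, (∀ a ∈ l, a ∈ S) → nestedBracket br l ∈ S
  | [], _ => S.zero_mem
  | [a], h => h a (by simp)
  | a :: b :: l, h => hS _ (h a (by simp)) _
      (nestedBracket_mem S hS (b :: l) fun c hc => h c (List.mem_cons_of_mem _ hc))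

theorem map_nestedBracket {L' : Type*} [Zero L] [Zero L'] {br : L → L → L} {br' : L' → L' → L'}
    (φ : L → L') (h0 : φ 0 = 0) (hφ : ∀ a b, φ (br a b) = br' (φ a) (φ b)) :
    ∀ l : List L, φ (nestedBracket br l) = nestedBracket br' (l.map φ)
  | [] => h0
  | [_] => rfl
  | a :: b :: l => (hφ _ _).trans (congrArg (br' (φ a)) (map_nestedBracket φ h0 hφ (b :: l)))

theorem map_dynkinWord {L' : Type*} (φ : L → L') (x y : L) {n : ℕ} (m : Fin n → ℕ × ℕ) :
    (dynkinWord x y m).map φ = dynkinWord (φ x) (φ y) m := by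
  simp [dynkinWord, List.map_flatten, List.map_ofFn, Function.comp_def]

theorem map_bchTerm {K L' : Type*} [Field K] [AddCommGroup L] [Module K L] [AddCommGroup L']
    [Module K L'] {br : L → L → L} {br' : L' → L' → L'} (φ : L →ₗ[K] L')
    (hφ : ∀ a b, φ (br a b) = br' (φ a) (φ b)) (x y : L) (N : ℕ) :
    φ (bchTerm K br x y N) = bchTerm K br' (φ x) (φ y) N := by
  simp only [bchTerm, map_sum, map_smul, map_nestedBracket φ (map_zero φ) hφ, map_dynkinWord]

theorem RingFiltration.nestedBracket_mem {K A : Type*} [Field K] [Ring A] [Algebra K A]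
    (F : RingFiltration K A) : ∀ l : List A, (∀ a ∈ l, a ∈ F.piece 1) →
      nestedBracket (fun a b => a * b - b * a) l ∈ F.piece l.length
  | [], _ => Submodule.zero_mem _
  | [a], h => h a (by simp)
  | a :: b :: l, h => by
    have ih := F.nestedBracket_mem (b :: l) fun c hc => h c (List.mem_cons_of_mem _ hc)
    have ha := h a (by simp)
    refine Submodule.sub_mem _ ?_ (F.mul_mem ih ha)
    rw [List.length_cons, add_comm]
    exact F.mul_mem ha ih

theorem RingFiltration.bchTerm_mem {K A : Type*} [Field K] [Ring A] [Algebra K A]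
    (F : RingFiltration K A) {x y : A} (hx : x ∈ F.piece 1) (hy : y ∈ F.piece 1) (N : ℕ) :
    bchTerm K (fun a b => a * b - b * a) x y N ∈ F.piece N := by
  refine KoszulDeligne.bchTerm_mem _ fun n m hm => ?_
  rw [← hm, ← length_dynkinWord x y m]
  refine F.nestedBracket_mem _ fun a ha => ?_
  rcases mem_dynkinWord ha with rfl | rfl <;> assumption

end Dynkin

/-! ### The Baker-Campbell-Hausdorff formula -/

section BakerCampbellHausdorff

open Polynomial

variable {K A : Type*} [Field K] [Ring A] [Algebra K A]

/-- The Euler derivation `X d/dX` of the polynomials over a `K`-algebra. -/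
noncomputable def eulerDeriv (K A : Type*) [Field K] [Ring A] [Algebra K A] : A[X] →ₗ[K] A[X] :=
  LinearMap.mulLeft K X ∘ₗ polyDeriv K A

theorem eulerDeriv_mul (p q : A[X]) :
    eulerDeriv K A (p * q) = eulerDeriv K A p * q + p * eulerDeriv K A q := by
  simp only [eulerDeriv, LinearMap.comp_apply, LinearMap.mulLeft_apply, polyDeriv_mul]
  rw [mul_add, mul_assoc X, ← mul_assoc X p, X_mul (p := p), mul_assoc p X]

theorem eulerDeriv_linePath (a : A) : eulerDeriv K A (linePath a) = linePath a := by
  rw [eulerDeriv, LinearMap.comp_apply, polyDeriv_linePath, LinearMap.mulLeft_apply, X_mul, linePath]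

/-- This factor `n` is the origin of the factor `1 / N` in Dynkin's formula. -/
theorem coeff_eulerDeriv (p : A[X]) (n : ℕ) : (eulerDeriv K A p).coeff n = (n : K) • p.coeff n := by
  rw [eulerDeriv, LinearMap.comp_apply, LinearMap.mulLeft_apply, polyDeriv_apply]
  rcases n with _ | n
  · simp
  · rw [coeff_X_mul, coeff_derivative, Nat.cast_smul_eq_nsmul, nsmul_eq_mul, Nat.cast_comm]
    push_cast
    rfl

/-- The power of `X` counts the letters, so extracting a coefficient later selects words of a given
length. -/
theorem adLin_linePath_pow (x a : A) (r k : ℕ) :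
    (adLin K (linePath x) ^ r) (C a * X ^ k) = C ((adLin K x ^ r) a) * X ^ (r + k) := by
  induction r with
  | zero => simp
  | succ r ih =>
    have h1 : ∀ b c : A, ∀ m, (C b * X ^ m) * linePath c = C (b * c) * X ^ (m + 1) := by
      intro b c m
      rw [linePath, mul_assoc, ← mul_assoc (X ^ m), X_pow_mul, mul_assoc (C c), ← pow_succ,
        ← mul_assoc, C_mul]
    have h2 : ∀ b c : A, ∀ m, linePath c * (C b * X ^ m) = C (c * b) * X ^ (m + 1) := by
      intro b c m
      rw [linePath, mul_assoc, ← mul_assoc X, X_mul, mul_assoc (C b), ← pow_succ', ← mul_assoc, C_mul]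
    rw [pow_succ', Module.End.mul_apply, ih, pow_succ' (adLin K x), Module.End.mul_apply,
      adLin_apply, adLin_apply, h1, h2, ← sub_mul, ← C_sub, add_right_comm]

open scoped Nat

/-- The coefficient `1 / (r! s!)` of `x ^ r y ^ s` in `e ^ x e ^ y`. -/
noncomputable def dynkinCoeff (K : Type*) [Field K] (p : ℕ × ℕ) : K := ((p.1 ! * p.2 ! : ℕ) : K)⁻¹

theorem expTrunc_mul_expTrunc_apply (P : ℕ) (f g : Module.End K A) (b : A) :
    expTrunc K P f (expTrunc K P g b) = ∑ p ∈ Finset.range P ×ˢ Finset.range P,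
      dynkinCoeff K p • (f ^ p.1) ((g ^ p.2) b) := by
  rw [Finset.sum_product]
  simp only [expTrunc, LinearMap.sum_apply, LinearMap.smul_apply, map_sum, map_smul,
    Finset.smul_sum, smul_smul, dynkinCoeff]
  rw [Finset.sum_comm]
  simp only [Nat.cast_mul, mul_inv]
  exact Finset.sum_congr rfl fun i _ => Finset.sum_congr rfl fun j _ => by rw [mul_comm]

/-- The pairs of exponents, not both zero, in the Dynkin formula. -/
def dynkinPairs (P : ℕ) : Finset (ℕ × ℕ) :=
  (Finset.range P ×ˢ Finset.range P).filter fun p => 0 < p.1 + p.2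

/-- Subtracting the identity removes exactly the pair `(0, 0)`; this is the condition `rᵢ + sᵢ > 0`
in Dynkin's sum. -/
theorem expTrunc_mul_expTrunc_sub_one_apply {P : ℕ} (hP : 0 < P) (f g : Module.End K A) (b : A) :
    expTrunc K P f (expTrunc K P g b) - b = ∑ p ∈ dynkinPairs P,
      dynkinCoeff K p • (f ^ p.1) ((g ^ p.2) b) := by
  rw [expTrunc_mul_expTrunc_apply, sub_eq_iff_eq_add, dynkinPairs,
    ← Finset.sum_filter_add_sum_filter_not _ (fun p : ℕ × ℕ => 0 < p.1 + p.2)]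
  congr 1
  rw [Finset.sum_eq_single_of_mem (0, 0)]
  · simp [dynkinCoeff]
  · simp [hP]
  · rintro ⟨r, s⟩ h hne
    simp only [Finset.mem_filter] at h
    exact absurd (Prod.ext (by omega) (by omega)) hne

/-- The inner word must be nonempty: the bracket of the empty word is `0` by convention, whereas
that of `x` alone is `x`, not `ad_x 0`. -/
theorem nestedBracket_dynkinWord_cons (x y : A) {n : ℕ} (p : ℕ × ℕ) (m : Fin n → ℕ × ℕ)
    (hm : dynkinWord x y m ≠ []) :
    nestedBracket (fun a b => a * b - b * a) (dynkinWord x y (Fin.cons p m : Fin (n + 1) → ℕ × ℕ)) =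
      (adLin K x ^ p.1) ((adLin K y ^ p.2)
        (nestedBracket (fun a b => a * b - b * a) (dynkinWord x y m))) := by
  have h : ∀ a : A, (fun b : A => a * b - b * a) = adLin K a := fun a => rfl
  rw [dynkinWord_cons, nestedBracket_replicate_append _ _ _ (by simp [hm]),
    nestedBracket_replicate_append _ _ _ hm, h, h, ← Module.End.pow_apply, ← Module.End.pow_apply]

theorem nestedBracket_replicate {L : Type*} [Zero L] {br : L → L → L} (x : L) (hx : br x x = 0)
    (h0 : br x 0 = 0) (r : ℕ) :
    nestedBracket br (List.replicate (r + 2) x) = 0 := by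
  induction r with
  | zero => exact hx
  | succ r ih =>
    rw [List.replicate_succ, List.replicate_succ]
    exact (congrArg (br x) ih).trans h0

/-- The brackets of the words `x ^ r y ^ s`. -/
theorem sum_dynkinPairs [CharZero K] {P : ℕ} (hP : 2 ≤ P) (x y : A) :
    ∑ p ∈ dynkinPairs P, dynkinCoeff K p •
      (C (nestedBracket (fun a b => a * b - b * a)
        (dynkinWord x y (Fin.cons p Fin.elim0 : Fin 1 → ℕ × ℕ))) * X ^ (p.1 + p.2)) =
    linePath x + expTrunc K P (adLin K (linePath x)) (linePath y) := by
  have hword : ∀ p : ℕ × ℕ, dynkinWord x y (Fin.cons p Fin.elim0 : Fin 1 → ℕ × ℕ) =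
      List.replicate p.1 x ++ List.replicate p.2 y := by
    intro p
    rw [dynkinWord_cons]
    simp [dynkinWord]
  have hbr : ∀ z : A, (fun a b : A => a * b - b * a) z z = 0 := fun z => sub_self _
  have hbr0 : ∀ z : A, (fun a b : A => a * b - b * a) z 0 = 0 := fun z => by simp
  simp only [hword]
  set f : ℕ × ℕ → A[X] := fun p => dynkinCoeff K p •
    (C (nestedBracket (fun a b : A => a * b - b * a)
      (List.replicate p.1 x ++ List.replicate p.2 y)) * X ^ (p.1 + p.2)) with hf
  have h00 : f (0, 0) = 0 := by simp [hf, nestedBracket]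
  have h1 : ∑ p ∈ dynkinPairs P, f p = ∑ p ∈ Finset.range P ×ˢ Finset.range P, f p := by
    refine Finset.sum_subset (Finset.filter_subset _ _) ?_
    rintro ⟨r, s⟩ h h'
    have : ¬ 0 < r + s := fun h'' => h' (Finset.mem_filter.2 ⟨h, h''⟩)
    obtain ⟨rfl, rfl⟩ : r = 0 ∧ s = 0 := by omega
    exact h00
  -- A word ending in `y y`, or a word `x ^ r` with `r ≥ 2`, has the innermost bracket `[y, y]` or
  -- `[x, x]`. Only `x` and the words `x ^ r y` survive, giving `x + e^{ad x} y`.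
  have h2 : ∀ r s : ℕ, f (r, s + 2) = 0 := by
    intro r s
    have h3 : List.replicate (s + 2) y ≠ [] := by simp
    simp only [hf]
    rw [nestedBracket_replicate_append _ _ _ h3, nestedBracket_replicate y (hbr y) (hbr0 y),
      Function.iterate_fixed (hbr0 x), C_0, zero_mul, smul_zero]
  have h3 : ∀ r, f (r + 2, 0) = 0 := by
    intro r
    simp only [hf]
    rw [List.replicate_zero, List.append_nil, nestedBracket_replicate x (hbr x) (hbr0 x), C_0,
      zero_mul, smul_zero]
  -- The truncation has to contain the exponents `0` and `1`, whence `2 ≤ P`.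
  obtain ⟨P, rfl⟩ := Nat.exists_eq_add_of_le' hP
  have h4 : ∀ r, ∑ s ∈ Finset.range (P + 2), f (r, s) = f (r, 1) + f (r, 0) := by
    intro r
    rw [Finset.sum_range_succ', Finset.sum_range_succ', Finset.sum_eq_zero fun s _ => h2 r s, zero_add]
  rw [h1, Finset.sum_product]
  simp only [h4]
  rw [Finset.sum_add_distrib, add_comm]
  congr 1
  · rw [Finset.sum_range_succ', Finset.sum_range_succ', Finset.sum_eq_zero fun r _ => h3 r, h00,
      zero_add, add_zero]
    simp [hf, nestedBracket, linePath, dynkinCoeff]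
  · rw [expTrunc, LinearMap.sum_apply]
    refine Finset.sum_congr rfl fun r _ => ?_
    have h5 := adLin_linePath_pow (K := K) x y r 1
    rw [pow_one, ← linePath] at h5
    rw [LinearMap.smul_apply, h5]
    simp only [hf]
    rw [nestedBracket_replicate_append _ _ _ (by simp), Module.End.pow_apply]
    simp only [dynkinCoeff, Nat.factorial_one, mul_one]
    rfl

/-- The iterates of `e^{ad x} e^{ad y} - 1` in terms of nested brackets. -/
theorem pow_apply_eq_sum_dynkinWord [CharZero K] {P : ℕ} (hP : 2 ≤ P) (x y : A) (n : ℕ) :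
    ((expTrunc K P (adLin K (linePath x)) * expTrunc K P (adLin K (linePath y)) - 1 :
      Module.End K A[X]) ^ n)
        (linePath x + expTrunc K P (adLin K (linePath x)) (linePath y)) =
    ∑ m ∈ Fintype.piFinset fun _ : Fin (n + 1) => dynkinPairs P,
      (∏ i, dynkinCoeff K (m i)) • (C (nestedBracket (fun a b => a * b - b * a) (dynkinWord x y m)) *
        X ^ (∑ i, ((m i).1 + (m i).2))) := by
  induction n with
  | zero =>
    rw [pow_zero, Module.End.one_apply, sum_piFinset_cons, ← sum_dynkinPairs hP]
    refine Finset.sum_congr rfl fun p _ => ?_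
    rw [Finset.sum_eq_single_of_mem Fin.elim0
      (by rw [Fintype.mem_piFinset]; exact fun i => i.elim0) fun m _ hm =>
      absurd (Subsingleton.elim _ _) hm]
    simp
  | succ n ih =>
    conv_rhs => rw [sum_piFinset_cons]
    rw [pow_succ', Module.End.mul_apply, ih, map_sum, Finset.sum_comm]
    refine Finset.sum_congr rfl fun m hm => ?_
    rw [map_smul, LinearMap.sub_apply, Module.End.mul_apply, Module.End.one_apply,
      expTrunc_mul_expTrunc_sub_one_apply (by omega), Finset.smul_sum]
    refine Finset.sum_congr rfl fun p _ => ?_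
    have hne : dynkinWord x y m ≠ [] := by
      rw [← List.length_pos_iff, length_dynkinWord]
      have h0 := Fintype.mem_piFinset.1 hm 0
      rw [dynkinPairs, Finset.mem_filter] at h0
      rw [Fin.sum_univ_succ]
      omega
    rw [adLin_linePath_pow, adLin_linePath_pow, nestedBracket_dynkinWord_cons (K := K) x y p m hne,
      smul_smul]
    conv_rhs => rw [Fin.prod_univ_succ, Fin.sum_univ_succ]
    simp only [Fin.cons_zero, Fin.cons_succ]
    rw [mul_comm, add_assoc]

/-- In length `N < P` no exponent exceeds `N`, so truncating exponents at `P` or at `N + 1` gives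
the same words; and there are none with more than `N` blocks, each block being nonempty. -/
theorem coeff_sum_dynkinWord [CharZero K] {P N : ℕ} (hN : N < P) (x y : A) :
    (∑ n ∈ Finset.range P, ((-1 : K) ^ n / (n + 1 : ℕ)) •
      ∑ m ∈ Fintype.piFinset fun _ : Fin (n + 1) => dynkinPairs P,
        (∏ i, dynkinCoeff K (m i)) •
          (C (nestedBracket (fun a b => a * b - b * a) (dynkinWord x y m)) *
            X ^ (∑ i, ((m i).1 + (m i).2)) : A[X])).coeff N =
      (N : K) • bchTerm K (fun a b => a * b - b * a) x y N := by
  have hset : ∀ n, (Fintype.piFinset fun _ : Fin n => dynkinPairs P).filter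
      (fun m => N = ∑ i, ((m i).1 + (m i).2)) =
      (Fintype.piFinset fun _ : Fin n => Finset.range (N + 1) ×ˢ Finset.range (N + 1)).filter
        (fun m => (∀ i, 0 < (m i).1 + (m i).2) ∧ ∑ i, ((m i).1 + (m i).2) = N) := by
    intro n
    ext m
    simp only [Finset.mem_filter, Fintype.mem_piFinset, dynkinPairs, Finset.mem_product,
      Finset.mem_range]
    constructor
    · rintro ⟨h1, h2⟩
      refine ⟨fun i => ?_, fun i => (h1 i).2, h2.symm⟩
      have := Finset.single_le_sum (f := fun i => (m i).1 + (m i).2) (fun _ _ => Nat.zero_le _)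
        (Finset.mem_univ i)
      omega
    · rintro ⟨h1, h2, h3⟩
      refine ⟨fun i => ⟨?_, h2 i⟩, h3.symm⟩
      have := h1 i
      omega
  have hempty : ∀ n, N < n → (Fintype.piFinset fun _ : Fin n =>
      Finset.range (N + 1) ×ˢ Finset.range (N + 1)).filter
        (fun m => (∀ i, 0 < (m i).1 + (m i).2) ∧ ∑ i, ((m i).1 + (m i).2) = N) = ∅ := by
    intro n hn
    rw [Finset.filter_eq_empty_iff]
    rintro m - ⟨h1, h2⟩
    have : ∑ i : Fin n, 1 ≤ ∑ i, ((m i).1 + (m i).2) := Finset.sum_le_sum fun i _ => h1 i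
    simp at this
    omega
  have hcoeff : ∀ n, (∑ m ∈ Fintype.piFinset fun _ : Fin n => dynkinPairs P,
      (∏ i, dynkinCoeff K (m i)) • (C (nestedBracket (fun a b => a * b - b * a) (dynkinWord x y m)) *
        X ^ (∑ i, ((m i).1 + (m i).2)) : A[X])).coeff N =
      ∑ m ∈ (Fintype.piFinset fun _ : Fin n => Finset.range (N + 1) ×ˢ Finset.range (N + 1)) with
        (∀ i, 0 < (m i).1 + (m i).2) ∧ ∑ i, ((m i).1 + (m i).2) = N,
        (∏ i, dynkinCoeff K (m i)) • nestedBracket (fun a b => a * b - b * a) (dynkinWord x y m) := by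
    intro n
    rw [← hset, Finset.sum_filter, finsetSum_coeff]
    refine Finset.sum_congr rfl fun m _ => ?_
    rw [coeff_smul, coeff_C_mul, coeff_X_pow]
    split_ifs <;> simp
  rw [finsetSum_coeff]
  simp only [coeff_smul, hcoeff]
  rw [bchTerm, Finset.smul_sum, Finset.range_eq_Ico]
  -- The index `n` of the logarithm series corresponds to `n + 1` blocks, so the sum is shifted by
  -- one to reach `(-1) ^ (n - 1) / n`.
  refine (Finset.sum_Ico_add' (fun n =>
    ((-1 : K) ^ (n - 1) / (n : ℕ)) • ∑ m ∈ (Fintype.piFinset fun _ : Fin n =>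
      Finset.range (N + 1) ×ˢ Finset.range (N + 1)) with
        (∀ i, 0 < (m i).1 + (m i).2) ∧ ∑ i, ((m i).1 + (m i).2) = N,
        (∏ i, dynkinCoeff K (m i)) • nestedBracket (fun a b : A => a * b - b * a) (dynkinWord x y m))
    0 P 1).trans ?_
  refine (Finset.sum_subset (s₁ := Finset.Icc 1 N) ?_ ?_).symm.trans ?_
  · intro n hn
    simp only [Finset.mem_Icc, Finset.mem_Ico] at hn ⊢
    omega
  · intro n hn hn'
    simp only [Finset.mem_Icc, Finset.mem_Ico] at hn hn'
    rw [hempty n (by omega), Finset.sum_empty, smul_zero]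
  · refine Finset.sum_congr rfl fun n hn => ?_
    rw [smul_comm, Finset.smul_sum, Finset.smul_sum, Finset.smul_sum]
    refine Finset.sum_congr rfl fun m _ => ?_
    have hN0 : (N : K) ≠ 0 := by
      have := Finset.mem_Icc.1 hn
      exact Nat.cast_ne_zero.2 (by omega)
    rw [smul_smul (N : K)]
    congr 2
    simp only [dynkinCoeff]
    push_cast
    rw [mul_inv, ← mul_assoc, mul_inv_cancel₀ hN0, one_mul, Finset.prod_inv_distrib]

/-- The Baker-Campbell-Hausdorff formula, in Dynkin's form, for a nilpotent filtration. -/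
theorem expTrunc_sum_bchTerm [CharZero K] (F : RingFiltration K A) {M : ℕ} (hM : F.piece M = ⊥)
    (hM0 : 0 < M) {x y : A} (hx : x ∈ F.piece 1) (hy : y ∈ F.piece 1) :
    expTrunc K M (∑ N ∈ Finset.range M, bchTerm K (fun a b => a * b - b * a) x y N) =
      expTrunc K M x * expTrunc K M y := by
  have hxP := F.linePath_mem hx
  have hyP := F.linePath_mem hy
  have hB := F.poly_eq_bot hM
  set Xx := linePath x with hXx
  set Yy := linePath y with hYy
  set u := expTrunc K M Xx * expTrunc K M Yy - 1 with hu
  have hu1 : u ∈ F.poly.piece 1 := by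
    have : u = (expTrunc K M Xx - 1) * expTrunc K M Yy + (expTrunc K M Yy - 1) := by
      rw [hu]
      noncomm_ring
    rw [this]
    exact Submodule.add_mem _ (F.poly.mul_mem_right (F.poly.expTrunc_sub_one_mem hxP hM0))
      (F.poly.expTrunc_sub_one_mem hyP hM0)
  -- `M ≤ P` makes the truncations exact, `2 ≤ P` serves the innermost bracket, and the degree bound
  -- lets every coefficient of the logarithm be compared.
  obtain ⟨P, hMP, hP2, hPd⟩ : ∃ P, M ≤ P ∧ 2 ≤ P ∧ (logTrunc K M u).natDegree < P :=
    ⟨M + 2 + (logTrunc K M u).natDegree, by omega, by omega, by omega⟩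
  have hpow : ∀ {a : A[X]}, a ∈ F.poly.piece 1 → ∀ {Q}, M ≤ Q → a ^ Q = 0 :=
    fun ha => F.poly.pow_eq_zero hB ha
  have hadp : ∀ {a : A[X]}, a ∈ F.poly.piece 1 → ∀ {Q}, M ≤ Q → adLin K a ^ Q = 0 :=
    fun ha => F.poly.adLin_pow_eq_zero hB ha
  have hexp : ∀ {a : A[X]}, a ∈ F.poly.piece 1 → ∀ {Q}, M ≤ Q → expTrunc K Q a = expTrunc K M a :=
    fun ha _ hQ => expTrunc_of_le hQ (hpow ha le_rfl)
  have hED : ∀ {a : A[X]}, a ∈ F.poly.piece 1 → eulerDeriv K A a = a →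
      eulerDeriv K A (expTrunc K M a) = a * expTrunc K M a := by
    intro a ha h
    have := map_expTrunc_of_leibniz (eulerDeriv K A) eulerDeriv_mul (a := a)
      (by rw [h]; exact Commute.refl a) (hpow ha le_rfl)
    rwa [h, hexp ha (Nat.le_succ M)] at this
  have hinv : ∀ {a : A[X]}, a ∈ F.poly.piece 1 → expTrunc K M a * expTrunc K M (-a) = 1 :=
    fun ha => expTrunc_mul_neg hM0 (hpow ha le_rfl)
  have had : ∀ {a : A[X]}, a ∈ F.poly.piece 1 → ∀ b,
      expTrunc K P (adLin K a) b = expTrunc K M a * b * expTrunc K M (-a) := by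
    intro a ha b
    rw [expTrunc_adLin (hpow ha hMP) (hadp ha hMP), hexp ha hMP, hexp (Submodule.neg_mem _ ha) hMP]
  set w' := expTrunc K M (-Yy) * expTrunc K M (-Xx) with hw'
  have h1u : 1 + u = expTrunc K M Xx * expTrunc K M Yy := by rw [hu, add_sub_cancel]
  have hw : (1 + u) * w' = 1 := by
    rw [h1u, hw', mul_assoc, ← mul_assoc (expTrunc K M Yy), hinv hyP, one_mul, hinv hxP]
  -- Differentiating `e^{Xx} e^{Xy}` on the left: the `x` factor gives `Xx`, and the `y` factor
  -- gives `Xy` conjugated by `e^{Xx}`.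
  have hDu : eulerDeriv K A u * w' = Xx + expTrunc K P (adLin K Xx) Yy := by
    rw [hu, map_sub, map_one_of_leibniz _ eulerDeriv_mul, sub_zero, eulerDeriv_mul,
      hED hxP (eulerDeriv_linePath x), hED hyP (eulerDeriv_linePath y), had hxP, add_mul, mul_assoc Xx,
      ← h1u, mul_assoc Xx, hw, mul_one, hw']
    congr 1
    rw [mul_assoc, mul_assoc, ← mul_assoc _ (expTrunc K M (-Yy)), hinv hyP, one_mul, ← mul_assoc]
  have hop : (LinearMap.mulLeft K (1 + u) ∘ₗ LinearMap.mulRight K w' - 1 : Module.End K A[X]) =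
      expTrunc K P (adLin K Xx) * expTrunc K P (adLin K Yy) - 1 := by
    congr 1
    apply LinearMap.ext
    intro b
    rw [Module.End.mul_apply, had hxP, had hyP, LinearMap.comp_apply, LinearMap.mulRight_apply,
      LinearMap.mulLeft_apply, h1u, hw']
    simp only [mul_assoc]
  have hZ := map_logTrunc_eq_sum (eulerDeriv K A) eulerDeriv_mul (hpow hu1 hMP) (hadp hu1 hMP) hw
  rw [hop, hDu, logTrunc_of_le (hMP.trans (Nat.le_succ P)) (hpow hu1 le_rfl)] at hZ
  simp only [hXx, hYy, pow_apply_eq_sum_dynkinWord hP2] at hZ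
  have hc : ∀ N, 0 < N → N < P → (logTrunc K M u).coeff N =
      bchTerm K (fun a b => a * b - b * a) x y N := by
    intro N hN0 hN
    have h1 := congrArg (fun p => p.coeff N) hZ
    simp only [coeff_sum_dynkinWord hN, coeff_eulerDeriv] at h1
    exact smul_right_injective A (Nat.cast_ne_zero.2 hN0.ne' : (N : K) ≠ 0) h1
  -- Time `0` gives the constant coefficient, which the Euler derivation cannot see; time `1` gives
  -- the logarithm of `e^x e^y`.
  have hev : ∀ r : K, evalScalar A r (logTrunc K M u) =
      logTrunc K M (expTrunc K M (r • x) * expTrunc K M (r • y) - 1) := by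
    intro r
    rw [map_logTrunc, hu, map_sub, map_mul, map_expTrunc, map_expTrunc, map_one, hXx, hYy,
      evalScalar_linePath, evalScalar_linePath]
  have hc0 : (logTrunc K M u).coeff 0 = bchTerm K (fun a b => a * b - b * a) x y 0 := by
    rw [coeff_zero_eq_evalScalar (K := K), hev]
    simp [bchTerm, expTrunc_zero hM0, logTrunc_zero]
  have hsum : logTrunc K M (expTrunc K M x * expTrunc K M y - 1) =
      ∑ N ∈ Finset.range M, bchTerm K (fun a b => a * b - b * a) x y N := by
    have h1 := hev 1
    rw [one_smul, one_smul] at h1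
    rw [← h1, as_sum_range_C_mul_X_pow' _ hPd, map_sum]
    simp only [map_mul, map_pow, evalScalar_C, evalScalar_X, map_one, one_pow, mul_one]
    rw [Finset.sum_congr rfl fun N hN => ?_]
    -- Terms of degree `N ≥ M` lie in the zero piece of the filtration, so the sum up to `P` stops
    -- at `M`.
    · refine (Finset.sum_subset (by simpa using hMP) fun N _ hN => ?_).symm
      have := F.anti (not_lt.1 fun h => hN (Finset.mem_range.2 h)) (F.bchTerm_mem hx hy N)
      rwa [hM, Submodule.mem_bot] at this
    · rcases N with _ | N
      exacts [hc0, hc _ N.succ_pos (Finset.mem_range.1 hN)]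
  rw [← hsum, expTrunc_logTrunc hM0, add_sub_cancel]
  have h2 := congrArg (evalScalar A (1 : K)) (hpow hu1 le_rfl)
  rwa [map_pow, hu, map_sub, map_mul, map_expTrunc, map_expTrunc, map_one, hXx, hYy,
    evalScalar_linePath, evalScalar_linePath, one_smul, one_smul, map_zero] at h2

end BakerCampbellHausdorff

/-! ### Nilpotent quotients of a filtered algebra -/

section FiltrationQuotients

namespace RingFiltration

variable {K A : Type*} [Field K] [Ring A] [Algebra K A] (F : RingFiltration K A)

/-- The piece of a filtration, as a two-sided ideal. -/
def ideal (n : ℕ) : Ideal A where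
  carrier := F.piece n
  add_mem' := Submodule.add_mem _
  zero_mem' := Submodule.zero_mem _
  smul_mem' a _ h := F.mul_mem_left (a := a) h

instance (n : ℕ) : (F.ideal n).IsTwoSided :=
  ⟨fun b h => F.mul_mem_right (b := b) h⟩

/-- The quotient by a piece of a filtration. -/
def Quot (n : ℕ) : Type _ := A ⧸ F.ideal n

noncomputable instance (n : ℕ) : Ring (F.Quot n) := inferInstanceAs (Ring (A ⧸ F.ideal n))

noncomputable instance (n : ℕ) : Algebra K (F.Quot n) :=
  inferInstanceAs (Algebra K (A ⧸ F.ideal n))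

/-- The projection to the quotient by a piece of a filtration. -/
noncomputable def proj (n : ℕ) : A →ₐ[K] F.Quot n := Ideal.Quotient.mkₐ K (F.ideal n)

theorem proj_surjective (n : ℕ) : Function.Surjective (F.proj n) := Ideal.Quotient.mk_surjective

theorem proj_eq_zero {n : ℕ} {a : A} : F.proj n a = 0 ↔ a ∈ F.piece n :=
  Ideal.Quotient.eq_zero_iff_mem

/-- The induced filtration of a quotient. -/
noncomputable def quot (n : ℕ) : RingFiltration K (F.Quot n) := F.map (F.proj n) (F.proj_surjective n)

/-- This turns the truncated identities into exact ones: modulo the `n`-th piece, the image of the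
first piece is nilpotent of order `n`. -/
theorem quot_eq_bot (n : ℕ) : (F.quot n).piece n = ⊥ := by
  rw [eq_bot_iff]
  rintro _ ⟨f, hf, rfl⟩
  exact F.proj_eq_zero.2 hf

theorem proj_mem {n k : ℕ} {a : A} (ha : a ∈ F.piece k) : F.proj n a ∈ (F.quot n).piece k :=
  ⟨a, ha, rfl⟩

theorem neg_mem {a : A} {i : ℕ} (ha : a ∈ F.piece i) : -a ∈ F.piece i := Submodule.neg_mem _ ha

theorem map_adLin_pow {B : Type*} [Ring B] [Algebra K B] (φ : A →ₐ[K] B) (a b : A) (k : ℕ) :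
    φ ((adLin K a ^ k) b) = (adLin K (φ a) ^ k) (φ b) := by
  induction k with
  | zero => rfl
  | succ k ih =>
    rw [pow_succ', pow_succ', Module.End.mul_apply, Module.End.mul_apply, ← ih, adLin_apply,
      adLin_apply, map_sub, map_mul, map_mul]

theorem smul_adLin_pow_mem {a : A} (ha : a ∈ F.piece 1) (b : A) (r : K) (k : ℕ) :
    r • (adLin K a ^ k) b ∈ F.piece k := by
  have := F.adLin_pow_mem ha (F.mem_zero b) k
  rw [zero_add] at this
  exact Submodule.smul_mem _ _ this

theorem proj_pow_eq_zero {a : A} (ha : a ∈ F.piece 1) (n : ℕ) : F.proj n a ^ n = 0 :=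
  (F.quot n).pow_eq_zero (F.quot_eq_bot n) (F.proj_mem ha) le_rfl

theorem proj_adLin_pow_eq_zero {a : A} (ha : a ∈ F.piece 1) (n : ℕ) :
    adLin K (F.proj n a) ^ n = 0 :=
  (F.quot n).adLin_pow_eq_zero (F.quot_eq_bot n) (F.proj_mem ha) le_rfl

theorem expTrunc_proj_mul_neg [CharZero K] {a : A} (ha : a ∈ F.piece 1) {n : ℕ} (hn : 0 < n) :
    expTrunc K n (F.proj n a) * expTrunc K n (F.proj n (-a)) = 1 := by
  rw [map_neg, expTrunc_mul_neg hn (F.proj_pow_eq_zero ha n)]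

theorem expTrunc_proj_conj [CharZero K] {a : A} (ha : a ∈ F.piece 1) (b : A) (n : ℕ) :
    expTrunc K n (F.proj n a) * F.proj n b * expTrunc K n (F.proj n (-a)) =
      ∑ k ∈ Finset.range n, F.proj n (((k.factorial : ℕ) : K)⁻¹ • (adLin K a ^ k) b) := by
  rw [map_neg, ← expTrunc_adLin (F.proj_pow_eq_zero ha n) (F.proj_adLin_pow_eq_zero ha n), expTrunc,
    LinearMap.sum_apply]
  exact Finset.sum_congr rfl fun k _ => by rw [map_smul, map_adLin_pow, LinearMap.smul_apply]

theorem expTrunc_sum_bchTerm_proj [CharZero K] {x y : A} (hx : x ∈ F.piece 1) (hy : y ∈ F.piece 1)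
    {n : ℕ} (hn : 0 < n) :
    expTrunc K n (∑ N ∈ Finset.range n,
      bchTerm K (fun a b => a * b - b * a) (F.proj n x) (F.proj n y) N) =
      expTrunc K n (F.proj n x) * expTrunc K n (F.proj n y) :=
  expTrunc_sum_bchTerm (F.quot n) (F.quot_eq_bot n) hn (F.proj_mem hx) (F.proj_mem hy)

end RingFiltration

end FiltrationQuotients

/-! ### The weight filtration and convergent series in the convolution algebra -/

noncomputable section WeightFiltration

variable {K : Type u} [Field K] {Q : QuadraticData.{u, v} K} {V : ChainComplex (ModuleCat.{w} K) ℤ}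

theorem conv_ext {f g : Conv Q V} (h : ∀ n c, f.ofConv (Q.incl n c) = g.ofConv (Q.incl n c)) :
    f = g :=
  WithConv.ext (Q.dual_hom_ext h)

theorem conv_mul_apply (f g : Conv Q V) (c : Q.Dual) :
    (f * g).ofConv c = LinearMap.mul' K _ (TensorProduct.map f.ofConv g.ofConv
      (CoalgebraStruct.comul (R := K) c)) := rfl

theorem conv_mul_incl (f g : Conv Q V) (n : ℕ) (c : Q.dualWeight n) :
    (f * g).ofConv (Q.incl n c) = ∑ p ∈ (Finset.HasAntidiagonal.antidiagonal n).attach,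
      LinearMap.mul' K _ (TensorProduct.map (f.ofConv ∘ₗ Q.incl p.1.1) (g.ofConv ∘ₗ Q.incl p.1.2)
        (Q.deconc (Finset.HasAntidiagonal.mem_antidiagonal.1 p.2) c)) := by
  rw [conv_mul_apply, Q.comul_incl, map_sum, map_sum]
  refine Finset.sum_congr rfl fun p _ => ?_
  rw [TensorProduct.map_comp, LinearMap.comp_apply]

variable (Q V) in
/-- The filtration of the convolution algebra by the maps which vanish in weights `< k`. -/
def convFiltration : RingFiltration K (Conv Q V) where
  piece k :=
    { carrier := {f | ∀ m < k, ∀ c, f.ofConv (Q.incl m c) = 0}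
      add_mem' := fun hf hg m hm c => by
        rw [WithConv.ofConv_add, LinearMap.add_apply, hf m hm, hg m hm, add_zero]
      zero_mem' := fun m _ c => by simp
      smul_mem' := fun r f hf m hm c => by
        rw [WithConv.ofConv_smul, LinearMap.smul_apply, hf m hm, smul_zero] }
  zero := by
    ext f
    exact ⟨fun _ => trivial, fun _ m hm => absurd hm (Nat.not_lt_zero m)⟩
  anti i j h f hf m hm := hf m (hm.trans_le h)
  mul_mem {i j f g} hf hg m hm c := by
    rw [conv_mul_incl]
    refine Finset.sum_eq_zero fun p _ => ?_
    have hp := Finset.HasAntidiagonal.mem_antidiagonal.1 p.2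
    -- If the two weights add up to less than `i + j`, either the first is below `i` or the second
    -- is below `j`.
    rcases lt_or_ge p.1.1 i with h | h
    · have : f.ofConv ∘ₗ Q.incl p.1.1 = 0 := LinearMap.ext fun c => hf _ h c
      rw [this, TensorProduct.map_zero_left, LinearMap.zero_apply, map_zero]
    · have : g.ofConv ∘ₗ Q.incl p.1.2 = 0 := LinearMap.ext fun c => hg _ (by omega) c
      rw [this, TensorProduct.map_zero_right, LinearMap.zero_apply, map_zero]

theorem mem_convFiltration {f : Conv Q V} {k : ℕ} :
    f ∈ (convFiltration Q V).piece k ↔ ∀ m < k, ∀ c, f.ofConv (Q.incl m c) = 0 := Iff.rfl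

variable (Q) in
theorem incl_zero_eq (c : Q.dualWeight 0) :
    Q.incl 0 c = CoalgebraStruct.counit (R := K) (Q.incl 0 c) • Q.unitI := by
  rw [QuadraticData.unitI, ← map_smul]
  congr 1
  apply Subtype.ext
  rw [Submodule.coe_smul, ← Q.counit_incl_zero c, Algebra.algebraMap_eq_smul_one]

theorem mem_convFiltration_one {f : Conv Q V} :
    f ∈ (convFiltration Q V).piece 1 ↔ f.ofConv Q.unitI = 0 := by
  rw [mem_convFiltration]
  constructor
  · intro h
    exact h 0 Nat.one_pos _
  · intro h m hm c
    obtain rfl : m = 0 := by omega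
    rw [incl_zero_eq, map_smul, h, smul_zero]

/-- The filtration is separated: level `n + 1` detects the component of weight `n`. -/
theorem conv_ext_proj {f g : Conv Q V} (h : ∀ n, (convFiltration Q V).proj (n + 1) f = (convFiltration Q V).proj (n + 1) g) :
    f = g := by
  rw [← sub_eq_zero]
  apply conv_ext
  intro n c
  have h1 : (convFiltration Q V).proj (n + 1) (f - g) = 0 := by rw [map_sub, h, sub_self]
  exact (convFiltration Q V).proj_eq_zero.1 h1 n n.lt_succ_self c

theorem weightSum_incl (F : ℕ → Conv Q V) (n : ℕ) (c : Q.dualWeight n) :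
    (weightSum F).ofConv (Q.incl n c) = ∑ k ∈ Finset.range (n + 1), (F k).ofConv (Q.incl n c) := by
  refine (DirectSum.toModule_lof (M := fun n => Q.dualWeight n) K n c).trans ?_
  rw [LinearMap.comp_apply, WithConv.ofConv_sum, LinearMap.sum_apply]

/-- In weight `m` the series is cut after `k = m`, and `hF` kills every later term there. Hence the
series reduces to a finite sum modulo each piece. -/
theorem convProj_weightSum {F : ℕ → Conv Q V} (hF : ∀ k, F k ∈ (convFiltration Q V).piece k)
    (n : ℕ) : (convFiltration Q V).proj n (weightSum F) = ∑ k ∈ Finset.range n, (convFiltration Q V).proj n (F k) := by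
  rw [← map_sum, ← sub_eq_zero, ← map_sub, (convFiltration Q V).proj_eq_zero]
  intro m hm c
  rw [WithConv.ofConv_sub, LinearMap.sub_apply, weightSum_incl, WithConv.ofConv_sum,
    LinearMap.sum_apply, sub_eq_zero]
  refine Finset.sum_subset (by simpa using hm) fun k _ hk => ?_
  exact hF k m (by simpa using hk) c

theorem convProj_convExp {l : Conv Q V} (hl : l ∈ (convFiltration Q V).piece 1) (n : ℕ) :
    (convFiltration Q V).proj n (convExp l) = expTrunc K n ((convFiltration Q V).proj n l) := by
  rw [convExp, convProj_weightSum, expTrunc]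
  · simp only [map_smul, map_pow]
  · exact fun k => Submodule.smul_mem _ _ ((convFiltration Q V).pow_mem_one hl k)

variable (Q V) in
theorem gradedBracket_zero_zero : gradedBracket 0 0 = fun f g : Conv Q V => f * g - g * f := by
  funext f g
  simp [gradedBracket, convStar, Module.End.one_eq_id]

theorem convProj_convBCH {x y : Conv Q V} (hx : x ∈ (convFiltration Q V).piece 1)
    (hy : y ∈ (convFiltration Q V).piece 1) (n : ℕ) :
    (convFiltration Q V).proj n (convBCH x y) = ∑ N ∈ Finset.range n,
      bchTerm K (fun a b => a * b - b * a) ((convFiltration Q V).proj n x) ((convFiltration Q V).proj n y) N := by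
  rw [convBCH, gradedBracket_zero_zero, convProj_weightSum]
  · refine Finset.sum_congr rfl fun N _ => ?_
    exact map_bchTerm (br := fun a b => a * b - b * a) (br' := fun a b => a * b - b * a)
      ((convFiltration Q V).proj n).toLinearMap (fun a b => by simp) x y N
  · exact (convFiltration Q V).bchTerm_mem hx hy

/-- The logarithm of an element with constant term `1`. -/
noncomputable def convLog (f : Conv Q V) : Conv Q V :=
  weightSum fun k => ((-1 : K) ^ (k + 1) / k) • (f - 1) ^ k

theorem convProj_convLog {f : Conv Q V} (hf : f - 1 ∈ (convFiltration Q V).piece 1) (n : ℕ) :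
    (convFiltration Q V).proj n (convLog f) = logTrunc K n ((convFiltration Q V).proj n f - 1) := by
  rw [convLog, convProj_weightSum, logTrunc]
  · simp only [map_smul, map_pow, map_sub, map_one]
  · exact fun k => Submodule.smul_mem _ _ ((convFiltration Q V).pow_mem_one hf k)

theorem weightSum_mem_one {F : ℕ → Conv Q V} (h0 : F 0 ∈ (convFiltration Q V).piece 1) :
    weightSum F ∈ (convFiltration Q V).piece 1 := by
  intro m hm c
  obtain rfl : m = 0 := by omega
  rw [weightSum_incl]
  simpa using h0 0 Nat.one_pos c

theorem convLog_mem (f : Conv Q V) : convLog f ∈ (convFiltration Q V).piece 1 :=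
  weightSum_mem_one (by simp)

theorem convBCH_mem (x y : Conv Q V) : convBCH x y ∈ (convFiltration Q V).piece 1 :=
  weightSum_mem_one (by simp [bchTerm])

theorem convExp_sub_one_mem (l : Conv Q V) : convExp l - 1 ∈ (convFiltration Q V).piece 1 := by
  intro m hm c
  obtain rfl : m = 0 := by omega
  rw [WithConv.ofConv_sub, LinearMap.sub_apply, convExp, weightSum_incl]
  simp

variable [CharZero K]

/-- Modulo each piece both sides are truncated, and the identity is Dynkin's formula for nilpotent
filtrations. -/
theorem convExp_convBCH {x y : Conv Q V} (hx : x ∈ (convFiltration Q V).piece 1)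
    (hy : y ∈ (convFiltration Q V).piece 1) : convExp (convBCH x y) = convExp x * convExp y := by
  refine conv_ext_proj fun n => ?_
  rw [convProj_convExp (convBCH_mem x y), convProj_convBCH hx hy, map_mul, convProj_convExp hx,
    convProj_convExp hy]
  exact (convFiltration Q V).expTrunc_sum_bchTerm_proj hx hy n.succ_pos

theorem convExp_convLog {f : Conv Q V} (hf : f - 1 ∈ (convFiltration Q V).piece 1) :
    convExp (convLog f) = f := by
  refine conv_ext_proj fun n => ?_
  have h := (convFiltration Q V).proj_pow_eq_zero hf (n + 1)
  rw [map_sub, map_one] at h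
  rw [convProj_convExp (convLog_mem f), convProj_convLog hf, expTrunc_logTrunc n.succ_pos h,
    add_sub_cancel]

theorem convLog_convExp {l : Conv Q V} (hl : l ∈ (convFiltration Q V).piece 1) :
    convLog (convExp l) = l := by
  refine conv_ext_proj fun n => ?_
  rw [convProj_convLog (convExp_sub_one_mem l), convProj_convExp hl,
    logTrunc_expTrunc n.succ_pos ((convFiltration Q V).proj_pow_eq_zero hl _)]

theorem convExp_mul_neg {l : Conv Q V} (hl : l ∈ (convFiltration Q V).piece 1) :
    convExp l * convExp (-l) = 1 := by
  refine conv_ext_proj fun n => ?_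
  rw [map_mul, convProj_convExp hl, convProj_convExp ((convFiltration Q V).neg_mem hl), map_one]
  exact (convFiltration Q V).expTrunc_proj_mul_neg hl n.succ_pos

theorem convExp_neg_mul {l : Conv Q V} (hl : l ∈ (convFiltration Q V).piece 1) :
    convExp (-l) * convExp l = 1 := by
  have h := convExp_mul_neg ((convFiltration Q V).neg_mem hl)
  rwa [show -(-l) = l from neg_neg l] at h

open scoped Nat in
/-- `e^{ad_l} D = e^l D e^{-l}`. -/
theorem weightSum_adLin {l : Conv Q V} (hl : l ∈ (convFiltration Q V).piece 1) (D : Conv Q V) :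
    weightSum (fun k => ((k ! : ℕ) : K)⁻¹ • (adLin K l ^ k) D) =
      convExp l * D * convExp (-l) := by
  refine conv_ext_proj fun n => ?_
  rw [map_mul, map_mul, convProj_convExp hl, convProj_convExp ((convFiltration Q V).neg_mem hl),
    convProj_weightSum fun k => (convFiltration Q V).smul_adLin_pow_mem hl D _ k]
  exact ((convFiltration Q V).expTrunc_proj_conj hl D (n + 1)).symm

end WeightFiltration

/-! ### Detecting degrees by rescaling -/

noncomputable section Scaling

variable {K : Type u} [Field K]

/-- The operator `x ↦ a ^ (|x| + s) x` on a graded vector space. -/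
def scaleOp (a : K) (E : ℤ → ModuleCat.{v} K) (s : ℤ) : (⨁ i, E i) →ₗ[K] (⨁ i, E i) :=
  DirectSum.toModule K ℤ _ fun i => (a ^ (i + s)) • DirectSum.lof K ℤ (fun i => E i) i

theorem scaleOp_lof (a : K) (E : ℤ → ModuleCat.{v} K) (s i : ℤ) (x : E i) :
    scaleOp a E s (DirectSum.lof K ℤ (fun i => E i) i x) =
      (a ^ (i + s)) • DirectSum.lof K ℤ (fun i => E i) i x := by
  rw [scaleOp, DirectSum.toModule_lof, LinearMap.smul_apply]

theorem scaleOp_of_mem (a : K) {E : ℤ → ModuleCat.{v} K} (s : ℤ) {i : ℤ} {x : ⨁ i, E i}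
    (hx : x ∈ homDegree E i) : scaleOp a E s x = (a ^ (i + s)) • x := by
  obtain ⟨x, rfl⟩ := hx
  exact scaleOp_lof a E s i x

theorem graded_hom_ext {E : ℤ → ModuleCat.{v} K} {M : Type*} [AddCommGroup M] [Module K M]
    {f g : (⨁ i, E i) →ₗ[K] M} (h : ∀ i, ∀ x ∈ homDegree E i, f x = g x) : f = g :=
  DirectSum.linearMap_ext K fun i => LinearMap.ext fun x => h i _ ⟨x, rfl⟩

/-- Characteristic zero embeds `ℚ`, where the powers of `2` are distinct; so the eigenvalue of
`2^{|x|}` recovers the degree. -/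
theorem zpow_two_injective [CharZero K] {i j : ℤ} (h : (2 : K) ^ i = 2 ^ j) : i = j := by
  have h1 : (((2 : ℚ) ^ i : ℚ) : K) = (((2 : ℚ) ^ j : ℚ) : K) := by
    push_cast
    exact h
  exact zpow_right_injective₀ (by norm_num) (by norm_num) (Rat.cast_injective h1)

theorem mem_homDegree_of_scaleOp [CharZero K] {E : ℤ → ModuleCat.{v} K} {i : ℤ} {x : ⨁ i, E i}
    (hx : scaleOp 2 E 0 x = ((2 : K) ^ i) • x) : x ∈ homDegree E i := by
  have h0 : ∀ j, DirectSum.component K ℤ (fun i => E i) j ∘ₗ scaleOp 2 E 0 =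
      ((2 : K) ^ j) • DirectSum.component K ℤ (fun i => E i) j := by
    intro j
    apply graded_hom_ext
    rintro i _ ⟨y, rfl⟩
    rw [LinearMap.comp_apply, scaleOp_lof, map_smul, LinearMap.smul_apply, add_zero]
    by_cases hij : i = j
    · subst hij
      rfl
    · rw [DirectSum.component.of, dif_neg hij, smul_zero, smul_zero]
  have h1 : ∀ j, j ≠ i → DirectSum.component K ℤ (fun i => E i) j x = 0 := by
    intro j hj
    have h2 := LinearMap.congr_fun (h0 j) x
    rw [LinearMap.comp_apply, hx, map_smul, LinearMap.smul_apply, ← sub_eq_zero, ← sub_smul] at h2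
    exact (smul_eq_zero.1 h2).resolve_left fun h3 => hj (zpow_two_injective (sub_eq_zero.1 h3)).symm
  refine ⟨DirectSum.component K ℤ (fun i => E i) i x, ?_⟩
  refine DirectSum.ext_component K fun j => ?_
  by_cases hij : i = j
  · subst hij
    exact DirectSum.component.lof_self (M := fun i => E i) K i _
  · rw [h1 j (Ne.symm hij), DirectSum.lof_eq_of]
    exact (DirectSum.component.of (M := fun i => E i) K j i _).trans (dif_neg hij)

/-- A stable subspace contains the eigencomponents of its elements: applying `θ - χ j` removes one
component and multiplies the others by nonzero scalars, so induction applies. -/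
theorem mem_of_sum_mem {M ι : Type*} [AddCommGroup M] [Module K M] {θ : Module.End K M}
    {p : Submodule K M} (hp : ∀ x ∈ p, θ x ∈ p) {χ : ι → K} (hχ : Function.Injective χ)
    (s : Finset ι) : ∀ v : ι → M, (∀ i, θ (v i) = χ i • v i) → ∑ i ∈ s, v i ∈ p →
      ∀ i ∈ s, v i ∈ p := by
  classical
  induction s using Finset.induction_on with
  | empty => simp
  | insert j t hj ih =>
    intro v hv hs
    have h1 : ∀ i ∈ t, v i ∈ p := by
      intro i hi
      have h2 := ih (fun i => (χ i - χ j) • v i)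
        (fun i => by rw [map_smul, hv, smul_comm]) (by
          have h3 := Submodule.sub_mem _ (hp _ hs) (Submodule.smul_mem _ (χ j) hs)
          rw [Finset.sum_insert hj, map_add, map_sum, smul_add, hv, add_sub_add_left_eq_sub,
            Finset.smul_sum, ← Finset.sum_sub_distrib] at h3
          simpa only [hv, sub_smul] using h3) i hi
      have hne : χ i - χ j ≠ 0 := sub_ne_zero.2 fun h => hj (hχ h ▸ hi)
      have h4 := Submodule.smul_mem _ (χ i - χ j)⁻¹ h2
      rwa [smul_smul, inv_mul_cancel₀ hne, one_smul] at h4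
    intro i hi
    rcases Finset.mem_insert.1 hi with rfl | hi
    · rw [Finset.sum_insert hj] at hs
      simpa using Submodule.sub_mem _ hs (Submodule.sum_mem _ h1)
    · exact h1 i hi

theorem tensorDegree_mul {M : Type*} [AddCommGroup M] [Module K M] (deg : ℤ → Submodule K M)
    (s i j : ℤ) :
    tensorDegree K deg s i * tensorDegree K deg s j ≤ tensorDegree K deg s (i + j) := by
  rw [tensorDegree, tensorDegree, Submodule.span_mul_span, Submodule.span_le]
  rintro _ ⟨_, ⟨l, hl, hl', rfl⟩, _, ⟨m, hm, hm', rfl⟩, rfl⟩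
  refine Submodule.subset_span ⟨l ++ m, ?_, by simp [hl', hm'], by simp⟩
  intro p hp
  rcases List.mem_append.1 hp with h | h
  exacts [hl p h, hm p h]

theorem ι_mem_tensorDegree {M : Type*} [AddCommGroup M] [Module K M] {deg : ℤ → Submodule K M}
    (s : ℤ) {d : ℤ} {x : M} (hx : x ∈ deg d) : TensorAlgebra.ι K x ∈ tensorDegree K deg s (d + s) :=
  Submodule.subset_span ⟨[(d, x)], by simpa using hx, by simp, by simp⟩

theorem iSup_tensorDegree {M : Type*} [AddCommGroup M] [Module K M] {deg : ℤ → Submodule K M}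
    (hdeg : ⨆ i, deg i = ⊤) (s : ℤ) : ⨆ i, tensorDegree K deg s i = ⊤ := by
  rw [eq_top_iff]
  rintro t -
  induction t using TensorAlgebra.induction with
  | algebraMap r =>
    rw [Algebra.algebraMap_eq_smul_one]
    refine Submodule.smul_mem _ _ (Submodule.mem_iSup_of_mem 0 ?_)
    exact Submodule.subset_span ⟨[], by simp, by simp, by simp⟩
  | ι x =>
    have h : ⨆ i, deg i ≤ (⨆ i, tensorDegree K deg s i).comap (TensorAlgebra.ι K) :=
      iSup_le fun i x hx => Submodule.mem_iSup_of_mem (i + s) (ι_mem_tensorDegree s hx)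
    rw [hdeg] at h
    exact h trivial
  | mul a b ha hb =>
    have h : (⨆ i, tensorDegree K deg s i) * (⨆ i, tensorDegree K deg s i) ≤
        ⨆ i, tensorDegree K deg s i := by
      rw [Submodule.iSup_mul]
      refine iSup_le fun i => ?_
      rw [Submodule.mul_iSup]
      exact iSup_le fun j => (tensorDegree_mul deg s i j).trans (le_iSup _ (i + j))
    exact h (Submodule.mul_mem_mul ha hb)
  | add a b ha hb => exact Submodule.add_mem _ ha hb

theorem iSup_homDegree (E : ℤ → ModuleCat.{v} K) : ⨆ i, homDegree E i = ⊤ := by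
  rw [eq_top_iff]
  rintro x -
  induction x using DirectSum.induction_on with
  | zero => exact Submodule.zero_mem _
  | of i x =>
    exact Submodule.mem_iSup_of_mem i ⟨x, rfl⟩
  | add x y hx hy => exact Submodule.add_mem _ hx hy

namespace QuadraticData

variable (Q : QuadraticData.{u, v} K)

/-- The algebra endomorphism `x ↦ a ^ |x| x` of the tensor algebra on `sE`. -/
def scaleAlg (a : K) : TensorAlgebra K Q.Gen →ₐ[K] TensorAlgebra K Q.Gen :=
  TensorAlgebra.lift K (TensorAlgebra.ι K ∘ₗ scaleOp a Q.E 1)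

theorem scaleAlg_ι (a : K) (x : Q.Gen) :
    Q.scaleAlg a (TensorAlgebra.ι K x) = TensorAlgebra.ι K (scaleOp a Q.E 1 x) := by
  simp [scaleAlg]

theorem scaleAlg_of_mem {a : K} (ha : a ≠ 0) {i : ℤ} {t : TensorAlgebra K Q.Gen}
    (ht : t ∈ tensorDegree K (homDegree Q.E) 1 i) : Q.scaleAlg a t = a ^ i • t := by
  have h : tensorDegree K (homDegree Q.E) 1 i ≤
      LinearMap.ker ((Q.scaleAlg a).toLinearMap - a ^ i • LinearMap.id) := by
    clear ht
    rw [tensorDegree, Submodule.span_le]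
    rintro _ ⟨l, hl, rfl, rfl⟩
    rw [SetLike.mem_coe, LinearMap.mem_ker, LinearMap.sub_apply, sub_eq_zero]
    induction l with
    | nil => simp
    | cons p l ih =>
      have h1 := ih fun q hq => hl q (List.mem_cons_of_mem _ hq)
      have h2 := hl p (by simp)
      simp only [AlgHom.toLinearMap_apply, LinearMap.smul_apply, LinearMap.id_apply, List.map_cons,
        List.prod_cons, List.sum_cons, map_mul, scaleAlg_ι] at h1 ⊢
      rw [h1, scaleOp_of_mem a 1 h2, map_smul, smul_mul_smul_comm, zpow_add₀ ha (p.1 + 1)]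
  have := h ht
  rwa [LinearMap.mem_ker, LinearMap.sub_apply, sub_eq_zero] at this

theorem scaleOp_sq_mem {a : K} (ha : a ≠ 0) {r : Q.Gen ⊗[K] Q.Gen} (hr : r ∈ Q.R) :
    TensorProduct.map (scaleOp a Q.E 1) (scaleOp a Q.E 1) r ∈ Q.R := by
  have h : Q.R ≤ Q.R.comap (TensorProduct.map (scaleOp a Q.E 1) (scaleOp a Q.E 1)) := by
    refine Q.homogeneous.trans (iSup_le fun n => ?_)
    rintro x ⟨hx, hx'⟩
    -- The exponent is `n + 2`: two suspensions raise the total degree by two.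
    have key : tensorSqDegree Q.E n ≤ LinearMap.ker
        (TensorProduct.map (scaleOp a Q.E 1) (scaleOp a Q.E 1) - (a ^ (n + 2)) • LinearMap.id) := by
      refine iSup_le fun i => iSup_le fun j => iSup_le fun hij => ?_
      rintro _ ⟨t, rfl⟩
      induction t with
      | zero => simp
      | tmul b c =>
        rw [LinearMap.mem_ker, LinearMap.sub_apply, sub_eq_zero]
        simp only [TensorProduct.map_tmul, Submodule.subtype_apply, scaleOp_of_mem a 1 b.2,
          scaleOp_of_mem a 1 c.2, LinearMap.smul_apply, LinearMap.id_apply, TensorProduct.tmul_smul,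
          TensorProduct.smul_tmul', smul_smul]
        rw [← zpow_add₀ ha, show j + 1 + (i + 1) = n + 2 by omega]
      | add b c hb hc => rw [map_add]; exact Submodule.add_mem _ hb hc
    have := key hx'
    rw [LinearMap.mem_ker, LinearMap.sub_apply, sub_eq_zero] at this
    rw [Submodule.mem_comap, this]
    exact Submodule.smul_mem _ _ hx
  exact h hr

theorem map_scaleAlg_words (a : K) (n : ℕ) :
    (Q.words n).map (Q.scaleAlg a).toLinearMap ≤ Q.words n := by
  rw [words, Submodule.map_pow]
  gcongr
  rintro _ ⟨_, ⟨x, rfl⟩, rfl⟩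
  exact ⟨scaleOp a Q.E 1 x, (Q.scaleAlg_ι a x).symm⟩

theorem map_scaleAlg_suspR {a : K} (ha : a ≠ 0) :
    Q.suspR.map (Q.scaleAlg a).toLinearMap ≤ Q.suspR := by
  rintro _ ⟨_, ⟨r, hr, rfl⟩, rfl⟩
  refine ⟨_, Q.scaleOp_sq_mem ha hr, ?_⟩
  have hc : ∀ x : Q.Gen, signOp Q.E 0 (scaleOp a Q.E 1 x) = scaleOp a Q.E 1 (signOp Q.E 0 x) := by
    intro x
    refine LinearMap.congr_fun (f := signOp Q.E 0 ∘ₗ scaleOp a Q.E 1)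
      (g := scaleOp a Q.E 1 ∘ₗ signOp Q.E 0) (graded_hom_ext ?_) x
    rintro i _ ⟨y, rfl⟩
    simp only [LinearMap.comp_apply, signOp_lof, scaleOp_lof, map_smul, smul_smul, mul_comm]
  generalize r = t
  induction t with
  | zero => simp
  | tmul b c => simp [mulGen, scaleAlg, hc]
  | add b c hb hc => simp only [map_add, hb, hc]

theorem scaleAlg_mem {a : K} (ha : a ≠ 0) (n : ℕ) (c : TensorAlgebra K Q.Gen)
    (hc : c ∈ Q.dualWeight n) : (Q.scaleAlg a).toLinearMap c ∈ Q.dualWeight n := by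
  refine ⟨Q.map_scaleAlg_words a n ⟨c, hc.1, rfl⟩, ?_⟩
  rw [SetLike.mem_coe, Submodule.mem_iInf]
  intro p
  have h := (Submodule.mem_iInf _).1 hc.2 p
  have h' : (Q.words p.1.1 * Q.suspR * Q.words p.1.2).map (Q.scaleAlg a).toLinearMap ≤
      Q.words p.1.1 * Q.suspR * Q.words p.1.2 := by
    rw [Submodule.map_mul, Submodule.map_mul]
    gcongr
    exacts [Q.map_scaleAlg_words a _, Q.map_scaleAlg_suspR ha, Q.map_scaleAlg_words a _]
  exact h' ⟨c, h, rfl⟩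

/-- The operator `c ↦ a ^ |c| c` on a weight component. -/
def scaleWeight {a : K} (ha : a ≠ 0) (n : ℕ) : Q.dualWeight n →ₗ[K] Q.dualWeight n :=
  (Q.scaleAlg a).toLinearMap.restrict (Q.scaleAlg_mem ha n)

/-- The operator `c ↦ a ^ |c| c` of the Koszul dual coalgebra. -/
def scaleDual {a : K} (ha : a ≠ 0) : Q.Dual →ₗ[K] Q.Dual :=
  Q.desc fun n => Q.incl n ∘ₗ Q.scaleWeight ha n

theorem sign_eq_scaleDual : Q.sign = Q.scaleDual (neg_ne_zero.2 one_ne_zero) := rfl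

theorem scaleDual_incl {a : K} (ha : a ≠ 0) (n : ℕ) (c : Q.dualWeight n) :
    Q.scaleDual ha (Q.incl n c) = Q.incl n (Q.scaleWeight ha n c) :=
  DirectSum.toModule_lof (M := fun n => Q.dualWeight n) K n c

theorem dual_ext {c d : Q.Dual} (h : ∀ n, Q.comp n c = Q.comp n d) : c = d :=
  DirectSum.ext_component K fun n => Subtype.ext (h n)

theorem comp_scaleDual {a : K} (ha : a ≠ 0) (n : ℕ) (c : Q.Dual) :
    Q.comp n (Q.scaleDual ha c) = Q.scaleAlg a (Q.comp n c) := by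
  refine LinearMap.congr_fun (f := Q.comp n ∘ₗ Q.scaleDual ha)
    (g := (Q.scaleAlg a).toLinearMap ∘ₗ Q.comp n) (Q.dual_hom_ext fun m c => ?_) c
  rw [LinearMap.comp_apply, LinearMap.comp_apply, scaleDual_incl]
  by_cases h : m = n
  · subst h
    rw [comp_incl_self, comp_incl_self]
    rfl
  · rw [Q.comp_incl_of_ne h, Q.comp_incl_of_ne h, map_zero]

theorem scaleDual_of_mem {a : K} (ha : a ≠ 0) {i : ℤ} {c : Q.Dual} (hc : c ∈ Q.dualDegree i) :
    Q.scaleDual ha c = a ^ i • c := by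
  refine Q.dual_ext fun n => ?_
  rw [comp_scaleDual, map_smul]
  exact Q.scaleAlg_of_mem ha ((Submodule.mem_iInf _).1 hc n)

theorem incl_mem_dualDegree {n : ℕ} {i : ℤ} {c : Q.dualWeight n}
    (hc : (c : TensorAlgebra K Q.Gen) ∈ tensorDegree K (homDegree Q.E) 1 i) :
    Q.incl n c ∈ Q.dualDegree i := by
  refine (Submodule.mem_iInf _).2 fun m => ?_
  rw [Submodule.mem_comap]
  by_cases h : n = m
  · subst h
    rwa [comp_incl_self]
  · rw [Q.comp_incl_of_ne h]
    exact Submodule.zero_mem _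

/-- The weight components are intersections inside the tensor algebra and could a priori fail to be
graded. They are stable under rescaling by `2`, since `R` is homogeneous, hence contain the
homogeneous components of their elements. -/
theorem iSup_dualDegree [CharZero K] : ⨆ i, Q.dualDegree i = ⊤ := by
  have h : ∀ n, LinearMap.range (Q.incl n) ≤ ⨆ i, Q.dualDegree i := by
    rintro n _ ⟨⟨c, hc⟩, rfl⟩
    have hc' : c ∈ ⨆ i, tensorDegree K (homDegree Q.E) 1 i := by
      rw [iSup_tensorDegree (iSup_homDegree Q.E)]
      trivial
    obtain ⟨m, hm, rfl⟩ := (Submodule.mem_iSup_iff_exists_finsupp _ _).1 hc'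
    have h2 : (2 : K) ≠ 0 := two_ne_zero
    have hm' : ∀ i ∈ m.support, m i ∈ Q.dualWeight n :=
      mem_of_sum_mem (θ := (Q.scaleAlg 2).toLinearMap) (Q.scaleAlg_mem h2 n)
        (χ := fun i : ℤ => (2 : K) ^ i) (fun i j hij => zpow_two_injective hij) m.support (fun i => m i)
        (fun i => Q.scaleAlg_of_mem h2 (hm i)) hc
    have h3 : (⟨m.sum fun _ x => x, hc⟩ : Q.dualWeight n) =
        ∑ i ∈ m.support.attach, ⟨m i.1, hm' i.1 i.2⟩ := by
      apply Subtype.ext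
      rw [AddSubmonoidClass.coe_finsetSum]
      exact (Finset.sum_attach m.support fun i => m i).symm
    rw [h3, map_sum]
    exact Submodule.sum_mem _ fun i _ => Submodule.mem_iSup_of_mem i.1 (Q.incl_mem_dualDegree (hm i.1))
  rw [eq_top_iff]
  intro c _
  have hid : (⨆ i, Q.dualDegree i).mkQ = 0 := Q.dual_hom_ext fun n c =>
    (Submodule.Quotient.mk_eq_zero _).2 (h n ⟨c, rfl⟩)
  exact (Submodule.Quotient.mk_eq_zero _).1 (LinearMap.congr_fun hid c)

theorem dual_hom_ext_degree [CharZero K] {M : Type*} [AddCommGroup M] [Module K M]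
    {f g : Q.Dual →ₗ[K] M} (h : ∀ i, ∀ c ∈ Q.dualDegree i, f c = g c) : f = g := by
  have h1 : ⨆ i, Q.dualDegree i ≤ LinearMap.eqLocus f g := iSup_le fun i c hc => h i c hc
  rw [iSup_dualDegree] at h1
  exact LinearMap.ext fun c => h1 trivial

theorem scaleDual_unitI {a : K} (ha : a ≠ 0) : Q.scaleDual ha Q.unitI = Q.unitI := by
  rw [unitI, scaleDual_incl]
  congr 1
  exact Subtype.ext (map_one (Q.scaleAlg a))

theorem counit_scaleDual {a : K} (ha : a ≠ 0) (c : Q.Dual) :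
    CoalgebraStruct.counit (R := K) (Q.scaleDual ha c) = CoalgebraStruct.counit (R := K) c := by
  refine LinearMap.congr_fun (f := CoalgebraStruct.counit ∘ₗ Q.scaleDual ha)
    (Q.dual_hom_ext fun m c => ?_) c
  rcases m with _ | m
  · rw [LinearMap.comp_apply, incl_zero_eq, map_smul, map_smul, scaleDual_unitI, map_smul]
  · rw [LinearMap.comp_apply, scaleDual_incl, counit_incl_succ, counit_incl_succ]

theorem deconc_scaleWeight {a : K} (ha : a ≠ 0) {p q n : ℕ} (h : p + q = n) (c : Q.dualWeight n) :
    Q.deconc h (Q.scaleWeight ha n c) =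
      TensorProduct.map (Q.scaleWeight ha p) (Q.scaleWeight ha q) (Q.deconc h c) := by
  apply Q.mulMap_dualWeight_injective p q
  have h1 : ∀ z : Q.dualWeight p ⊗[K] Q.dualWeight q,
      Submodule.mulMap _ _ (TensorProduct.map (Q.scaleWeight ha p) (Q.scaleWeight ha q) z) =
        Q.scaleAlg a (Submodule.mulMap _ _ z) := by
    intro z
    induction z with
    | zero => simp
    | tmul b c => exact (map_mul (Q.scaleAlg a) b.1 c.1).symm
    | add b c hb hc => simp only [map_add, hb, hc]
  rw [h1, mulMap_deconc, mulMap_deconc]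
  rfl

/-- Rescaling is multiplicative on words, hence compatible with their deconcatenation.
Precomposition with it is therefore multiplicative for convolution, which is how degrees and
parities pass to products. -/
theorem comul_scaleDual {a : K} (ha : a ≠ 0) (c : Q.Dual) :
    CoalgebraStruct.comul (R := K) (Q.scaleDual ha c) =
      TensorProduct.map (Q.scaleDual ha) (Q.scaleDual ha) (CoalgebraStruct.comul (R := K) c) := by
  refine LinearMap.congr_fun (f := CoalgebraStruct.comul ∘ₗ Q.scaleDual ha)
    (g := TensorProduct.map (Q.scaleDual ha) (Q.scaleDual ha) ∘ₗ CoalgebraStruct.comul)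
    (Q.dual_hom_ext fun n c => ?_) c
  rw [LinearMap.comp_apply, LinearMap.comp_apply, scaleDual_incl, comul_incl, comul_incl, map_sum]
  refine Finset.sum_congr rfl fun p _ => ?_
  rw [deconc_scaleWeight]
  generalize Q.deconc (Finset.HasAntidiagonal.mem_antidiagonal.1 p.2) c = z
  induction z with
  | zero => simp
  | tmul b c => simp [scaleDual_incl]
  | add b c hb hc => simp only [map_add, hb, hc]

end QuadraticData

end Scaling

/-! ### Homogeneous maps in the convolution algebra -/

noncomputable section ConvolutionDegrees

variable {K : Type u} [Field K] {Q : QuadraticData.{u, v} K} {V : ChainComplex (ModuleCat.{w} K) ℤ}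

section EndDegrees

theorem mem_endDegree {k : ℤ} {φ : Module.End K (Total V)} :
    φ ∈ endDegree V k ↔ ∀ j, ∀ x ∈ homDegree V.X j, φ x ∈ homDegree V.X (j + k) := by
  simp only [endDegree, Submodule.mem_iInf, Submodule.mem_comap, Subtype.forall]
  rfl

theorem mul_mem_endDegree {k l : ℤ} {φ ψ : Module.End K (Total V)} (hφ : φ ∈ endDegree V k)
    (hψ : ψ ∈ endDegree V l) : φ * ψ ∈ endDegree V (k + l) := by
  rw [mem_endDegree] at *
  intro j x hx
  have h := hφ _ _ (hψ j x hx)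
  rwa [add_assoc, add_comm l k] at h

theorem one_mem_endDegree : (1 : Module.End K (Total V)) ∈ endDegree V 0 := by
  rw [mem_endDegree]
  intro j x hx
  rwa [add_zero]

theorem scaleOp_mul_of_mem_endDegree {a : K} (ha : a ≠ 0) {k : ℤ} {φ : Module.End K (Total V)}
    (hφ : φ ∈ endDegree V k) :
    (scaleOp a V.X 0 : Module.End K (Total V)) * φ = a ^ k • (φ * scaleOp a V.X 0) := by
  refine graded_hom_ext (E := V.X) fun j x hx => ?_
  rw [Module.End.mul_apply, scaleOp_of_mem a 0 (mem_endDegree.1 hφ j x hx), LinearMap.smul_apply,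
    Module.End.mul_apply, scaleOp_of_mem a 0 hx, map_smul, smul_smul, ← zpow_add₀ ha]
  congr 2
  omega

theorem mem_endDegree_of_scaleOp_mul [CharZero K] {k : ℤ} {φ : Module.End K (Total V)}
    (hφ : (scaleOp 2 V.X 0 : Module.End K (Total V)) * φ = (2 : K) ^ k • (φ * scaleOp 2 V.X 0)) :
    φ ∈ endDegree V k := by
  rw [mem_endDegree]
  intro j x hx
  apply mem_homDegree_of_scaleOp
  have h := LinearMap.congr_fun hφ x
  rw [Module.End.mul_apply, LinearMap.smul_apply, Module.End.mul_apply, scaleOp_of_mem 2 0 hx,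
    map_smul, smul_smul, ← zpow_add₀ two_ne_zero] at h
  rw [h]
  congr 2
  omega

variable (V) in
theorem signOp_mul_signOp : (signOp V.X 0 : Module.End K (Total V)) * signOp V.X 0 = 1 := by
  refine graded_hom_ext (E := V.X) ?_
  rintro j _ ⟨x, rfl⟩
  rw [Module.End.mul_apply, QuadraticData.signOp_lof, map_smul, QuadraticData.signOp_lof, smul_smul,
    Module.End.one_apply,
    ← mul_zpow, neg_mul_neg, one_mul, one_zpow, one_smul]

variable (V) in
theorem totalDiff_mul_totalDiff : totalDiff V * totalDiff V = 0 := by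
  refine DirectSum.linearMap_ext K fun i => LinearMap.ext fun x => ?_
  simp only [LinearMap.comp_apply, Module.End.mul_apply, totalDiff, DirectSum.toModule_lof,
    LinearMap.zero_apply]
  have h : (V.d (i - 1) (i - 1 - 1)).hom ((V.d i (i - 1)).hom x) = 0 := by
    rw [← LinearMap.comp_apply, ← ModuleCat.hom_comp, V.d_comp_d]
    rfl
  rw [h, map_zero]

variable (V) in
theorem totalDiff_mem_endDegree : totalDiff V ∈ endDegree V (-1) := by
  rw [mem_endDegree]
  rintro j _ ⟨x, rfl⟩
  rw [totalDiff, DirectSum.toModule_lof]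
  exact ⟨_, rfl⟩

theorem endDiff_apply (φ : Module.End K (Total V)) :
    endDiff V φ = totalDiff V * φ -
      signOp V.X 0 * (φ * signOp V.X 0) * totalDiff V := rfl

end EndDegrees

theorem bchTerm_induction {L : Type*} [AddCommGroup L] [Module K L] {br : L → L → L} (p : L → Prop)
    (zero : p 0) (add : ∀ a b, p a → p b → p (a + b)) (smul : ∀ (r : K) a, p a → p (r • a))
    (bracket : ∀ a b, p a → p b → p (br a b)) {x y : L} (hx : p x) (hy : p y) (N : ℕ) :
    p (bchTerm K br x y N) := by
  let S : Submodule K L :=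
    { carrier := {a | p a}, zero_mem' := zero, add_mem' := add _ _, smul_mem' := smul }
  refine KoszulDeligne.bchTerm_mem S fun n m _ => ?_
  refine nestedBracket_mem (br := br) S (fun a ha b hb => bracket a b ha hb) _ fun a ha => ?_
  rcases mem_dynkinWord ha with rfl | rfl <;> assumption

/-- The map `I ↦ φ`, extended by `0` in positive weight. -/
def convConst (Q : QuadraticData.{u, v} K) (φ : Module.End K (Total V)) : Conv Q V :=
  WithConv.toConv (LinearMap.toSpanSingleton K _ φ ∘ₗ CoalgebraStruct.counit)

variable (Q V) in
theorem delta_eq : delta Q V = convConst Q (totalDiff V) := rfl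

/-- Counitality: a map supported on `I` multiplies pointwise. Operators of `V`, such as `∂_V` and
the sign, thus become elements of the convolution algebra. -/
theorem convConst_mul_apply (φ : Module.End K (Total V)) (f : Conv Q V) (c : Q.Dual) :
    (convConst Q φ * f).ofConv c = φ * f.ofConv c := by
  rw [conv_mul_apply, convConst, WithConv.ofConv_toConv, ← LinearMap.map_comp_rTensor,
    LinearMap.comp_apply, Coalgebra.rTensor_counit_comul]
  simp

theorem mul_convConst_apply (φ : Module.End K (Total V)) (f : Conv Q V) (c : Q.Dual) :
    (f * convConst Q φ).ofConv c = f.ofConv c * φ := by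
  rw [conv_mul_apply, convConst, WithConv.ofConv_toConv, ← LinearMap.map_comp_lTensor,
    LinearMap.comp_apply, Coalgebra.lTensor_counit_comul]
  simp

theorem convConst_apply (φ : Module.End K (Total V)) (c : Q.Dual) :
    (convConst Q φ).ofConv c = CoalgebraStruct.counit (R := K) c • φ := rfl

theorem convConst_mul (φ ψ : Module.End K (Total V)) :
    convConst Q φ * convConst Q ψ = convConst Q (φ * ψ) := by
  refine WithConv.ext (LinearMap.ext fun c => ?_)
  rw [convConst_mul_apply, convConst_apply, convConst_apply, mul_smul_comm]

theorem conv_one_apply (c : Q.Dual) :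
    (1 : Conv Q V).ofConv c = CoalgebraStruct.counit (R := K) c • 1 := rfl

variable (Q V) in
theorem convConst_one : convConst Q (1 : Module.End K (Total V)) = 1 := rfl

/-- The map `f ↦ (c ↦ f (a ^ |c| c))`. -/
def scaleConv {a : K} (ha : a ≠ 0) (f : Conv Q V) : Conv Q V :=
  WithConv.toConv (f.ofConv ∘ₗ Q.scaleDual ha)

theorem scaleConv_apply {a : K} (ha : a ≠ 0) (f : Conv Q V) (c : Q.Dual) :
    (scaleConv ha f).ofConv c = f.ofConv (Q.scaleDual ha c) := rfl

theorem scaleConv_mul {a : K} (ha : a ≠ 0) (f g : Conv Q V) :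
    scaleConv ha (f * g) = scaleConv ha f * scaleConv ha g := by
  refine WithConv.ext (LinearMap.ext fun c => ?_)
  rw [scaleConv_apply, conv_mul_apply, conv_mul_apply, Q.comul_scaleDual,
    show (scaleConv ha f).ofConv = f.ofConv ∘ₗ Q.scaleDual ha from rfl,
    show (scaleConv ha g).ofConv = g.ofConv ∘ₗ Q.scaleDual ha from rfl, TensorProduct.map_comp]
  rfl

theorem scaleConv_convConst {a : K} (ha : a ≠ 0) (φ : Module.End K (Total V)) :
    scaleConv ha (convConst Q φ) = convConst Q φ := by
  refine WithConv.ext (LinearMap.ext fun c => ?_)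
  rw [scaleConv_apply, convConst_apply, convConst_apply, Q.counit_scaleDual]

theorem scale_mul_aux {A : Type*} [Ring A] [Algebra K A] {T f g f' g' : A} {r s : K}
    (hf : T * f = r • (f' * T)) (hg : T * g = s • (g' * T)) :
    T * (f * g) = (r * s) • (f' * g' * T) := by
  rw [← mul_assoc, hf, smul_mul_assoc, mul_assoc, hg, mul_smul_comm, smul_smul, mul_assoc]

theorem hasDegree_zero {p : ℤ} : HasDegree (0 : Conv Q V) p := fun _ _ _ => Submodule.zero_mem _

theorem HasDegree.add {f g : Conv Q V} {p : ℤ} (hf : HasDegree f p) (hg : HasDegree g p) :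
    HasDegree (f + g) p := fun i c hc => Submodule.add_mem _ (hf i c hc) (hg i c hc)

theorem HasDegree.sub {f g : Conv Q V} {p : ℤ} (hf : HasDegree f p) (hg : HasDegree g p) :
    HasDegree (f - g) p := fun i c hc => Submodule.sub_mem _ (hf i c hc) (hg i c hc)

theorem HasDegree.neg {f : Conv Q V} {p : ℤ} (hf : HasDegree f p) :
    HasDegree (-f) p := fun i c hc => Submodule.neg_mem _ (hf i c hc)

theorem HasDegree.smul {f : Conv Q V} {p : ℤ} (hf : HasDegree f p) (r : K) :
    HasDegree (r • f) p := fun i c hc => Submodule.smul_mem _ r (hf i c hc)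

theorem conv_bchTerm_induction {x y : Conv Q V} (p : Conv Q V → Prop) (zero : p 0)
    (add : ∀ f g, p f → p g → p (f + g)) (smul : ∀ (r : K) f, p f → p (r • f))
    (bracket : ∀ f g, p f → p g → p (gradedBracket 0 0 f g)) (hx : p x) (hy : p y) (N : ℕ) :
    p (bchTerm K (gradedBracket 0 0) x y N) :=
  bchTerm_induction (L := Conv Q V) p zero add smul bracket hx hy N

variable [CharZero K]

/-- Homogeneity becomes an equation in the convolution algebra. Taking `a = 2` characterises the
degree, and `a = -1` produces the Koszul signs. -/
theorem HasDegree.scale {f : Conv Q V} {p : ℤ} (hf : HasDegree f p) {a : K} (ha : a ≠ 0) :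
    convConst Q (scaleOp a V.X 0) * f = a ^ p • (scaleConv ha f * convConst Q (scaleOp a V.X 0)) := by
  refine WithConv.ext (Q.dual_hom_ext_degree fun i c hc => ?_)
  rw [convConst_mul_apply, WithConv.ofConv_smul, LinearMap.smul_apply, mul_convConst_apply,
    scaleConv_apply, Q.scaleDual_of_mem ha hc, map_smul,
    scaleOp_mul_of_mem_endDegree ha (hf i c hc), smul_mul_assoc, smul_smul, ← zpow_add₀ ha,
    add_comm]

theorem hasDegree_of_scale {f : Conv Q V} {p : ℤ}
    (hf : convConst Q (scaleOp 2 V.X 0) * f =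
      (2 : K) ^ p • (scaleConv two_ne_zero f * convConst Q (scaleOp 2 V.X 0))) : HasDegree f p := by
  intro i c hc
  apply mem_endDegree_of_scaleOp_mul
  have h := LinearMap.congr_fun (congrArg WithConv.ofConv hf) c
  rw [convConst_mul_apply, WithConv.ofConv_smul, LinearMap.smul_apply, mul_convConst_apply,
    scaleConv_apply, Q.scaleDual_of_mem two_ne_zero hc, map_smul, smul_mul_assoc, smul_smul,
    ← zpow_add₀ two_ne_zero, add_comm] at h
  exact h

/-- The scaling element is moved through `f` and then through `g`, which avoids decomposing the
coproduct into homogeneous parts. -/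
theorem HasDegree.mul {f g : Conv Q V} {p q : ℤ} (hf : HasDegree f p) (hg : HasDegree g q) :
    HasDegree (f * g) (p + q) := by
  apply hasDegree_of_scale
  rw [scaleConv_mul, zpow_add₀ two_ne_zero]
  exact scale_mul_aux (A := Conv Q V) (hf.scale two_ne_zero) (hg.scale two_ne_zero)

theorem hasDegree_convConst {φ : Module.End K (Total V)} {p : ℤ} (hφ : φ ∈ endDegree V p) :
    HasDegree (convConst Q φ) p := by
  apply hasDegree_of_scale
  rw [scaleConv_convConst, convConst_mul, convConst_mul,
    scaleOp_mul_of_mem_endDegree two_ne_zero hφ]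
  refine WithConv.ext (LinearMap.ext fun c => ?_)
  rw [convConst_apply, WithConv.ofConv_smul, LinearMap.smul_apply, convConst_apply, smul_comm]

variable (Q V) in
theorem hasDegree_one : HasDegree (1 : Conv Q V) 0 :=
  hasDegree_convConst one_mem_endDegree

variable (Q V) in
theorem hasDegree_delta : HasDegree (delta Q V) (-1) :=
  hasDegree_convConst (totalDiff_mem_endDegree V)

theorem HasDegree.pow {f : Conv Q V} (hf : HasDegree f 0) (n : ℕ) : HasDegree (f ^ n) 0 := by
  induction n with
  | zero =>
    rw [pow_zero]
    exact hasDegree_one Q V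
  | succ n ih =>
    rw [pow_succ]
    have h := ih.mul hf
    rwa [add_zero] at h

/-- Rescaling preserves weight, so the scaling equation can be checked on the finite sum in each
weight. -/
theorem hasDegree_weightSum {F : ℕ → Conv Q V} {p : ℤ} (hF : ∀ k, HasDegree (F k) p) :
    HasDegree (weightSum F) p := by
  apply hasDegree_of_scale
  apply conv_ext
  intro n c
  rw [convConst_mul_apply, WithConv.ofConv_smul, LinearMap.smul_apply, mul_convConst_apply,
    scaleConv_apply, Q.scaleDual_incl, weightSum_incl, weightSum_incl, Finset.mul_sum,
    Finset.sum_mul, Finset.smul_sum]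
  refine Finset.sum_congr rfl fun k _ => ?_
  have h := LinearMap.congr_fun (congrArg WithConv.ofConv ((hF k).scale two_ne_zero)) (Q.incl n c)
  rwa [convConst_mul_apply, WithConv.ofConv_smul, LinearMap.smul_apply, mul_convConst_apply,
    scaleConv_apply, Q.scaleDual_incl] at h

theorem hasDegree_convExp {l : Conv Q V} (hl : HasDegree l 0) : HasDegree (convExp l) 0 :=
  hasDegree_weightSum fun k => (hl.pow k).smul _

theorem hasDegree_convLog {f : Conv Q V} (hf : HasDegree f 0) : HasDegree (convLog f) 0 :=
  hasDegree_weightSum fun k => ((hf.sub (hasDegree_one Q V)).pow k).smul _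

theorem HasDegree.bracket {f g : Conv Q V} (hf : HasDegree f 0) (hg : HasDegree g 0) :
    HasDegree (gradedBracket 0 0 f g) 0 := by
  have h := (hf.mul hg).sub (hg.mul hf)
  rw [add_zero] at h
  rwa [gradedBracket_zero_zero]

theorem hasDegree_bchTerm {x y : Conv Q V} (hx : HasDegree x 0) (hy : HasDegree y 0) :
    ∀ N, HasDegree (bchTerm K (gradedBracket 0 0) x y N) 0 :=
  conv_bchTerm_induction (fun f => HasDegree f 0) hasDegree_zero (fun _ _ hf hg => hf.add hg)
    (fun r _ hf => hf.smul r) (fun _ _ hf hg => hf.bracket hg) hx hy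

theorem hasDegree_convBCH {x y : Conv Q V} (hx : HasDegree x 0) (hy : HasDegree y 0) :
    HasDegree (convBCH x y) 0 :=
  hasDegree_weightSum (hasDegree_bchTerm hx hy)

end ConvolutionDegrees

/-! ### Absorbing Koszul signs into an involution -/

section TwistedSquares

variable {A : Type*} [Ring A] {s d a S : A}

theorem eq_of_mul_self_eq_one (hs : s * s = 1) {x y : A} (h : s * x = s * y) : x = y := by
  rw [← one_mul x, ← one_mul y, ← hs, mul_assoc, h, mul_assoc]

theorem twisted_injective (hs : s * s = 1) {x y : A} (h : s * (d + x) = s * (d + y)) : x = y :=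
  add_left_cancel (eq_of_mul_self_eq_one hs h)

/-- Here `s` is the sign, `d` is `δ` and `S` is the parity twist of `a`. Conjugation by `s` produces
the signs of the differential and of the product; the `d²` term vanishes. -/
theorem twisted_square (hs : s * s = 1) (hsd : s * d = -(d * s)) (hdd : d * d = 0)
    (hS : s * a = -(S * s)) :
    s * (d + a) * (s * (d + a)) = -(d * a - s * (a * s) * d + S * a) := by
  have h1 : s * d * s = -d := by rw [hsd, neg_mul, mul_assoc, hs, mul_one]
  have h2 : s * a * s = -S := by rw [hS, neg_mul, mul_assoc, hs, mul_one]
  calc s * (d + a) * (s * (d + a))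
      = s * d * s * d + s * d * s * a + s * a * s * d + s * a * s * a := by noncomm_ring
    _ = -(d * a - s * (a * s) * d + S * a) := by
      rw [← mul_assoc s a s, h1, h2, neg_mul, hdd]
      noncomm_ring

theorem twisted_intertwine_iff (hs : s * s = 1) {f g x y : A} (hS : s * f = S * s) :
    S * x = y * g ↔ f * (s * x) = s * y * g := by
  have h : s * S = f * s := by
    rw [← mul_one (s * S), ← hs, ← mul_assoc, mul_assoc s S s, ← hS, ← mul_assoc s s f, hs,
      one_mul]
  rw [← mul_assoc f, ← h, mul_assoc, mul_assoc]
  exact ⟨fun e => by rw [e], fun e => eq_of_mul_self_eq_one hs e⟩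

/-- After multiplication by `s`, the graded bracket of a degree `0` element with an odd one becomes
an ordinary commutator. -/
theorem twisted_bracket (hs : s * s = 1) {f g : A} (hS : s * f = S * s) :
    s * (S * g - g * f) = f * (s * g) - s * g * f := by
  have h : s * S = f * s := by
    rw [← mul_one (s * S), ← hs, ← mul_assoc, mul_assoc s S s, ← hS, ← mul_assoc s s f, hs,
      one_mul]
  rw [mul_sub, ← mul_assoc, h, mul_assoc, mul_assoc]

end TwistedSquares

/-! ### Maurer-Cartan elements as square-zero elements, gauge action as conjugation -/

noncomputable section MaurerCartanElements

variable {K : Type u} [Field K] {Q : QuadraticData.{u, v} K} {V : ChainComplex (ModuleCat.{w} K) ℤ}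

variable (Q V) in
/-- The map `I ↦ (x ↦ (-1)^{|x|} x)`. -/
def convSign : Conv Q V := convConst Q (signOp V.X 0)

variable (Q V) in
theorem convSign_mul_convSign : convSign Q V * convSign Q V = 1 := by
  rw [convSign, convConst_mul, signOp_mul_signOp, convConst_one]

/-- The map `f ↦ (c ↦ (-1)^{|c|} f c)`. -/
def convParity (f : Conv Q V) : Conv Q V := scaleConv (neg_ne_zero.2 one_ne_zero) f

/-- When the right factor is odd, the sign is `(-1)^{|c'|}`, which is the parity twist of the left
factor. -/
theorem convStar_neg_one (f g : Conv Q V) : convStar (-1) f g = convParity f * g := by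
  rw [convStar, convParity, scaleConv, QuadraticData.sign_eq_scaleDual]
  rfl

theorem convStar_zero (f g : Conv Q V) : convStar 0 f g = f * g := by
  simp [convStar, Module.End.one_eq_id]

theorem HasDegree.convParity_apply {f : Conv Q V} {p : ℤ} (hf : HasDegree f p) :
    HasDegree (convParity f) p := by
  intro i c hc
  rw [convParity, scaleConv_apply, Q.scaleDual_of_mem _ hc, map_smul]
  exact Submodule.smul_mem _ _ (hf i c hc)

/-- The operator `(-1)^{|x|} (δ + a)`. -/
def twistedDiff (a : Conv Q V) : Conv Q V := convSign Q V * (delta Q V + a)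

theorem twistedDiff_injective {a b : Conv Q V} (h : twistedDiff a = twistedDiff b) : a = b := by
  exact twisted_injective (A := Conv Q V) (convSign_mul_convSign Q V) h

variable (Q V) in
theorem delta_mul_delta : delta Q V * delta Q V = 0 := by
  rw [delta_eq, convConst_mul, totalDiff_mul_totalDiff]
  refine WithConv.ext (LinearMap.ext fun c => ?_)
  rw [convConst_apply, smul_zero]
  rfl

theorem convDiff_eq (a : Conv Q V) :
    convDiff a = delta Q V * a - convSign Q V * (a * convSign Q V) * delta Q V := by
  refine WithConv.ext (LinearMap.ext fun c => ?_)
  rw [WithConv.ofConv_sub, LinearMap.sub_apply, delta_eq, convConst_mul_apply, mul_convConst_apply,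
    convSign, convConst_mul_apply, mul_convConst_apply]
  rfl

theorem gradedBracket_zero_neg_one (l g : Conv Q V) :
    gradedBracket 0 (-1) l g = convParity l * g - g * l := by
  rw [gradedBracket, convStar_neg_one, convStar_zero, zero_mul, zpow_zero]
  congr 1
  refine WithConv.ext (LinearMap.ext fun c => ?_)
  rw [WithConv.ofConv_smul, LinearMap.smul_apply, one_smul]

/-- On weight `0` the series is cut after its `k = 0` term, `δ + a`; subtracting `δ` leaves `a`,
which vanishes on `I`. -/
theorem gaugeAct_unitI {l a : Conv Q V} (ha : a.ofConv Q.unitI = 0) :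
    (gaugeAct l a).ofConv Q.unitI = 0 := by
  rw [gaugeAct, WithConv.ofConv_sub, LinearMap.sub_apply, QuadraticData.unitI, weightSum_incl]
  simp only [zero_add, Finset.range_one, Finset.sum_singleton, Nat.factorial_zero, Nat.cast_one,
    inv_one, Function.iterate_zero, id_eq, one_smul]
  rw [QuadraticData.unitI] at ha
  rw [WithConv.ofConv_add, LinearMap.add_apply, ha, add_zero, sub_self]

theorem convSign_mul_weightSum (F : ℕ → Conv Q V) :
    convSign Q V * weightSum F = weightSum fun k => convSign Q V * F k := by
  apply conv_ext
  intro n c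
  rw [convSign, convConst_mul_apply, weightSum_incl, weightSum_incl, Finset.mul_sum]
  exact Finset.sum_congr rfl fun k _ => (convConst_mul_apply _ _ _).symm

theorem convSign_mul_smul (r : K) (f : Conv Q V) :
    convSign Q V * (r • f) = r • (convSign Q V * f) := by
  exact mul_smul_comm r _ _

variable [CharZero K]

theorem HasDegree.convSign_mul_of_neg_one {f : Conv Q V} (hf : HasDegree f (-1)) :
    convSign Q V * f = -(convParity f * convSign Q V) := by
  have h := hf.scale (neg_ne_zero.2 one_ne_zero)
  rw [zpow_neg_one, inv_neg, inv_one] at h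
  refine h.trans ?_
  refine WithConv.ext (LinearMap.ext fun c => ?_)
  rw [WithConv.ofConv_smul, WithConv.ofConv_neg, LinearMap.smul_apply, neg_one_smul]
  rfl

theorem HasDegree.convSign_mul {f : Conv Q V} (hf : HasDegree f 0) :
    convSign Q V * f = convParity f * convSign Q V := by
  have h := hf.scale (neg_ne_zero.2 one_ne_zero)
  rw [zpow_zero] at h
  refine h.trans ?_
  refine WithConv.ext (LinearMap.ext fun c => ?_)
  rw [WithConv.ofConv_smul, LinearMap.smul_apply, one_smul]
  rfl

theorem intertwine_iff {f a b : Conv Q V} (hf : HasDegree f 0) :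
    convStar (-1) f (delta Q V + a) = convStar 0 (delta Q V + b) f ↔
      f * twistedDiff a = twistedDiff b * f := by
  rw [convStar_neg_one, convStar_zero]
  exact twisted_intertwine_iff (A := Conv Q V) (convSign_mul_convSign Q V) hf.convSign_mul

/-- Both degrees being odd, the commutator sign is `+`, so the bracket is twice the signed square.
-/
theorem half_gradedBracket_self (a : Conv Q V) :
    (2 : K)⁻¹ • gradedBracket (-1) (-1) a a = convParity a * a := by
  rw [gradedBracket, convStar_neg_one]
  refine WithConv.ext (LinearMap.ext fun c => ?_)
  rw [WithConv.ofConv_smul, WithConv.ofConv_sub, WithConv.ofConv_smul, LinearMap.smul_apply,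
    LinearMap.sub_apply, LinearMap.smul_apply]
  generalize (convParity a * a).ofConv c = x
  norm_num [← two_smul K x, smul_smul]

variable (Q V) in
theorem convSign_mul_delta : convSign Q V * delta Q V = -(delta Q V * convSign Q V) := by
  rw [(hasDegree_delta Q V).convSign_mul_of_neg_one]
  rw [delta_eq, convParity, scaleConv_convConst]

/-- The equation says that `δ + a` has square zero for `⋆`; `∂_V² = 0` removes the curvature of `δ`,
and multiplying by the sign removes the signs up to a global `-1`. -/
theorem maurerCartan_iff {a : Conv Q V} (ha : HasDegree a (-1)) :
    convDiff a + (2 : K)⁻¹ • gradedBracket (-1) (-1) a a = 0 ↔ twistedDiff a * twistedDiff a = 0 := by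
  have h := twisted_square (A := Conv Q V) (convSign_mul_convSign Q V) (convSign_mul_delta Q V)
    (delta_mul_delta Q V) ha.convSign_mul_of_neg_one
  rw [half_gradedBracket_self, convDiff_eq]
  refine Iff.trans ?_ (iff_of_eq (congrArg (· = 0) h.symm))
  exact (neg_eq_zero (α := Conv Q V)).symm

theorem HasDegree.gradedBracket_apply {l g : Conv Q V} (hl : HasDegree l 0) (hg : HasDegree g (-1)) :
    HasDegree (gradedBracket 0 (-1) l g) (-1) := by
  have h1 := hl.convParity_apply.mul hg
  have h2 := hg.mul hl
  rw [zero_add] at h1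
  rw [add_zero] at h2
  rw [gradedBracket_zero_neg_one]
  exact h1.sub h2

theorem HasDegree.iterate_gradedBracket {l g : Conv Q V} (hl : HasDegree l 0)
    (hg : HasDegree g (-1)) (k : ℕ) :
    HasDegree ((gradedBracket 0 (-1) l)^[k] g) (-1) := by
  induction k with
  | zero => exact hg
  | succ k ih =>
    rw [Function.iterate_succ_apply']
    exact hl.gradedBracket_apply ih

theorem HasDegree.gaugeAct_apply {l a : Conv Q V} (hl : HasDegree l 0) (ha : HasDegree a (-1)) :
    HasDegree (gaugeAct l a) (-1) :=
  (hasDegree_weightSum fun k => (hl.iterate_gradedBracket ((hasDegree_delta Q V).add ha) k).smul _).sub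
    (hasDegree_delta Q V)

theorem convSign_mul_iterate {l : Conv Q V} (hl : HasDegree l 0) (g : Conv Q V) (k : ℕ) :
    convSign Q V * (gradedBracket 0 (-1) l)^[k] g = (adLin K l ^ k) (convSign Q V * g) := by
  induction k with
  | zero => rfl
  | succ k ih =>
    rw [Function.iterate_succ_apply', gradedBracket_zero_neg_one, pow_succ', Module.End.mul_apply,
      ← ih]
    exact twisted_bracket (A := Conv Q V) (convSign_mul_convSign Q V) hl.convSign_mul

/-- The sign turns the iterated graded brackets into powers of `ad_l`, and the series `e^{ad_l}` is
conjugation by `e^l`. -/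
theorem twistedDiff_gaugeAct {l : Conv Q V} (hl : HasDegree l 0) (hl' : l ∈ (convFiltration Q V).piece 1)
    (a : Conv Q V) :
    twistedDiff (gaugeAct l a) = convExp l * twistedDiff a * convExp (-l) := by
  rw [← weightSum_adLin hl', twistedDiff, gaugeAct]
  rw [show ∀ x y : Conv Q V, x + (y - x) = y from fun x y => add_sub_cancel x y,
    convSign_mul_weightSum]
  congr 1
  funext k
  rw [convSign_mul_smul, convSign_mul_iterate hl, twistedDiff]

end MaurerCartanElements

/-! ### Derivations twisted by the sign -/

section TwistedDerivations

variable {A : Type*} [Ring A] {s d x y : A}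

theorem twisted_derivation (hs : s * s = 1) :
    d * (x * y) - s * (x * y * s) * d =
      (d * x - s * (x * s) * d) * y + s * (x * s) * (d * y - s * (y * s) * d) := by
  have h : s * (x * s) * (s * (y * s) * d) = s * (x * y * s) * d := by
    calc _ = s * x * (s * s) * (y * s) * d := by noncomm_ring
      _ = _ := by rw [hs]; noncomm_ring
  rw [sub_mul, mul_sub, h]
  noncomm_ring

theorem conj_eq_neg (hs : s * s = 1) (h : s * x = -(y * s)) : s * (x * s) = -y := by
  rw [← mul_assoc, h, neg_mul, mul_assoc, hs, mul_one]

end TwistedDerivations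

/-! ### Homotopy modules as Maurer-Cartan elements -/

noncomputable section HomotopyModules

variable {K : Type u} [Field K] {Q : QuadraticData.{u, v} K} {V : ChainComplex (ModuleCat.{w} K) ℤ}

namespace QuadraticData

theorem projBar_coe (c : Q.Dual) :
    (Q.projBar c : Q.Dual) = c - CoalgebraStruct.counit (R := K) c • Q.unitI := rfl

theorem projBar_of_mem (c : Q.DualBar) : Q.projBar c = c := by
  refine Subtype.ext ?_
  rw [projBar_coe, LinearMap.mem_ker.1 c.2, zero_smul, sub_zero]

theorem projBar_unitI : Q.projBar Q.unitI = 0 := by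
  refine Subtype.ext ?_
  rw [projBar_coe, counit_unitI, one_smul, sub_self]
  rfl

theorem desusp_of_mem (c : Q.DualBar) : Q.desusp c = TensorAlgebra.ι K c := by
  rw [desusp, LinearMap.comp_apply, projBar_of_mem]

theorem desusp_unitI : Q.desusp Q.unitI = 0 := by
  rw [desusp, LinearMap.comp_apply, projBar_unitI, map_zero]

theorem unitI_mem_dualDegree : Q.unitI ∈ Q.dualDegree 0 :=
  Q.incl_mem_dualDegree (Submodule.subset_span ⟨[], by simp, rfl, rfl⟩)

/-- The counit is invariant under rescaling, so `2 ^ i ε(c) = ε(c)`: either `ε(c) = 0` and nothing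
is subtracted, or `i = 0`, the degree of `I`. -/
theorem projBar_mem_dualDegree [CharZero K] {i : ℤ} {c : Q.Dual} (hc : c ∈ Q.dualDegree i) :
    (Q.projBar c : Q.Dual) ∈ Q.dualDegree i := by
  rw [projBar_coe]
  refine Submodule.sub_mem _ hc ?_
  have h := Q.counit_scaleDual (two_ne_zero (α := K)) c
  rw [Q.scaleDual_of_mem two_ne_zero hc, map_smul, smul_eq_mul] at h
  rcases eq_or_ne (CoalgebraStruct.counit (R := K) c) 0 with h0 | h0
  · rw [h0, zero_smul]
    exact Submodule.zero_mem _
  · obtain rfl : i = 0 := zpow_two_injective (K := K) (by rw [zpow_zero]; exact mul_eq_right₀ h0 |>.1 h)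
    exact Submodule.smul_mem _ _ Q.unitI_mem_dualDegree

theorem desusp_mem_cobarDegree [CharZero K] {i : ℤ} {c : Q.Dual} (hc : c ∈ Q.dualDegree i) :
    Q.desusp c ∈ Q.cobarDegree (i + -1) :=
  ι_mem_tensorDegree (deg := fun j => (Q.dualDegree j).comap Q.DualBar.subtype) (-1)
    (Q.projBar_mem_dualDegree hc)

theorem cobarDiff_algebraMap (r : K) : Q.cobarDiff (algebraMap K Q.Cobar r) = 0 := by
  have h := Q.cobarDiff_mul 1 1
  rw [map_one Q.cobarParity, one_mul, mul_one, one_mul, left_eq_add] at h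
  rw [Algebra.algebraMap_eq_smul_one, map_smul, h, smul_zero]

end QuadraticData

theorem endDiff_mul (φ ψ : Module.End K (Total V)) :
    endDiff V (φ * ψ) =
      endDiff V φ * ψ + signOp V.X 0 * (φ * signOp V.X 0) * endDiff V ψ := by
  exact twisted_derivation (signOp_mul_signOp V)

theorem endDiff_algebraMap (r : K) : endDiff V (algebraMap K _ r) = 0 := by
  rw [Algebra.algebraMap_eq_smul_one, map_smul, endDiff_apply, one_mul, signOp_mul_signOp, mul_one,
    one_mul, sub_self, smul_zero]

theorem conv_eq_zero_of_bar {f : Conv Q V} (h0 : f.ofConv Q.unitI = 0)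
    (h : ∀ c : Q.DualBar, f.ofConv c = 0) : f = 0 := by
  refine WithConv.ext (LinearMap.ext fun c => ?_)
  have hc := h (Q.projBar c)
  rw [QuadraticData.projBar_coe, map_sub, map_smul, h0, smul_zero, sub_zero] at hc
  exact hc

/-- The full coproduct may stand in for the reduced one, because `desusp` kills `I`. What remains is
the convolution square of the twisting map, with the Koszul sign on the first factor. -/
theorem act_cobarDiffGen (act : Q.Cobar →ₐ[K] Module.End K (Total V)) {a : Conv Q V}
    (ha : a.ofConv = act.toLinearMap ∘ₗ Q.desusp) (c : Q.DualBar) :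
    act (Q.cobarDiffGen c) = -(convParity a * a).ofConv c := by
  rw [conv_mul_apply, convParity, scaleConv, WithConv.ofConv_toConv,
    ← QuadraticData.sign_eq_scaleDual, ha]
  change act (-_) = _
  rw [map_neg]
  congr 1
  simp only [LinearMap.comp_apply, Submodule.subtype_apply]
  generalize CoalgebraStruct.comul (R := K) (c : Q.Dual) = t
  induction t with
  | zero => simp
  | tmul x y => simp
  | add x y hx hy => simp only [map_add, hx, hy]

theorem lift_desusp {a : Conv Q V} (h0 : a.ofConv Q.unitI = 0) :
    a.ofConv = (TensorAlgebra.lift K (a.ofConv ∘ₗ Q.DualBar.subtype)).toLinearMap ∘ₗ Q.desusp := by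
  refine LinearMap.ext fun c => ?_
  rw [LinearMap.comp_apply, QuadraticData.desusp, LinearMap.comp_apply, AlgHom.toLinearMap_apply,
    TensorAlgebra.lift_ι_apply, LinearMap.comp_apply, Submodule.subtype_apply,
    QuadraticData.projBar_coe, map_sub, map_smul, h0, smul_zero, sub_zero]

theorem HomotopyModule.ext_twisting {M N : HomotopyModule Q V} (h : M.twisting = N.twisting) :
    M = N := by
  refine HomotopyModule.ext (TensorAlgebra.hom_ext (LinearMap.ext fun c => ?_))
  have hc := LinearMap.congr_fun (congrArg WithConv.ofConv h) (c : Q.Dual)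
  change M.act (Q.desusp c) = N.act (Q.desusp c) at hc
  rwa [QuadraticData.desusp_of_mem] at hc

variable [CharZero K]

/-- The equation restricted to the coaugmentation coideal is the compatibility of the action with
the differentials on generators. -/
theorem maurerCartan_apply_iff {a : Conv Q V} (h0 : a.ofConv Q.unitI = 0) :
    convDiff a + (2 : K)⁻¹ • gradedBracket (-1) (-1) a a = 0 ↔
      ∀ c : Q.DualBar, endDiff V (a.ofConv c) = -(convParity a * a).ofConv c := by
  rw [half_gradedBracket_self]
  constructor
  · intro h c
    exact eq_neg_of_add_eq_zero_left (LinearMap.congr_fun (congrArg WithConv.ofConv h) (c : Q.Dual))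
  · intro h
    refine conv_eq_zero_of_bar ?_ fun c => ?_
    -- On `I` the equation is automatic: the quadratic term starts in weight `2`, and `a` vanishes
    -- on `I`.
    · have h1 : convParity a ∈ (convFiltration Q V).piece 1 := by
        rw [mem_convFiltration_one, convParity, scaleConv_apply, Q.scaleDual_unitI, h0]
      have h2 : a ∈ (convFiltration Q V).piece 1 := mem_convFiltration_one.2 h0
      have h3 := (convFiltration Q V).anti one_le_two ((convFiltration Q V).mul_mem h1 h2)
      rw [WithConv.ofConv_add, LinearMap.add_apply, mem_convFiltration_one.1 h3, add_zero]
      change endDiff V (a.ofConv Q.unitI) = 0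
      rw [h0, map_zero]
    · rw [WithConv.ofConv_add, LinearMap.add_apply]
      exact add_eq_zero_iff_eq_neg.2 (h c)

theorem signOp_mul_neg_one {a : Conv Q V} (ha : HasDegree a (-1)) (c : Q.Dual) :
    -(a.ofConv (Q.sign c)) = signOp V.X 0 * (a.ofConv c * signOp V.X 0) := by
  have h := LinearMap.congr_fun (congrArg WithConv.ofConv ha.convSign_mul_of_neg_one) c
  rw [WithConv.ofConv_neg, LinearMap.neg_apply, convSign, convConst_mul_apply, mul_convConst_apply] at h
  exact (conj_eq_neg (A := Module.End K (Total V)) (signOp_mul_signOp V) h).symm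

/-- An action of degree `0` carries the parity of the cobar construction to conjugation by the sign
of `V`. This matches the signs in the two Leibniz rules. -/
theorem act_cobarParity (act : Q.Cobar →ₐ[K] Module.End K (Total V)) {a : Conv Q V}
    (ha : a.ofConv = act.toLinearMap ∘ₗ Q.desusp) (hd : HasDegree a (-1)) (x : Q.Cobar) :
    act (Q.cobarParity x) = signOp V.X 0 * (act x * signOp V.X 0) := by
  induction x using TensorAlgebra.induction with
  | algebraMap r =>
    rw [AlgHom.commutes, AlgHom.commutes, Algebra.algebraMap_eq_smul_one, smul_mul_assoc, one_mul,
      mul_smul_comm, signOp_mul_signOp]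
  | ι c =>
    have h := signOp_mul_neg_one hd (c : Q.Dual)
    rw [ha] at h
    rw [← QuadraticData.desusp_of_mem c]
    refine Eq.trans ?_ h
    rw [QuadraticData.desusp_of_mem, QuadraticData.cobarParity, TensorAlgebra.lift_ι_apply]
    exact map_neg act _
  | mul x y hx hy =>
    rw [map_mul, map_mul, map_mul, hx, hy]
    have h := signOp_mul_signOp V
    calc _ = signOp V.X 0 * act x * ((signOp V.X 0 : Module.End K (Total V)) * signOp V.X 0) *
          (act y * signOp V.X 0) := by noncomm_ring
      _ = _ := by rw [h]; noncomm_ring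
  | add x y hx hy => rw [map_add, map_add, map_add, hx, hy, add_mul, mul_add]

/-- The homotopy module structure attached to a Maurer-Cartan element. -/
def MaurerCartan.toHomotopyModule (a : MaurerCartan Q V) : HomotopyModule Q V where
  act := TensorAlgebra.lift K (a.1.ofConv ∘ₗ Q.DualBar.subtype)
  degree i x hx := by
    have h : Q.cobarDegree i ≤ (endDegree V i).comap
        (TensorAlgebra.lift K (a.1.ofConv ∘ₗ Q.DualBar.subtype)).toLinearMap := by
      refine Submodule.span_le.2 ?_
      rintro _ ⟨l, hl, rfl, rfl⟩
      clear hx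
      induction l with
      | nil => simpa using one_mem_endDegree
      | cons p l ih =>
        have h1 := a.2.1 p.1 p.2 (hl p (by simp))
        have h2 := ih fun q hq => hl q (List.mem_cons_of_mem _ hq)
        have h3 := mul_mem_endDegree h1 h2
        simpa using h3
    exact h hx
  -- Both composites are twisted derivations along the action, so equality on generators, which is
  -- the Maurer-Cartan equation, propagates to products.
  diff x := by
    have ha := lift_desusp a.2.2.1
    induction x using TensorAlgebra.induction with
    | algebraMap r =>
      rw [QuadraticData.cobarDiff_algebraMap, map_zero, AlgHom.commutes, endDiff_algebraMap]
    | ι c =>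
      rw [QuadraticData.cobarDiff_ι, act_cobarDiffGen _ ha, TensorAlgebra.lift_ι_apply]
      exact ((maurerCartan_apply_iff a.2.2.1).1 a.2.2.2 c).symm
    | mul x y hx hy =>
      rw [QuadraticData.cobarDiff_mul, map_add, map_mul, map_mul, hx, hy,
        act_cobarParity _ ha a.2.1, map_mul, endDiff_mul]
    | add x y hx hy => rw [map_add, map_add, map_add, map_add, hx, hy]

theorem MaurerCartan.twisting_toHomotopyModule (a : MaurerCartan Q V) :
    a.toHomotopyModule.twisting = a.1 :=
  (congrArg WithConv.toConv (lift_desusp a.2.2.1)).symm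

/-- The Maurer-Cartan element attached to a homotopy module structure. -/
def HomotopyModule.toMaurerCartan (M : HomotopyModule Q V) : MaurerCartan Q V :=
  have h0 : M.twisting.ofConv Q.unitI = 0 := by
    change M.act (Q.desusp Q.unitI) = 0
    rw [QuadraticData.desusp_unitI, map_zero]
  ⟨M.twisting, fun i c hc => M.degree _ _ (Q.desusp_mem_cobarDegree hc), h0,
    (maurerCartan_apply_iff h0).2 fun c => by
      rw [← act_cobarDiffGen (a := M.twisting) M.act rfl, ← QuadraticData.cobarDiff_ι, M.diff,
        ← QuadraticData.desusp_of_mem]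
      rfl⟩

end HomotopyModules

/-! ### Conjugation and intertwining -/

section Intertwiners

variable {A : Type*} [Monoid A] {e e' x y : A}

theorem conj_eq_iff (h : e * e' = 1) (h' : e' * e = 1) : e * x * e' = y ↔ e * x = y * e := by
  constructor
  · rintro rfl
    rw [mul_assoc, h', mul_one]
  · intro he
    rw [he, mul_assoc, h, mul_one]

theorem conj_square_zero {A : Type*} [Ring A] {e e' x : A} (h' : e' * e = 1) (hx : x * x = 0) :
    e * x * e' * (e * x * e') = 0 := by
  calc _ = e * x * (e' * e) * x * e' := by noncomm_ring
    _ = e * (x * x) * e' := by rw [h']; noncomm_ring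
    _ = 0 := by rw [hx, mul_zero, zero_mul]

end Intertwiners

/-! ### The gauge group, the ∞-isotopies and the Deligne groupoid -/

noncomputable section DeligneGroupoid

variable {K : Type u} [Field K] {Q : QuadraticData.{u, v} K} {V : ChainComplex (ModuleCat.{w} K) ℤ}

variable (Q V) in
theorem convExp_zero : convExp (0 : Conv Q V) = 1 := by
  apply conv_ext
  intro n c
  rw [convExp, weightSum_incl, Finset.sum_eq_single 0]
  · simp
  · intro k _ hk
    rw [zero_pow hk, smul_zero]
    rfl
  · simp

theorem Gauge.mem (l : Gauge Q V) : l.1 ∈ (convFiltration Q V).piece 1 :=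
  mem_convFiltration_one.2 l.2.2

theorem convFiltration_sub_one {f : Conv Q V} :
    f - 1 ∈ (convFiltration Q V).piece 1 ↔ f.ofConv Q.unitI = LinearMap.id := by
  rw [mem_convFiltration_one, WithConv.ofConv_sub, LinearMap.sub_apply, conv_one_apply,
    QuadraticData.counit_unitI, one_smul, sub_eq_zero, Module.End.one_eq_id]

local instance Gauge.instOne : One (Gauge Q V) := ⟨⟨0, hasDegree_zero, rfl⟩⟩

variable (Q V) in
theorem Gauge.convExp_one : convExp (1 : Gauge Q V).1 = 1 := convExp_zero Q V

theorem InfIso.hasDegree (f : InfIso Q V) : HasDegree f.1 0 :=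
  let ⟨_, _, h⟩ := f.2
  h.1.1

theorem InfIso.apply_unitI (f : InfIso Q V) : f.1.ofConv Q.unitI = LinearMap.id :=
  let ⟨_, _, h⟩ := f.2
  h.2

variable [CharZero K]

/-- The logarithm is a left inverse. Through this lemma identities for BCH are read off from the
convolution algebra. -/
theorem Gauge.convExp_injective {x y : Gauge Q V} (h : convExp x.1 = convExp y.1) : x = y := by
  refine Subtype.ext ?_
  rw [← convLog_convExp x.mem, h, convLog_convExp y.mem]

local instance Gauge.instMul : Mul (Gauge Q V) :=
  ⟨fun x y => ⟨convBCH x.1 y.1, hasDegree_convBCH x.2.1 y.2.1,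
    mem_convFiltration_one.1 (convBCH_mem x.1 y.1)⟩⟩

local instance Gauge.instInv : Inv (Gauge Q V) :=
  ⟨fun x => ⟨-x.1, x.2.1.neg, mem_convFiltration_one.1 ((convFiltration Q V).neg_mem x.mem)⟩⟩

theorem Gauge.convExp_mul (x y : Gauge Q V) :
    convExp (x * y).1 = convExp x.1 * convExp y.1 := convExp_convBCH x.mem y.mem

theorem Gauge.convExp_inv_mul (x : Gauge Q V) : convExp x⁻¹.1 * convExp x.1 = 1 :=
  convExp_neg_mul x.mem

theorem Gauge.convExp_mul_inv (x : Gauge Q V) : convExp x.1 * convExp x⁻¹.1 = 1 :=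
  convExp_mul_neg x.mem

/-- The gauge group. -/
local instance Gauge.instGroup : Group (Gauge Q V) :=
  -- No manipulation of the BCH series is needed: exp is injective and turns BCH into an associative
  -- product with unit.
  Group.ofLeftAxioms
    (fun x y z => Gauge.convExp_injective (by simp only [Gauge.convExp_mul, mul_assoc]))
    (fun x => Gauge.convExp_injective (by rw [Gauge.convExp_mul, Gauge.convExp_one, one_mul]))
    (fun x => Gauge.convExp_injective
      (by rw [Gauge.convExp_mul, Gauge.convExp_inv_mul, Gauge.convExp_one]))

local instance MaurerCartan.instSMul : SMul (Gauge Q V) (MaurerCartan Q V) :=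
  ⟨fun l a => ⟨gaugeAct l.1 a.1, l.2.1.gaugeAct_apply a.2.1, gaugeAct_unitI a.2.2.1, by
    rw [maurerCartan_iff (l.2.1.gaugeAct_apply a.2.1), twistedDiff_gaugeAct l.2.1 l.mem]
    exact conj_square_zero (A := Conv Q V) l.convExp_inv_mul ((maurerCartan_iff a.2.1).1 a.2.2.2)⟩⟩

/-- Conjugation by `e^l` determines the twisted differential, and this determines the Maurer-Cartan
element. The action axioms and the comparison with ∞-isotopies both reduce to this intertwining
relation. -/
theorem gauge_smul_eq_iff {l : Gauge Q V} {a b : MaurerCartan Q V} :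
    l • a = b ↔ convExp l.1 * twistedDiff a.1 = twistedDiff b.1 * convExp l.1 := by
  have h : twistedDiff (l • a).1 = convExp l.1 * twistedDiff a.1 * convExp l⁻¹.1 :=
    twistedDiff_gaugeAct l.2.1 l.mem a.1
  rw [← conj_eq_iff l.convExp_mul_inv l.convExp_inv_mul, ← h]
  exact ⟨fun e => by rw [e], fun e => Subtype.ext (twistedDiff_injective e)⟩

local instance MaurerCartan.instMulAction : MulAction (Gauge Q V) (MaurerCartan Q V) where
  one_smul a := gauge_smul_eq_iff.2 (by rw [Gauge.convExp_one, one_mul, mul_one])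
  mul_smul x y a := gauge_smul_eq_iff.2 (by
    rw [Gauge.convExp_mul, mul_assoc, gauge_smul_eq_iff.1 (rfl : y • a = y • a), ← mul_assoc,
      gauge_smul_eq_iff.1 (rfl : x • y • a = x • y • a), mul_assoc])

/-- The logarithm of a map of degree `0` with identity as first component. -/
def gaugeLog (f : Conv Q V) (h : HasDegree f 0) : Gauge Q V :=
  ⟨convLog f, hasDegree_convLog h, mem_convFiltration_one.1 (convLog_mem f)⟩

theorem convExp_gaugeLog {f : Conv Q V} (h : HasDegree f 0) (h' : f.ofConv Q.unitI = LinearMap.id) :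
    convExp (gaugeLog f h).1 = f := convExp_convLog (convFiltration_sub_one.2 h')

/-- The relation defining ∞-morphisms and that of the gauge action are the same equation in the
twisted differentials; the degree and first component of an exponential are automatic. -/
theorem isInfIsotopy_convExp {M N : HomotopyModule Q V} {l : Gauge Q V} :
    IsInfIsotopy M N (convExp l.1) ↔ l • M.toMaurerCartan = N.toMaurerCartan := by
  have hd := hasDegree_convExp l.2.1
  rw [gauge_smul_eq_iff]
  refine Iff.trans ?_ (intertwine_iff hd)
  exact ⟨fun h => h.1.2, fun h => ⟨⟨hd, h⟩, convFiltration_sub_one.1 (convExp_sub_one_mem l.1)⟩⟩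

theorem MaurerCartan.toMaurerCartan_toHomotopyModule (a : MaurerCartan Q V) :
    a.toHomotopyModule.toMaurerCartan = a := Subtype.ext a.twisting_toHomotopyModule

theorem HomotopyModule.toHomotopyModule_toMaurerCartan (M : HomotopyModule Q V) :
    M.toMaurerCartan.toHomotopyModule = M :=
  HomotopyModule.ext_twisting M.toMaurerCartan.twisting_toHomotopyModule

-- The trivial structure always exists on the complex `V`; it serves as a source for arbitrary
-- ∞-isotopies.
local instance MaurerCartan.instZero : Zero (MaurerCartan Q V) :=
  ⟨⟨0, hasDegree_zero, rfl, (maurerCartan_apply_iff rfl).2 fun c => by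
    rw [mul_zero]
    exact (map_zero (endDiff V)).trans neg_zero.symm⟩⟩

/-- Acting on `α = 0` realises any `e^l` as an ∞-isotopy, so exp lands in the set of ∞-isotopies and
that set is all of `exp(g₀)`. -/
theorem exists_isInfIsotopy_convExp (l : Gauge Q V) :
    ∃ M N : HomotopyModule Q V, IsInfIsotopy M N (convExp l.1) :=
  ⟨(0 : MaurerCartan Q V).toHomotopyModule, (l • (0 : MaurerCartan Q V)).toHomotopyModule,
    isInfIsotopy_convExp.2 (by simp only [MaurerCartan.toMaurerCartan_toHomotopyModule])⟩

variable (Q V) in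
/-- The exponential, as a bijection from the gauge group to the ∞-isotopies. -/
def expEquiv : Gauge Q V ≃ InfIso Q V where
  toFun l := ⟨convExp l.1, exists_isInfIsotopy_convExp l⟩
  invFun f := gaugeLog f.1 f.hasDegree
  left_inv l := Subtype.ext (convLog_convExp l.mem)
  right_inv f := Subtype.ext (convExp_gaugeLog f.hasDegree f.apply_unitI)

/-- The group of ∞-isotopies. -/
local instance InfIso.instGroup : Group (InfIso Q V) := (expEquiv Q V).symm.group

/-- The group law is transported from the gauge group; since exp converts BCH into convolution, it
is the convolution product. -/
theorem InfIso.mul_val (f g : InfIso Q V) : (f * g).1 = f.1 * g.1 := by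
  refine (Gauge.convExp_mul _ _).trans ?_
  exact congrArg₂ (· * ·) (convExp_gaugeLog f.hasDegree f.apply_unitI)
    (convExp_gaugeLog g.hasDegree g.apply_unitI)

variable (Q V) in
theorem InfIso.one_val : (1 : InfIso Q V).1 = 1 := Gauge.convExp_one Q V

variable (Q V) in
/-- The exponential, as an isomorphism from the gauge group to the group of ∞-isotopies. -/
def expMulEquiv : Gauge Q V ≃* InfIso Q V := (expEquiv Q V).symm.mulEquiv.symm

/-- The logarithm of an ∞-isotopy. -/
def InfIsotopy.log {M N : HomotopyModule Q V} (f : InfIsotopy M N) : Gauge Q V :=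
  gaugeLog f.1 f.2.1.1

theorem InfIsotopy.convExp_log {M N : HomotopyModule Q V} (f : InfIsotopy M N) :
    convExp f.log.1 = f.1 := convExp_gaugeLog f.2.1.1 f.2.2

theorem InfIsotopy.log_smul {M N : HomotopyModule Q V} (f : InfIsotopy M N) :
    f.log • M.toMaurerCartan = N.toMaurerCartan :=
  isInfIsotopy_convExp.1 (by rw [f.convExp_log]; exact f.2)

/-- The ∞-isotopy `e^λ` between `α` and `λ.α`. -/
def InfIsotopy.exp {M N : HomotopyModule Q V} (l : Gauge Q V)
    (h : l • M.toMaurerCartan = N.toMaurerCartan) : InfIsotopy M N :=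
  ⟨convExp l.1, isInfIsotopy_convExp.2 h⟩

/-- The identity ∞-isotopy. -/
def InfIsotopy.id (M : HomotopyModule Q V) : InfIsotopy M M :=
  ⟨1, by
    rw [← Gauge.convExp_one]
    exact isInfIsotopy_convExp.2 (one_smul _ _)⟩

/-- The composite of ∞-isotopies. -/
def InfIsotopy.comp {L M N : HomotopyModule Q V} (f : InfIsotopy L M) (g : InfIsotopy M N) :
    InfIsotopy L N :=
  ⟨g.1 * f.1, by
    rw [← g.convExp_log, ← f.convExp_log, ← Gauge.convExp_mul]
    exact isInfIsotopy_convExp.2 (by rw [mul_smul, f.log_smul, g.log_smul])⟩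

/-- The inverse ∞-isotopy. -/
def InfIsotopy.inv {M N : HomotopyModule Q V} (f : InfIsotopy M N) : InfIsotopy N M :=
  InfIsotopy.exp f.log⁻¹ (by rw [← f.log_smul, inv_smul_smul])

/-- The groupoid of homotopy modules and ∞-isotopies. -/
local instance HomotopyModule.instGroupoid : Groupoid.{max u v w} (HomotopyModule Q V) where
  Hom := InfIsotopy
  id := InfIsotopy.id
  comp := InfIsotopy.comp
  id_comp f := Subtype.ext (mul_one f.1)
  comp_id f := Subtype.ext (one_mul f.1)
  assoc f g h := Subtype.ext (mul_assoc h.1 g.1 f.1).symm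
  inv := InfIsotopy.inv
  inv_comp f := Subtype.ext (by
    have h := f.log.convExp_mul_inv
    rw [f.convExp_log] at h
    exact h)
  comp_inv f := Subtype.ext (by
    have h := f.log.convExp_inv_mul
    rw [f.convExp_log] at h
    exact h)

/-- Going round the two functors fixes objects only up to propositional equality, so comparing
morphisms involves transports; these do not change the underlying map. -/
theorem InfIsotopy.conj_eqToHom_val {M M' N N' : HomotopyModule Q V} (h : M = M') (f : M' ⟶ N')
    (h' : N' = N) :
    (show InfIsotopy M N from eqToHom h ≫ f ≫ eqToHom h').1 = (show InfIsotopy M' N' from f).1 := by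
  cases h
  cases h'
  rw [eqToHom_refl, eqToHom_refl, Category.id_comp, Category.comp_id]

theorem actionCategory_conj_eqToHom_val {a a' b b' : ActionCategory (Gauge Q V) (MaurerCartan Q V)}
    (h : a = a') (l : a' ⟶ b') (h' : b' = b) : (eqToHom h ≫ l ≫ eqToHom h').1 = l.1 := by
  cases h
  cases h'
  rw [eqToHom_refl, eqToHom_refl, Category.id_comp, Category.comp_id]

variable (Q V) in
/-- The functor `α ↦ ρ`, `λ ↦ e^λ` from the Deligne groupoid to homotopy modules. -/
def deligneFunctor : ActionCategory (Gauge Q V) (MaurerCartan Q V) ⥤ HomotopyModule Q V where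
  obj a := a.back.toHomotopyModule
  map {a b} l := InfIsotopy.exp l.1 (by
    rw [MaurerCartan.toMaurerCartan_toHomotopyModule, MaurerCartan.toMaurerCartan_toHomotopyModule]
    exact l.2)
  map_id a := Subtype.ext (Gauge.convExp_one Q V)
  -- Composition in the action category multiplies the later element on the left, in agreement with
  -- the composite `g ⋆ f` of ∞-isotopies.
  map_comp l m := Subtype.ext (Gauge.convExp_mul m.1 l.1)

variable (Q V) in
/-- The functor `ρ ↦ α`, `f ↦ log f` from homotopy modules to the Deligne groupoid. -/
def deligneInverse : HomotopyModule Q V ⥤ ActionCategory (Gauge Q V) (MaurerCartan Q V) where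
  obj M := (M.toMaurerCartan : ActionCategory (Gauge Q V) (MaurerCartan Q V))
  map f := ⟨InfIsotopy.log f, InfIsotopy.log_smul f⟩
  map_id M := Subtype.ext (Gauge.convExp_injective
    ((InfIsotopy.convExp_log (𝟙 M)).trans (Gauge.convExp_one Q V).symm))
  map_comp f g := Subtype.ext (Gauge.convExp_injective
    ((InfIsotopy.convExp_log (f ≫ g)).trans ((congrArg₂ (· * ·) (InfIsotopy.convExp_log g).symm
      (InfIsotopy.convExp_log f).symm).trans (Gauge.convExp_mul _ _).symm)))

variable (Q V) in
theorem deligneFunctor_comp_inverse : deligneFunctor Q V ⋙ deligneInverse Q V = 𝟭 _ := by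
  have hobj : ∀ a, (deligneFunctor Q V ⋙ deligneInverse Q V).obj a = a := fun a =>
    (congrArg (fun x : MaurerCartan Q V => (x : ActionCategory (Gauge Q V) (MaurerCartan Q V)))
      a.back.toMaurerCartan_toHomotopyModule).trans a.back_coe
  refine CategoryTheory.Functor.ext hobj fun a b l => Subtype.ext ?_
  refine Eq.trans ?_ (actionCategory_conj_eqToHom_val (hobj a) l (hobj b).symm).symm
  exact Gauge.convExp_injective (InfIsotopy.convExp_log ((deligneFunctor Q V).map l))

variable (Q V) in
theorem deligneInverse_comp_functor : deligneInverse Q V ⋙ deligneFunctor Q V = 𝟭 _ := by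
  have hobj : ∀ M, (deligneInverse Q V ⋙ deligneFunctor Q V).obj M = M := fun M =>
    M.toHomotopyModule_toMaurerCartan
  refine CategoryTheory.Functor.ext hobj fun M N f => Subtype.ext ?_
  refine Eq.trans ?_ (InfIsotopy.conj_eqToHom_val (hobj M) f (hobj N).symm).symm
  exact InfIsotopy.convExp_log f

end DeligneGroupoid

end KoszulDeligne

theorem mainTheorem5 {K : Type u} [Field K] [CharZero K] (Q : QuadraticData.{u, v} K)
    (hQ : Q.IsKoszul) (V : ChainComplex (ModuleCat.{w} K) ℤ) :
    ∃ (_ : Group (Gauge Q V)) (_ : Group (InfIso Q V)),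
      -- the gauge group `Γ = (g₀, BCH, 0)`
      (∀ x y : Gauge Q V, (x * y).1 = convBCH x.1 y.1) ∧ (1 : Gauge Q V).1 = 0 ∧
      -- the group `(∞-iso, ⋆, id_V)`
      (∀ f g : InfIso Q V, (f * g).1 = convStar 0 f.1 g.1) ∧ (1 : InfIso Q V).1 = 1 ∧
      -- they are isomorphic under the exponential map
      (∃ e : Gauge Q V ≃* InfIso Q V, ∀ l, (e l).1 = convExp l.1) ∧
      -- the gauge group acts on the Maurer-Cartan elements
      ∃ (_ : MulAction (Gauge Q V) (MaurerCartan Q V)),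
        (∀ (l : Gauge Q V) (a : MaurerCartan Q V), (l • a).1 = gaugeAct l.1 a.1) ∧
        -- the groupoid of homotopy modules and ∞-isotopies
        ∃ (_ : Groupoid.{max u v w} (HomotopyModule Q V))
          (j : ∀ M N : HomotopyModule Q V, (M ⟶ N) ≃ InfIsotopy M N),
          (∀ M, (j M M (𝟙 M)).1 = 1) ∧
          (∀ (L M N : HomotopyModule Q V) (f : L ⟶ M) (g : M ⟶ N),
            (j L N (f ≫ g)).1 = convStar 0 (j M N g).1 (j L M f).1) ∧
          -- the Deligne groupoid is isomorphic to it
          ∃ (F : ActionCategory (Gauge Q V) (MaurerCartan Q V) ⥤ HomotopyModule Q V)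
            (G : HomotopyModule Q V ⥤ ActionCategory (Gauge Q V) (MaurerCartan Q V)),
            F ⋙ G = 𝟭 _ ∧ G ⋙ F = 𝟭 _ ∧
            (∀ a, (F.obj a).twisting = a.back.1) ∧
            (∀ (a b : ActionCategory (Gauge Q V) (MaurerCartan Q V)) (l : a ⟶ b),
              (j _ _ (F.map l)).1 = convExp l.1.1) := by
  refine ⟨Gauge.instGroup, InfIso.instGroup, fun _ _ => rfl, rfl,
    fun f g => (InfIso.mul_val f g).trans (convStar_zero f.1 g.1).symm, InfIso.one_val Q V,
    ⟨expMulEquiv Q V, fun _ => rfl⟩, MaurerCartan.instMulAction, fun _ _ => rfl,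
    HomotopyModule.instGroupoid,
    fun _ _ => Equiv.refl _, fun _ => rfl, fun _ _ _ f g => (convStar_zero g.1 f.1).symm,
    deligneFunctor Q V, deligneInverse Q V, deligneFunctor_comp_inverse Q V,
    deligneInverse_comp_functor Q V, fun _ => MaurerCartan.twisting_toHomotopyModule _,
    fun _ _ _ => rfl⟩
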